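/- Let $H$ be a finite graph without isolated vertices. For a finite graph $G$, let $\langle G\rangle_H$ be the graph obtained from $G_0=G$ by repeatedly adding, for $t\ge 1$, to $G_{t-1}$ every edge $e$ of the complete graph on $V(G)$ such that $H_e\setminus e\subseteq G_{t-1}$ for some copy $H_e$ of $H$ in that complete graph containing $e$. Let $\mathcal A(H)$ be the set of pairs $(e,A)$ where $A$ is a finite graph and $e$ is an edge of $\langle A\rangle_H\setminus A$, and put $$\rho(H)=\inf_{(e,A)\in\mathcal A(H)}\ \max_{e\subset F\subseteq A\cup e}\frac{e(F)-1}{v(F)-2}\in[0,\infty],$$ where $e(F),v(F)$ denote the numbers of edges and vertices of $F$, the maximum is over subgraphs $F\ne e$ (an empty maximum is $0$), and $\inf\emptyset=\infty$. Let $G(n,p)$ be the binomial random graph on $n$ vertices and $p_c(n,H)=\inf\{p>0:\mathbb P(\langle G(n,p)\rangle_H=K_n)\ge 1/2\}$. Suppose that $\rho=\rho(H)>1$. (1) As $n\to\infty$, $n^{1/\rho}p_c(n,H)=\Omega(1/\log n)$ and $n^{1/\rho}p_c(n,H)=O(\log^2 n)$ (with $1/\rho=0$ if $\rho=\infty$,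 i.e. if $H$ has no edges). Suppose moreover that $\rho<\infty$. Then the following hold. (2) There is $\varepsilon_0=\varepsilon_0(H)>0$ such that, for every constant $0<\varepsilon<\varepsilon_0$, if $p=p(n)\in[0,1]$ satisfies $np^\rho\log^\rho n=\varepsilon$ for all large $n$, then $\langle G(n,p)\rangle_H\ne K_n$ with probability tending to $1$ as $n\to\infty$. (3) If $\rho$ is rational, let $a/b$ be its expression as an irreducible fraction (with $b\ge1$); if $\rho$ is irrational, let $b\ge 1$ be any integer. There is $A_0=A_0(H,b)>0$ such that, for every constant $A\ge A_0$, if $p=p(n)\in[0,1]$ satisfies $np^\rho=A\log^{2+2/b}n$ for all large $n$, then $\langle G(n,p)\rangle_H=K_n$ with probability tending to $1$ as $n\to\infty$. -/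

import Mathlib

open scoped ENNReal unitInterval

noncomputable section

namespace GraphBootstrap

/-- `e` is an edge of some copy of `H` in the complete graph on `V` (the image of `H` under an
injection of the vertices), all of whose other edges belong to `G`. -/
def CompletesCopy {W V : Type*} (H : SimpleGraph W) (G : SimpleGraph V) (e : Sym2 V) : Prop :=
  ∃ φ : W ↪ V, e ∈ (H.map φ).edgeSet ∧ (H.map φ).edgeSet \ {e} ⊆ G.edgeSet

/-- One step of the `H`-dynamics: add to `G` all edges that complete a copy of `H`. -/
def step {W V : Type*} (H : SimpleGraph W) (G : SimpleGraph V) : SimpleGraph V :=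
  G ⊔ SimpleGraph.fromEdgeSet {e | CompletesCopy H G e}

/-- The graph `⟨G⟩_H = ⋃ t, G_t` of all eventually active edges, where `G_0 = G`. -/
def hClosure {W V : Type*} (H : SimpleGraph W) (G : SimpleGraph V) : SimpleGraph V :=
  ⨆ t : ℕ, (step H)^[t] G

/-- The graph `A ∪ e`. -/
def addEdge {V : Type*} (A : SimpleGraph V) (e : Sym2 V) : SimpleGraph V :=
  A ⊔ SimpleGraph.fromEdgeSet {e}

/-- The maximum of `(e(F) - 1) / (v(F) - 2)` over all subgraphs `e ⊂ F ⊆ A ∪ e`. The condition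
`3 ≤ v(F)` says that `F` is not `e` itself. (The maximum over the empty family is `0`.) -/
def rootedDensity {V : Type*} (A : SimpleGraph V) (e : Sym2 V) : ℝ≥0∞ :=
  ⨆ (F : (addEdge A e).Subgraph) (_ : e ∈ F.edgeSet) (_ : 3 ≤ F.verts.ncard),
    ((F.edgeSet.ncard : ℝ≥0∞) - 1) / ((F.verts.ncard : ℝ≥0∞) - 2)

/-- The critical `H`-activation density `ρ(H)`: the infimum of `rootedDensity A e` over all finite
graphs `A` and all edges `e` of `⟨A⟩_H` that are not in `A`. It is `∞` if there are no such pairs. -/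
def activationDensity {W : Type*} (H : SimpleGraph W) : ℝ≥0∞ :=
  ⨅ (V : Type) (_ : Finite V) (A : SimpleGraph V) (e : Sym2 V)
    (_ : e ∈ (hClosure H A).edgeSet \ A.edgeSet), rootedDensity A e

/-- The probability that the random graph `G(n,p)` `H`-percolates, i.e. that
`⟨G(n,p)⟩_H = K_n`. -/
def percProb {W : Type*} (H : SimpleGraph W) (n : ℕ) (p : I) : ℝ :=
  (SimpleGraph.binomialRandom (Fin n) p).real {G | hClosure H G = ⊤}

/-- The critical `H`-percolation threshold
`p_c(n,H) = inf {p > 0 : P(⟨G(n,p)⟩_H = K_n) ≥ 1/2}`. -/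
def pc {W : Type*} (n : ℕ) (H : SimpleGraph W) : ℝ :=
  sInf {x : ℝ | ∃ p : I, (p : ℝ) = x ∧ 0 < x ∧ 1 / 2 ≤ percProb H n p}

end GraphBootstrap

end

/-! Both bounds rest on the excess `h(X) = e(X) - ρ v(X)`, which is supermodular. Hence a vertex set
S has a core, the largest maximiser of h among its supersets of bounded size. Cores grow with S, and
whatever hangs on a core adds at most ρ edges per vertex.

Lower bound. Let L be about log n. If n (p log n)^ρ is small, then with high probability no set of
between L and 2L vertices has excess above a negative constant (`bprob_exists_le_excess_le`), and
this gap makes cores of size at most L exist. Then every active edge is activated by a graph made of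
its core and of new vertices that span fewer than ρ edges each (`exists_sparseExt_of_mem_hClosure`):
given a copy of H, glue the graphs activating its other edges, then detach all vertices outside the
core of the new edge. By definition of ρ this graph has a subgraph of rooted density at least ρ; the
sparse new part cannot account for it, so the edge lies in a dense set of at most L vertices of
G(n,p) itself (`exists_dense_of_mem_hClosure`). For a fixed pair this has probability O(1/log n)
(`bprob_exists_dense_le`).

Upper bound. Let A witness an activation density below ρ₁ = ρ + 1/log n, and put ρ₂ = ρ + 2/log n.
The graph A may be huge, but the ρ₂-core of the vertices of a copy of H in A has only O(log n)
vertices. To activate the image of an edge it suffices to embed its core, and a core over a smaller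
core is a sparse rooted graph of size O(log n). If G contains all such extensions over all
placements of the roots, it percolates, because the core of the witness edge is just its two
endpoints (`hClosure_eq_top_of_hasSparseExtensions`).

The extensions are found by Janson's inequality. There are exp(O(log² n)) rooted graphs and
placements, so the second-moment sum must be O(1/log² n). Overlaps in z < b new vertices gain a
power of p, as ρ z is not an integer; overlaps in z ≥ b vertices contribute about (log² n / (n
p^ρ))^z. This is why n p^ρ must exceed log n to the power 2 + 2/b. -/

namespace GraphBootstrap

/-! ### Random subsets with independent elements, the Harris and Janson inequalities -/

section RandomSubset

variable {α : Type*} [Fintype α] [DecidableEq α]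

/-- The weight of `S` in the random subset containing each `e` independently with
probability `q e`. -/
def bweight (q : α → ℝ) (S : Finset α) : ℝ := ∏ e, if e ∈ S then q e else 1 - q e

open Classical in
/-- The probability that the random subset with inclusion probabilities `q` satisfies `Q`. -/
noncomputable def bprob (q : α → ℝ) (Q : Finset α → Prop) : ℝ := ∑ S, if Q S then bweight q S else 0

lemma bweight_nonneg {q : α → ℝ} (h0 : ∀ e, 0 ≤ q e) (h1 : ∀ e, q e ≤ 1) (S : Finset α) :
    0 ≤ bweight q S := by
  refine Finset.prod_nonneg fun e _ => ?_
  split_ifs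
  · exact h0 e
  · linarith [h1 e]

lemma sum_bweight (q : α → ℝ) : ∑ S, bweight q S = 1 := by
  have h := Finset.prod_add q (fun e => 1 - q e) (Finset.univ : Finset α)
  simp only [add_sub_cancel, Finset.prod_const_one, Finset.powerset_univ] at h
  rw [h]
  refine Finset.sum_congr rfl fun S _ => ?_
  rw [bweight, Finset.prod_ite]
  congr 1
  · exact Finset.prod_congr (by ext; simp) fun _ _ => rfl
  · exact Finset.prod_congr (by ext; simp) fun _ _ => rfl

/-- Pairing S with `insert e S` conditions on a single element; this is how independence enters. -/
lemma sum_finset_eq_sum_notMem (e : α) (f : Finset α → ℝ) :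
    ∑ S, f S = ∑ S ∈ (Finset.univ.erase e).powerset, (f S + f (insert e S)) := by
  rw [← Finset.powerset_univ, ← Finset.insert_erase (Finset.mem_univ e),
    Finset.sum_powerset_insert (Finset.notMem_erase e _), Finset.sum_add_distrib]
  simp

lemma bweight_insert (q : α → ℝ) (e : α) (S : Finset α) :
    bweight q (insert e S) = q e * ∏ x ∈ Finset.univ.erase e, if x ∈ S then q x else 1 - q x := by
  rw [bweight, ← Finset.mul_prod_erase _ _ (Finset.mem_univ e)]
  congr 1
  · simp
  · refine Finset.prod_congr rfl fun x hx => ?_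
    simp [Finset.ne_of_mem_erase hx]

lemma bweight_notMem (q : α → ℝ) {e : α} {S : Finset α} (h : e ∉ S) :
    bweight q S = (1 - q e) * ∏ x ∈ Finset.univ.erase e, if x ∈ S then q x else 1 - q x := by
  rw [bweight, ← Finset.mul_prod_erase _ _ (Finset.mem_univ e)]
  simp [h]

lemma bprob_nonneg {q : α → ℝ} (h0 : ∀ e, 0 ≤ q e) (h1 : ∀ e, q e ≤ 1) (Q : Finset α → Prop) :
    0 ≤ bprob q Q := by
  refine Finset.sum_nonneg fun S _ => ?_
  split_ifs
  exacts [bweight_nonneg h0 h1 S, le_rfl]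

lemma bprob_mono {q : α → ℝ} (h0 : ∀ e, 0 ≤ q e) (h1 : ∀ e, q e ≤ 1) {Q Q' : Finset α → Prop}
    (h : ∀ S, Q S → Q' S) : bprob q Q ≤ bprob q Q' := by
  refine Finset.sum_le_sum fun S _ => ?_
  have := bweight_nonneg h0 h1 S
  by_cases hQ : Q S
  · simp [hQ, h S hQ]
  · simp only [hQ, if_false]; split_ifs <;> linarith

lemma bprob_congr (q : α → ℝ) {Q Q' : Finset α → Prop}
    (h : ∀ S, Q S ↔ Q' S) : bprob q Q = bprob q Q' := by
  rw [show Q = Q' from funext fun S => propext (h S)]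

lemma bprob_not (q : α → ℝ) (Q : Finset α → Prop) :
    bprob q (fun S => ¬ Q S) = 1 - bprob q Q := by
  rw [← sum_bweight q, bprob, bprob, ← Finset.sum_sub_distrib]
  refine Finset.sum_congr rfl fun S _ => ?_
  by_cases h : Q S <;> simp [h]

lemma bprob_true (q : α → ℝ) : bprob q (fun _ => True) = 1 := by
  simp [bprob, sum_bweight]

lemma bprob_and_add_and_not (q : α → ℝ) (Q R : Finset α → Prop) :
    bprob q (fun S => Q S ∧ R S) + bprob q (fun S => Q S ∧ ¬ R S) = bprob q Q := by
  rw [bprob, bprob, bprob, ← Finset.sum_add_distrib]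
  refine Finset.sum_congr rfl fun S _ => ?_
  by_cases h : Q S <;> by_cases h' : R S <;> simp [h, h']

lemma bprob_exists_le {q : α → ℝ} (h0 : ∀ e, 0 ≤ q e) (h1 : ∀ e, q e ≤ 1) {ι : Type*}
    (s : Finset ι) (Q : ι → Finset α → Prop) :
    bprob q (fun S => ∃ i ∈ s, Q i S) ≤ ∑ i ∈ s, bprob q (Q i) := by
  classical
  simp only [bprob]
  rw [Finset.sum_comm]
  refine Finset.sum_le_sum fun S _ => ?_
  have hw := bweight_nonneg h0 h1 S
  split_ifs with h
  · obtain ⟨i, hi, hQ⟩ := h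
    refine le_trans ?_ (Finset.single_le_sum (f := fun i => if Q i S then bweight q S else 0)
      (fun j _ => by split_ifs <;> simp [hw]) hi)
    simp [hQ]
  · exact Finset.sum_nonneg fun j _ => by split_ifs <;> simp [hw]

lemma bprob_or_le {q : α → ℝ} (h0 : ∀ e, 0 ≤ q e) (h1 : ∀ e, q e ≤ 1)
    (Q R : Finset α → Prop) :
    bprob q (fun S => Q S ∨ R S) ≤ bprob q Q + bprob q R := by
  simp only [bprob]
  rw [← Finset.sum_add_distrib]
  refine Finset.sum_le_sum fun S _ => ?_
  have hw := bweight_nonneg h0 h1 S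
  by_cases h : Q S <;> by_cases h' : R S <;> simp [h, h', hw]

lemma bprob_mem_and (q : α → ℝ) (e : α) (Q : Finset α → Prop)
    (hQ : ∀ S, Q (insert e S) ↔ Q S) :
    bprob q (fun S => e ∈ S ∧ Q S) = q e * bprob q Q := by
  rw [bprob, bprob, sum_finset_eq_sum_notMem e, sum_finset_eq_sum_notMem e, Finset.mul_sum]
  refine Finset.sum_congr rfl fun S hS => ?_
  have he : e ∉ S := fun h => by simpa using Finset.mem_powerset.1 hS h
  rw [bweight_insert q e, bweight_notMem q he]
  by_cases h : Q S
  · simp only [Finset.mem_insert_self, hQ, h, he, and_self, false_and, if_true, if_false]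
    ring
  · simp [h, hQ, he]

lemma bprob_subset_and (q : α → ℝ) (T : Finset α) (Q : Finset α → Prop)
    (hQ : ∀ e ∈ T, ∀ S, Q (insert e S) ↔ Q S) :
    bprob q (fun S => T ⊆ S ∧ Q S) = (∏ e ∈ T, q e) * bprob q Q := by
  induction T using Finset.induction_on with
  | empty => simp
  | insert a T ha ih =>
    rw [Finset.prod_insert ha, mul_assoc, ← ih fun e he => hQ e (Finset.mem_insert_of_mem he),
      ← bprob_mem_and q a]
    · exact bprob_congr q fun S => by rw [Finset.insert_subset_iff, and_assoc]
    · intro S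
      rw [hQ a (Finset.mem_insert_self a T), Finset.subset_insert_iff_of_notMem ha]

lemma bprob_subset (q : α → ℝ) (T : Finset α) :
    bprob q (fun S => T ⊆ S) = ∏ e ∈ T, q e := by
  simpa [bprob_true] using bprob_subset_and q T (fun _ => True) (by simp)

/-- The Harris inequality for an increasing and a decreasing event. -/
lemma bprob_and_le_mul {q : α → ℝ} (h0 : ∀ e, 0 ≤ q e) (h1 : ∀ e, q e ≤ 1)
    {Q R : Finset α → Prop} (hQ : Monotone Q) (hR : Antitone R) :
    bprob q (fun S => Q S ∧ R S) ≤ bprob q Q * bprob q R := by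
  classical
  -- FKG for the increasing indicators of Q and of the complement of R; product weights satisfy the
  -- lattice condition with equality.
  have key := fkg (μ := bweight q) (f := fun S => if Q S then 1 else 0)
    (g := fun S => if R S then 0 else 1) (bweight_nonneg h0 h1)
    (fun S => by dsimp only [Pi.zero_apply]; split_ifs <;> simp)
    (fun S => by dsimp only [Pi.zero_apply]; split_ifs <;> simp)
    (fun S S' h => by
      dsimp only
      by_cases h' : Q S
      · simp [h', hQ h h']
      · simp only [h', if_false]; split_ifs <;> simp)
    (fun S S' h => by
      dsimp only
      by_cases h' : R S'
      · simp [h', hR h h']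
      · simp only [h', if_false]; split_ifs <;> simp)
    (fun S S' => by
      rw [bweight, bweight, bweight, bweight, ← Finset.prod_mul_distrib,
        ← Finset.prod_mul_distrib]
      refine le_of_eq (Finset.prod_congr rfl fun e _ => ?_)
      by_cases h : e ∈ S <;> by_cases h' : e ∈ S' <;> simp [h, h', mul_comm])
  rw [sum_bweight, one_mul] at key
  have e1 : ∑ S, bweight q S * (if Q S then (1 : ℝ) else 0) = bprob q Q := by
    rw [bprob]; exact Finset.sum_congr rfl fun S _ => by by_cases h : Q S <;> simp [h]
  have e2 : ∑ S, bweight q S * (if R S then (0 : ℝ) else 1) = bprob q (fun S => ¬ R S) := by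
    rw [bprob]; exact Finset.sum_congr rfl fun S _ => by by_cases h : R S <;> simp [h]
  have e3 : ∑ S, bweight q S * ((if Q S then (1 : ℝ) else 0) * if R S then 0 else 1) =
      bprob q (fun S => Q S ∧ ¬ R S) := by
    rw [bprob]
    exact Finset.sum_congr rfl fun S _ => by by_cases h : R S <;> by_cases h' : Q S <;> simp [h, h']
  rw [e1, e2, e3, bprob_not] at key
  have := bprob_and_add_and_not q Q R
  nlinarith

/-- The first-moment step in the proof of Janson's inequality, following Boppana and Spencer. -/
lemma bprob_avoid_insert_le {q : α → ℝ} (h0 : ∀ e, 0 ≤ q e) (h1 : ∀ e, q e ≤ 1) {ι : Type*}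
    [DecidableEq ι] (T : ι → Finset α) (R : ι → ι → Prop) [DecidableRel R]
    (hR : ∀ i j, ¬ R i j → Disjoint (T i) (T j)) (s : Finset ι) (i : ι) :
    bprob q (fun S => ∀ j ∈ insert i s, ¬ T j ⊆ S) ≤
      bprob q (fun S => ∀ j ∈ s, ¬ T j ⊆ S) *
        Real.exp (-∏ e ∈ T i, q e + ∑ j ∈ s with R i j, ∏ e ∈ T i ∪ T j, q e) := by
  set a := ∏ e ∈ T i, q e
  set b := ∑ j ∈ s with R i j, ∏ e ∈ T i ∪ T j, q e
  set P := bprob q (fun S => ∀ j ∈ s, ¬ T j ⊆ S)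
  have hP : 0 ≤ P := bprob_nonneg h0 h1 _
  have hsplit : bprob q (fun S => ∀ j ∈ insert i s, ¬ T j ⊆ S) =
      P - bprob q (fun S => (∀ j ∈ s, ¬ T j ⊆ S) ∧ T i ⊆ S) := by
    have h := bprob_and_add_and_not q (fun S => ∀ j ∈ s, ¬ T j ⊆ S) (fun S => T i ⊆ S)
    rw [eq_sub_iff_add_eq, add_comm]
    refine Eq.trans ?_ h
    rw [add_right_inj]
    exact bprob_congr q fun S => by simp [and_comm]
  have key : P * (a - b) ≤ bprob q (fun S => (∀ j ∈ s, ¬ T j ⊆ S) ∧ T i ⊆ S) := by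
    rcases le_or_gt (a - b) 0 with hab | hab
    · exact le_trans (mul_nonpos_of_nonneg_of_nonpos hP hab) (bprob_nonneg h0 h1 _)
    -- E keeps only the constraints unrelated to i: it is independent of `T i ⊆ S`, it is
    -- decreasing, and it contains the avoidance event.
    set E : Finset α → Prop := fun S => ∀ j ∈ s, ¬ R i j → ¬ T j ⊆ S with hE
    have hEanti : Antitone E := fun S S' h hS j hj hr hT => hS j hj hr (hT.trans h)
    have hPE : P ≤ bprob q E := bprob_mono h0 h1 fun S hS j hj _ => hS j hj
    have e1 : bprob q (fun S => T i ⊆ S ∧ E S) = a * bprob q E := by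
      refine bprob_subset_and q _ _ fun e he S => ?_
      refine forall_congr' fun j => forall_congr' fun _ => forall_congr' fun hr => ?_
      rw [Finset.subset_insert_iff_of_notMem
        (fun hej => Finset.disjoint_left.1 (hR i j hr) he hej)]
    have e2 : bprob q (fun S => (T i ⊆ S ∧ E S) ∧ ¬ ∀ j ∈ s, ¬ T j ⊆ S) ≤ b * bprob q E := by
      calc _ ≤ bprob q (fun S => ∃ j ∈ s.filter (R i), T i ∪ T j ⊆ S ∧ E S) := by
            refine bprob_mono h0 h1 fun S ⟨⟨hT, hES⟩, hn⟩ => ?_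
            push Not at hn
            obtain ⟨j, hj, hTj⟩ := hn
            exact ⟨j, Finset.mem_filter.2 ⟨hj, by_contra fun hr => hES j hj hr hTj⟩,
              Finset.union_subset hT hTj, hES⟩
        _ ≤ ∑ j ∈ s.filter (R i), bprob q (fun S => T i ∪ T j ⊆ S ∧ E S) :=
            bprob_exists_le h0 h1 _ _
        _ ≤ ∑ j ∈ s.filter (R i), (∏ e ∈ T i ∪ T j, q e) * bprob q E := by
            refine Finset.sum_le_sum fun j _ => ?_
            rw [← bprob_subset]
            -- Harris: containing `T i ∪ T j` is increasing while E is decreasing.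
            exact bprob_and_le_mul h0 h1 (fun S S' h hS => hS.trans h) hEanti
        _ = _ := by rw [Finset.sum_mul]
    have e3 := bprob_and_add_and_not q (fun S => T i ⊆ S ∧ E S) (fun S => ∀ j ∈ s, ¬ T j ⊆ S)
    have e4 : bprob q (fun S => (T i ⊆ S ∧ E S) ∧ ∀ j ∈ s, ¬ T j ⊆ S) ≤
        bprob q (fun S => (∀ j ∈ s, ¬ T j ⊆ S) ∧ T i ⊆ S) :=
      bprob_mono h0 h1 fun S h => ⟨h.2, h.1.1⟩
    have : P * (a - b) ≤ bprob q E * (a - b) := mul_le_mul_of_nonneg_right hPE hab.le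
    linarith
  rw [hsplit]
  have hexp := Real.add_one_le_exp (-a + b)
  calc _ ≤ P * (-a + b + 1) := by linarith
    _ ≤ _ := mul_le_mul_of_nonneg_left hexp hP

/-- Multiplying the one-step bounds, an unordered pair is charged once, when its later index is
inserted; the double sum counts it twice, hence the division by 2. -/
lemma bprob_avoid_le {q : α → ℝ} (h0 : ∀ e, 0 ≤ q e) (h1 : ∀ e, q e ≤ 1) {ι : Type*}
    [DecidableEq ι] (T : ι → Finset α) (R : ι → ι → Prop) [DecidableRel R]
    (hsymm : ∀ i j, R i j → R j i)
    (hR : ∀ i j, ¬ R i j → Disjoint (T i) (T j)) (s : Finset ι) :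
    bprob q (fun S => ∀ j ∈ s, ¬ T j ⊆ S) ≤
      Real.exp (-∑ i ∈ s, ∏ e ∈ T i, q e +
        (∑ i ∈ s, ∑ j ∈ s, if i ≠ j ∧ R i j then ∏ e ∈ T i ∪ T j, q e else 0) / 2) := by
  induction s using Finset.induction_on with
  | empty => simp [bprob_true]
  | insert i s hi ih =>
    refine (bprob_avoid_insert_le h0 h1 T R hR s i).trans ?_
    refine (mul_le_mul_of_nonneg_right ih (Real.exp_nonneg _)).trans ?_
    rw [← Real.exp_add]
    refine Real.exp_le_exp.2 (le_of_eq ?_)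
    have e1 : ∑ j ∈ s, (if i ≠ j ∧ R i j then ∏ e ∈ T i ∪ T j, q e else 0) =
        ∑ j ∈ s with R i j, ∏ e ∈ T i ∪ T j, q e := by
      rw [Finset.sum_filter]
      refine Finset.sum_congr rfl fun j hj => ?_
      have : i ≠ j := fun h => hi (h ▸ hj)
      simp [this]
    have e2 : ∑ j ∈ s, (if j ≠ i ∧ R j i then ∏ e ∈ T j ∪ T i, q e else 0) =
        ∑ j ∈ s with R i j, ∏ e ∈ T i ∪ T j, q e := by
      rw [← e1]
      refine Finset.sum_congr rfl fun j hj => ?_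
      rw [Finset.union_comm]
      exact if_congr (and_congr ne_comm ⟨hsymm _ _, hsymm _ _⟩) rfl rfl
    simp only [Finset.sum_insert hi, Finset.sum_add_distrib, e1, e2]
    simp
    ring

/-- The left side is the expectation of the right side for a random s containing each index with
probability θ; as b vanishes on the diagonal, every quadratic term has weight θ². -/
lemma exists_subset_quadratic_ge {ι : Type*} [Fintype ι] [DecidableEq ι] (a : ι → ℝ)
    (b : ι → ι → ℝ) (hb : ∀ i, b i i = 0) {θ : ℝ} (hθ0 : 0 ≤ θ) (hθ1 : θ ≤ 1) :
    ∃ s : Finset ι, θ * ∑ i, a i - θ ^ 2 * ∑ i, ∑ j, b i j ≤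
      ∑ i ∈ s, a i - ∑ i ∈ s, ∑ j ∈ s, b i j := by
  set q : ι → ℝ := fun _ => θ
  have hw := fun S => bweight_nonneg (q := q) (fun _ => hθ0) (fun _ => hθ1) S
  have hT : ∀ T : Finset ι, ∑ S, (if T ⊆ S then bweight q S else 0) = θ ^ T.card := by
    intro T
    have := bprob_subset q T
    rw [Finset.prod_const] at this
    rw [← this, bprob]
    exact Finset.sum_congr rfl fun S _ => by congr
  by_contra! h
  have h2 : ∑ S, bweight q S * (∑ i ∈ S, a i - ∑ i ∈ S, ∑ j ∈ S, b i j) <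
      ∑ S, bweight q S * (θ * ∑ i, a i - θ ^ 2 * ∑ i, ∑ j, b i j) := by
    refine Finset.sum_lt_sum (fun S _ => mul_le_mul_of_nonneg_left (h S).le (hw S)) ?_
    by_contra! h3
    have : ∑ S, bweight q S ≤ 0 := Finset.sum_nonpos fun S hS => by
      have := h3 S hS
      nlinarith [h S, hw S]
    rw [sum_bweight] at this
    linarith
  rw [← Finset.sum_mul, sum_bweight, one_mul] at h2
  refine absurd h2 (not_lt.2 (le_of_eq ?_))
  have e1 : ∀ S : Finset ι, bweight q S * (∑ i ∈ S, a i - ∑ i ∈ S, ∑ j ∈ S, b i j) =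
      ∑ i, a i * (if {i} ⊆ S then bweight q S else 0) -
        ∑ i, ∑ j, b i j * (if {i, j} ⊆ S then bweight q S else 0) := by
    intro S
    rw [mul_sub, Finset.mul_sum, Finset.mul_sum]
    congr 1
    · rw [← Finset.sum_subset (Finset.subset_univ S)]
      · exact Finset.sum_congr rfl fun i hi => by simp [hi, mul_comm]
      · intro i _ hi; simp [hi]
    · rw [← Finset.sum_subset (Finset.subset_univ S)]
      · refine Finset.sum_congr rfl fun i hi => ?_
        rw [Finset.mul_sum, ← Finset.sum_subset (Finset.subset_univ S)]
        · exact Finset.sum_congr rfl fun j hj => by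
            simp [hi, hj, mul_comm, Finset.insert_subset_iff]
        · intro j _ hj; simp [hj, Finset.insert_subset_iff]
      · intro i _ hi
        exact Finset.sum_eq_zero fun j _ => by simp [hi, Finset.insert_subset_iff]
  rw [Finset.sum_congr rfl fun S _ => e1 S, Finset.sum_sub_distrib, Finset.mul_sum,
    Finset.mul_sum]
  congr 1
  · rw [Finset.sum_comm]
    exact Finset.sum_congr rfl fun i _ => by rw [← Finset.mul_sum, hT]; simp [mul_comm]
  · rw [Finset.sum_comm]
    refine Finset.sum_congr rfl fun i _ => ?_
    rw [Finset.mul_sum, Finset.sum_comm]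
    refine Finset.sum_congr rfl fun j _ => ?_
    rw [← Finset.mul_sum, hT]
    rcases eq_or_ne i j with rfl | hij
    · simp [hb]
    · rw [Finset.card_pair hij, mul_comm]

/-- Janson's inequality. -/
theorem bprob_forall_not_subset_le {q : α → ℝ} (h0 : ∀ e, 0 ≤ q e) (h1 : ∀ e, q e ≤ 1)
    {ι : Type*} [Fintype ι] (T : ι → Finset α) (R : ι → ι → Prop) [DecidableRel R]
    (hrefl : ∀ i, R i i) (hsymm : ∀ i j, R i j → R j i)
    (hR : ∀ i j, ¬ R i j → Disjoint (T i) (T j)) :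
    bprob q (fun S => ∀ j, ¬ T j ⊆ S) ≤
      Real.exp (-((∑ i, ∏ e ∈ T i, q e) ^ 2 /
        (2 * ∑ i, ∑ j, if R i j then ∏ e ∈ T i ∪ T j, q e else 0))) := by
  classical
  have hp : ∀ T : Finset α, 0 ≤ ∏ e ∈ T, q e := fun T => Finset.prod_nonneg fun e _ => h0 e
  set μ := ∑ i, ∏ e ∈ T i, q e with hμ
  set D := ∑ i, ∑ j, if R i j then ∏ e ∈ T i ∪ T j, q e else 0 with hD
  set b : ι → ι → ℝ := fun i j => if i ≠ j ∧ R i j then ∏ e ∈ T i ∪ T j, q e else 0 with hb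
  have hμ0 : 0 ≤ μ := Finset.sum_nonneg fun i _ => hp _
  have hμD : μ ≤ D := by
    refine Finset.sum_le_sum fun i _ => ?_
    refine le_trans ?_ (Finset.single_le_sum
      (f := fun j => if R i j then ∏ e ∈ T i ∪ T j, q e else 0)
      (fun j _ => by split_ifs <;> simp [hp]) (Finset.mem_univ i))
    simp [hrefl]
  rcases hμ0.eq_or_lt with h | hμpos
  · rw [← h]
    simp only [ne_eq, OfNat.ofNat_ne_zero, not_false_eq_true, zero_pow, zero_div, neg_zero,
      Real.exp_zero]
    exact (bprob_mono h0 h1 fun _ _ => trivial).trans_eq (bprob_true q)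
  have hDpos : 0 < D := hμpos.trans_le hμD
  -- The choice θ = μ / D maximises θ μ - θ² D / 2, with value μ² / (2 D). It is at most 1 because D
  -- includes the diagonal terms.
  obtain ⟨s, hs⟩ := exists_subset_quadratic_ge (fun i => ∏ e ∈ T i, q e) (fun i j => b i j / 2)
    (fun i => by simp [hb]) (θ := μ / D) (by positivity) ((div_le_one hDpos).2 hμD)
  have hbD : ∑ i, ∑ j, b i j ≤ D := by
    refine Finset.sum_le_sum fun i _ => Finset.sum_le_sum fun j _ => ?_
    simp only [hb]
    by_cases hij : R i j
    · rw [if_pos hij]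
      split_ifs
      exacts [le_rfl, hp _]
    · simp [hij]
  calc _ ≤ bprob q (fun S => ∀ j ∈ s, ¬ T j ⊆ S) := bprob_mono h0 h1 fun S h j _ => h j
    _ ≤ _ := bprob_avoid_le h0 h1 T R hsymm hR s
    _ ≤ _ := by
      refine Real.exp_le_exp.2 ?_
      simp only [← Finset.sum_div] at hs
      have e : μ / D * μ - (μ / D) ^ 2 * (D / 2) = μ ^ 2 / (2 * D) := by
        field_simp; ring
      have : (μ / D) ^ 2 * ((∑ i, ∑ j, b i j) / 2) ≤ (μ / D) ^ 2 * (D / 2) := by gcongr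
      simp only [← hμ] at hs
      linarith

end RandomSubset

end GraphBootstrap

/-! ### The binomial random graph as a random subset of `Sym2 V` -/

namespace GraphBootstrap

/-- The edge probabilities of the binomial random graph, as a function on `Sym2 V`. -/
noncomputable def edgeProb {V : Type*} [DecidableEq V] (p : ℝ) (e : Sym2 V) : ℝ :=
  if e.IsDiag then 0 else p

section

variable {V : Type*} [DecidableEq V]

lemma edgeProb_nonneg {p : ℝ} (hp : 0 ≤ p) (e : Sym2 V) : 0 ≤ edgeProb p e := by
  unfold edgeProb; split_ifs <;> simp [hp]

lemma edgeProb_le_one {p : ℝ} (hp : p ≤ 1) (e : Sym2 V) : edgeProb p e ≤ 1 := by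
  unfold edgeProb; split_ifs <;> simp [hp]

lemma prod_edgeProb {p : ℝ} {T : Finset (Sym2 V)} (hT : ∀ e ∈ T, ¬ e.IsDiag) :
    ∏ e ∈ T, edgeProb p e = p ^ T.card := by
  rw [Finset.prod_congr rfl fun e he => by rw [edgeProb, if_neg (hT e he)], Finset.prod_const]

lemma prod_edgeProb_le {p : ℝ} (hp : 0 ≤ p) (T : Finset (Sym2 V)) :
    ∏ e ∈ T, edgeProb p e ≤ p ^ T.card := by
  rw [← Finset.prod_const]
  refine Finset.prod_le_prod (fun e _ => edgeProb_nonneg hp e) fun e _ => ?_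
  unfold edgeProb; split_ifs <;> simp [hp]

variable [Fintype V]

lemma bweight_edgeProb (p : I) (S : Finset (Sym2 V)) :
    (ProbabilityTheory.setBernoulli (Sym2.diagSetᶜ : Set (Sym2 V)) p).real {(S : Set (Sym2 V))} =
      bweight (edgeProb (p : ℝ)) S := by
  by_cases hS : (S : Set (Sym2 V)) ⊆ Sym2.diagSetᶜ
  · rw [ProbabilityTheory.setBernoulli_real_singleton p hS (Set.toFinite _), bweight,
      Finset.prod_ite]
    have e1 : ∏ e ∈ Finset.univ.filter (· ∈ S), edgeProb (p : ℝ) e =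
        (p : ℝ) ^ (S : Set (Sym2 V)).ncard := by
      rw [Set.ncard_coe_finset, Finset.filter_univ_mem]
      refine prod_edgeProb fun e he => ?_
      simpa using hS he
    have e2 : ∏ e ∈ Finset.univ.filter (fun e => ¬ e ∈ S), (1 - edgeProb (p : ℝ) e) =
        (1 - (p : ℝ)) ^ ((Sym2.diagSetᶜ : Set (Sym2 V)) \ S).ncard := by
      have : ∀ e : Sym2 V, 1 - edgeProb (p : ℝ) e = if e.IsDiag then 1 else 1 - (p : ℝ) := by
        intro e; unfold edgeProb; split_ifs <;> simp
      simp only [this]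
      rw [Finset.prod_ite, Finset.prod_const_one, one_mul, Finset.prod_const,
        ← Set.ncard_coe_finset]
      congr 2
      ext e
      simp [and_comm]
    rw [e1, e2]
  -- A set containing a loop has weight 0 on both sides.
  · have h0 := ProbabilityTheory.setBernoulli_singleton_of_not_subset p hS
    rw [MeasureTheory.measureReal_def, h0, ENNReal.toReal_zero]
    obtain ⟨e, he, hd⟩ := Set.not_subset.1 hS
    refine (Finset.prod_eq_zero (Finset.mem_univ e) ?_).symm
    have : e.IsDiag := by simpa using hd
    simp [Finset.mem_coe.1 he, edgeProb, this]

lemma binomialRandom_real_eq_bprob (p : I) (Q : Set (SimpleGraph V)) :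
    (SimpleGraph.binomialRandom V p).real Q =
      bprob (edgeProb (p : ℝ)) (fun S : Finset (Sym2 V) =>
        SimpleGraph.fromEdgeSet (S : Set (Sym2 V)) ∈ Q) := by
  classical
  have hQ : MeasurableSet Q := by
    rw [← Set.preimage_image_eq Q (SimpleGraph.edgeSet_injective (V := V))]
    exact SimpleGraph.measurable_edgeSet (Set.toFinite _).measurableSet
  rw [SimpleGraph.binomialRandom_eq_map, MeasureTheory.map_measureReal_apply
    (by fun_prop) hQ]
  have hfin : Fintype (Set (Sym2 V)) := inferInstance
  set B := (fun t : Set (Sym2 V) => SimpleGraph.fromEdgeSet t) ⁻¹' Q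
  have h : B = ⋃ S ∈ (Finset.univ.filter fun S : Finset (Sym2 V) => (S : Set (Sym2 V)) ∈ B),
      {(S : Set (Sym2 V))} := by
    ext t
    simp only [Finset.mem_filter, Finset.mem_univ, true_and, Set.mem_iUnion,
      Set.mem_singleton_iff, exists_prop]
    constructor
    · intro ht
      exact ⟨t.toFinset, by simpa using ht, by simp⟩
    · rintro ⟨S, hS, rfl⟩; exact hS
  rw [h, MeasureTheory.measureReal_biUnion_finset, bprob, Finset.sum_filter]
  · refine Finset.sum_congr rfl fun S _ => ?_
    rw [bweight_edgeProb]
    rfl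
  · intro S _ S' _ hne
    simpa using hne
  · intro S _
    exact (Set.toFinite _).measurableSet

end

end GraphBootstrap

namespace GraphBootstrap

/-! ### The closure as the least closed graph -/

section Closure

variable {W V V' : Type*}

/-- A graph is `H`-closed if it contains all the edges completing a copy of `H`. -/
def IsHClosed (H : SimpleGraph W) (G : SimpleGraph V) : Prop :=
  ∀ e, CompletesCopy H G e → e ∈ G.edgeSet

lemma CompletesCopy.not_isDiag {H : SimpleGraph W} {G : SimpleGraph V} {e : Sym2 V}
    (h : CompletesCopy H G e) : ¬ e.IsDiag := by
  obtain ⟨φ, h, -⟩ := h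
  exact SimpleGraph.not_isDiag_of_mem_edgeSet _ h

lemma CompletesCopy.mono {H : SimpleGraph W} {G G' : SimpleGraph V} {e : Sym2 V} (hG : G ≤ G')
    (h : CompletesCopy H G e) : CompletesCopy H G' e := by
  obtain ⟨φ, h, h'⟩ := h
  exact ⟨φ, h, h'.trans (SimpleGraph.edgeSet_mono hG)⟩

lemma mem_step {H : SimpleGraph W} {G : SimpleGraph V} {e : Sym2 V} :
    e ∈ (step H G).edgeSet ↔ e ∈ G.edgeSet ∨ CompletesCopy H G e := by
  rw [step, SimpleGraph.edgeSet_sup, SimpleGraph.edgeSet_fromEdgeSet]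
  simp only [Set.mem_union, Set.mem_sdiff, Set.mem_ofPred_eq]
  exact or_congr_right ⟨fun h => h.1, fun h => ⟨h, by simpa using h.not_isDiag⟩⟩

lemma le_step (H : SimpleGraph W) (G : SimpleGraph V) : G ≤ step H G := le_sup_left

lemma monotone_iterate_step (H : SimpleGraph W) (G : SimpleGraph V) :
    Monotone fun t => (step H)^[t] G :=
  monotone_nat_of_le_succ fun t => by
    rw [Function.iterate_succ_apply']
    exact le_step H _

lemma le_hClosure (H : SimpleGraph W) (G : SimpleGraph V) : G ≤ hClosure H G :=
  le_iSup (fun t => (step H)^[t] G) 0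

lemma mem_hClosure {H : SimpleGraph W} {G : SimpleGraph V} {e : Sym2 V} :
    e ∈ (hClosure H G).edgeSet ↔ ∃ t, e ∈ ((step H)^[t] G).edgeSet := by
  rw [hClosure]
  induction e with
  | _ u v => simp

/-- With `isHClosed_hClosure` this makes the closure the least closed graph above G. Later
inductions on the activation time are run by showing that the graph of edges with a given property
is closed. -/
lemma hClosure_le {H : SimpleGraph W} {G K : SimpleGraph V} (hG : G ≤ K) (hK : IsHClosed H K) :
    hClosure H G ≤ K := by
  refine iSup_le fun t => ?_
  induction t with
  | zero => exact hG
  | succ t ih =>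
    rw [Function.iterate_succ_apply', ← SimpleGraph.edgeSet_subset_edgeSet]
    intro e he
    rcases mem_step.1 he with h | h
    · exact SimpleGraph.edgeSet_mono ih h
    · exact hK e (h.mono ih)

/-- A copy of H has finitely many edges, so all the required ones are present at one finite time,
and the missing edge is added at the next. -/
lemma isHClosed_hClosure [Finite W] (H : SimpleGraph W) (G : SimpleGraph V) :
    IsHClosed H (hClosure H G) := by
  rintro e ⟨φ, he, h⟩
  have hfin : ((H.map φ).edgeSet \ {e}).Finite := by
    rw [SimpleGraph.edgeSet_map]
    exact ((Set.toFinite _).image _).subset Set.sdiff_subset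
  have hex : ∀ x ∈ (H.map φ).edgeSet \ {e}, ∃ t, x ∈ ((step H)^[t] G).edgeSet :=
    fun x hx => mem_hClosure.1 (h hx)
  choose! t ht using hex
  obtain ⟨T, hT⟩ := (hfin.image t).bddAbove
  refine mem_hClosure.2 ⟨T + 1, ?_⟩
  rw [Function.iterate_succ_apply']
  refine mem_step.2 (Or.inr ⟨φ, he, fun x hx => ?_⟩)
  exact SimpleGraph.edgeSet_mono (monotone_iterate_step H G (hT ⟨x, hx, rfl⟩)) (ht x hx)

lemma IsHClosed.comap {H : SimpleGraph W} {K : SimpleGraph V'} (hK : IsHClosed H K) (f : V ↪ V') :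
    IsHClosed H (K.comap f) := by
  rintro e ⟨φ, he, h⟩
  have key : ∀ x : Sym2 V, x ∈ (K.comap f).edgeSet ↔ x.map f ∈ K.edgeSet := by
    intro x; induction x with | _ u v => simp
  rw [key]
  have hmap : (H.map (φ.trans f)).edgeSet = Sym2.map f '' (H.map φ).edgeSet := by
    rw [SimpleGraph.edgeSet_map, SimpleGraph.edgeSet_map, Set.image_image]
    simp [Sym2.map_map]
  refine hK _ ⟨φ.trans f, ?_, ?_⟩
  · rw [hmap]; exact ⟨e, he, rfl⟩
  · rw [hmap]
    rintro _ ⟨⟨x, hx, rfl⟩, hne⟩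
    exact (key x).1 (h ⟨hx, fun hxe => hne (by rw [Set.mem_singleton_iff.1 hxe]; rfl)⟩)

/-- The pullback of the closure of K along f is closed and contains G, hence contains the closure of
G. -/
lemma map_mem_hClosure [Finite W] {H : SimpleGraph W} {G : SimpleGraph V} {K : SimpleGraph V'}
    (f : V ↪ V') (hGK : G ≤ K.comap f) {e : Sym2 V} (he : e ∈ (hClosure H G).edgeSet) :
    e.map f ∈ (hClosure H K).edgeSet := by
  have h : hClosure H G ≤ (hClosure H K).comap f :=
    hClosure_le (hGK.trans (SimpleGraph.comap_monotone _ (le_hClosure H K)))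
      ((isHClosed_hClosure H K).comap f)
  have := SimpleGraph.edgeSet_mono h he
  induction e with | _ u v => simpa using this

end Closure

/-! ### Induced edge counts and supermodularity of the excess -/

section EdgeCount

variable {V V' : Type*}

/-- The number of edges of `A` with both endpoints in `X`. -/
noncomputable def eIn (A : SimpleGraph V) (X : Finset V) : ℕ := (A.edgeSet ∩ X.sym2).ncard

lemma finite_inter_sym2 (A : SimpleGraph V) (X : Finset V) :
    (A.edgeSet ∩ (X.sym2 : Set (Sym2 V))).Finite :=
  X.sym2.finite_toSet.inter_of_right _

lemma eIn_mono {A B : SimpleGraph V} (hA : A ≤ B) {X Y : Finset V} (hX : X ⊆ Y) :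
    eIn A X ≤ eIn B Y :=
  Set.ncard_le_ncard (Set.inter_subset_inter (SimpleGraph.edgeSet_mono hA)
    (by exact_mod_cast Finset.sym2_mono hX)) (finite_inter_sym2 _ _)

lemma eIn_supermodular [DecidableEq V] (A : SimpleGraph V) (X Y : Finset V) :
    eIn A X + eIn A Y ≤ eIn A (X ∪ Y) + eIn A (X ∩ Y) := by
  have h := Set.ncard_union_add_ncard_inter (A.edgeSet ∩ (X.sym2 : Set (Sym2 V)))
    (A.edgeSet ∩ (Y.sym2 : Set (Sym2 V))) (finite_inter_sym2 _ _) (finite_inter_sym2 _ _)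
  rw [eIn, eIn, ← h]
  refine add_le_add (Set.ncard_le_ncard ?_ (finite_inter_sym2 _ _)) (Set.ncard_le_ncard ?_
    (finite_inter_sym2 _ _))
  · rw [← Set.inter_union_distrib_left]
    refine Set.inter_subset_inter_right _ (Set.union_subset ?_ ?_)
    · exact_mod_cast Finset.sym2_mono Finset.subset_union_left
    · exact_mod_cast Finset.sym2_mono Finset.subset_union_right
  · rintro e ⟨⟨h1, h2⟩, -, h3⟩
    refine ⟨h1, ?_⟩
    simp only [Finset.mem_coe, Finset.mem_sym2_iff, Finset.mem_inter] at h2 h3 ⊢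
    exact fun a ha => ⟨h2 a ha, h3 a ha⟩

/-- The excess `e(X) - ρ v(X)`. -/
noncomputable def excess (A : SimpleGraph V) (ρ : ℝ) (X : Finset V) : ℝ := eIn A X - ρ * X.card

lemma excess_supermodular [DecidableEq V] (A : SimpleGraph V) (ρ : ℝ) (X Y : Finset V) :
    excess A ρ X + excess A ρ Y ≤ excess A ρ (X ∪ Y) + excess A ρ (X ∩ Y) := by
  have h1 : (eIn A X : ℝ) + eIn A Y ≤ eIn A (X ∪ Y) + eIn A (X ∩ Y) := by
    exact_mod_cast eIn_supermodular A X Y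
  have h2 : ((X ∪ Y).card : ℝ) + (X ∩ Y).card = X.card + Y.card := by
    exact_mod_cast Finset.card_union_add_card_inter X Y
  unfold excess
  linear_combination h1 + ρ * h2

lemma neg_le_excess (A : SimpleGraph V) (ρ : ℝ) (X : Finset V) : -(ρ * X.card) ≤ excess A ρ X := by
  unfold excess
  linarith [(eIn A X).cast_nonneg (α := ℝ)]

end EdgeCount

/-! ### Cores for a supermodular function -/

section Core

variable {V : Type*} [DecidableEq V]

/-- `X` is the largest set maximising `h` among the supersets of `S` with at most `L` elements;
the last field is the form in which maximality of `X` is used. -/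
structure IsCore (h : Finset V → ℝ) (L : ℕ) (S X : Finset V) : Prop where
  subset : S ⊆ X
  card_le : X.card ≤ L
  le : ∀ Y, S ⊆ Y → Y.card ≤ L → h Y ≤ h X
  lt : ∀ F : Finset V, F.card ≤ L → ¬ F ⊆ X → h F < h (F ∩ X)

/-- If X were not inside Y, passing from X to `X ∩ Y` would strictly raise h, yet `X ∩ Y` still
contains S and competes with X. -/
lemma IsCore.mono {h : Finset V → ℝ} {L : ℕ} {S T X Y : Finset V} (hX : IsCore h L S X)
    (hY : IsCore h L T Y) (hST : S ⊆ T) : X ⊆ Y := by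
  by_contra hXY
  have h1 := hY.lt X hX.card_le hXY
  have h2 := hX.le (X ∩ Y) (Finset.subset_inter hX.subset (hST.trans hY.subset))
    ((Finset.card_le_card Finset.inter_subset_left).trans hX.card_le)
  linarith

/-- If `h F ≥ h (F ∩ X)`, supermodularity gives `h (F ∪ X) ≥ h X ≥ -K`. The gap then forbids sizes
above L for `F ∪ X`, which therefore competes with X; as X is a maximiser of largest size, F lies in
X. -/
lemma exists_isCore [Fintype V] {h : Finset V → ℝ} (hsm : ∀ X Y, h X + h Y ≤ h (X ∪ Y) + h (X ∩ Y)) {L : ℕ}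
    {K : ℝ} (hgap : ∀ X : Finset V, L < X.card → X.card ≤ 2 * L → h X < -K) {S : Finset V}
    (hSL : S.card ≤ L) (hSK : -K ≤ h S) : ∃ X, IsCore h L S X := by
  classical
  set 𝒞 : Finset (Finset V) := Finset.univ.filter fun Y => S ⊆ Y ∧ Y.card ≤ L with h𝒞
  have mem𝒞 : ∀ Y, Y ∈ 𝒞 ↔ S ⊆ Y ∧ Y.card ≤ L := fun Y => by simp [h𝒞]
  obtain ⟨X₀, hX₀, hmax₀⟩ := 𝒞.exists_max_image h ⟨S, (mem𝒞 S).2 ⟨subset_rfl, hSL⟩⟩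
  obtain ⟨X, hX, hmax⟩ := (𝒞.filter fun Y => h Y = h X₀).exists_max_image Finset.card
    ⟨X₀, Finset.mem_filter.2 ⟨hX₀, rfl⟩⟩
  obtain ⟨hX1, hX2⟩ := Finset.mem_filter.1 hX
  obtain ⟨hSX, hXL⟩ := (mem𝒞 X).1 hX1
  have hle : ∀ Y, S ⊆ Y → Y.card ≤ L → h Y ≤ h X := fun Y h1 h2 => by
    rw [hX2]; exact hmax₀ Y ((mem𝒞 Y).2 ⟨h1, h2⟩)
  refine ⟨X, hSX, hXL, hle, fun F hF hFX => ?_⟩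
  by_contra! hcon
  have h1 := hsm F X
  have h2 := hle S subset_rfl hSL
  have h3 : (F ∪ X).card ≤ 2 * L := (Finset.card_union_le F X).trans (by omega)
  have h4 : (F ∪ X).card ≤ L := by
    by_contra! h5
    linarith [hgap _ h5 h3]
  have h6 : S ⊆ F ∪ X := hSX.trans Finset.subset_union_right
  have h7 := hle _ h6 h4
  have h8 := hmax (F ∪ X) (Finset.mem_filter.2 ⟨(mem𝒞 _).2 ⟨h6, h4⟩, by linarith⟩)
  have h9 := Finset.eq_of_subset_of_card_le (Finset.subset_union_right (s₁ := F) (s₂ := X)) h8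
  exact hFX (h9 ▸ Finset.subset_union_left)

end Core

end GraphBootstrap

/-! ### Lower bound, deterministic part: sparse extensions of cores -/

namespace GraphBootstrap

lemma eIn_map {V V' : Type*} (A : SimpleGraph V) (i : V ↪ V') {F : Finset V} {F' : Finset V'}
    (h : ∀ x, x ∈ F ↔ i x ∈ F') :
    (A.map i).edgeSet ∩ (F'.sym2 : Set (Sym2 V')) = Sym2.map i '' (A.edgeSet ∩ F.sym2) := by
  rw [SimpleGraph.edgeSet_map]
  ext e
  constructor
  · rintro ⟨⟨e, he, rfl⟩, hF⟩
    refine ⟨e, ⟨he, ?_⟩, rfl⟩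
    induction e with
    | _ a b => simpa [h] using hF
  · rintro ⟨e, ⟨he, hF⟩, rfl⟩
    refine ⟨⟨e, he, rfl⟩, ?_⟩
    induction e with
    | _ a b => simpa [h] using hF

lemma eIn_map_eq {V V' : Type*} (A : SimpleGraph V) (i : V ↪ V') {F : Finset V} {F' : Finset V'}
    (h : ∀ x, x ∈ F ↔ i x ∈ F') : eIn (A.map i) F' = eIn A F := by
  rw [eIn, eIn_map A i h, Set.ncard_image_of_injective _ (Sym2.map.injective i.injective), eIn]

section SparseExt

variable {V : Type} [DecidableEq V]

/-- `A`, a graph on `V` and further vertices `T`, extends `G[X]` in such a way that every set of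
further vertices spans, together with its edges to `V`, at most `ρ` edges per vertex. -/
structure SparseExt (G : SimpleGraph V) (ρ : ℝ) (X : Finset V) {T : Type}
    (A : SimpleGraph (V ⊕ T)) : Prop where
  base : ∀ v w, A.Adj (Sum.inl v) (Sum.inl w) ↔ G.Adj v w ∧ v ∈ X ∧ w ∈ X
  le : ∀ F : Finset (V ⊕ T), (eIn A F : ℝ) ≤ ρ * F.toRight.card + eIn G (F.toLeft ∩ X)
  lt : ∀ F : Finset (V ⊕ T), F.toRight.Nonempty →
    (eIn A F : ℝ) < ρ * F.toRight.card + eIn G (F.toLeft ∩ X)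

lemma exists_sparseExt_empty (G : SimpleGraph V) (ρ : ℝ) (X : Finset V) :
    ∃ A : SimpleGraph (V ⊕ Empty), SparseExt G ρ X A := by
  let B : SimpleGraph V :=
    { Adj := fun v w => G.Adj v w ∧ v ∈ X ∧ w ∈ X
      symm := ⟨fun v w h => ⟨h.1.symm, h.2.2, h.2.1⟩⟩
      loopless := ⟨fun v h => h.1.ne rfl⟩ }
  refine ⟨B.map (Function.Embedding.inl : V ↪ V ⊕ Empty), ?_, ?_, ?_⟩
  · intro v w
    exact SimpleGraph.map_adj_apply (f := (Function.Embedding.inl : V ↪ V ⊕ Empty))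
  · intro F
    have hR : F.toRight = ∅ := Finset.eq_empty_of_forall_notMem fun x => x.elim
    rw [eIn_map_eq (F := F.toLeft) _ _ (by simp), hR]
    simp only [Finset.card_empty, Nat.cast_zero, mul_zero, zero_add, Nat.cast_le]
    refine Set.ncard_le_ncard ?_ (finite_inter_sym2 _ _)
    rintro e ⟨h1, h2⟩
    induction e with
    | _ v w =>
      obtain ⟨h3, h4, h5⟩ : G.Adj v w ∧ v ∈ X ∧ w ∈ X := h1
      simp_all
  · rintro F ⟨x, -⟩
    exact x.elim

/-- The new vertices are kept disjoint, so the two graphs overlap only in the edges of G spanned by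
Y. Counting that overlap once is what makes the two bounds add up to the bound over X. -/
lemma SparseExt.glue {G : SimpleGraph V} {ρ : ℝ} {X Y : Finset V} (hYX : Y ⊆ X) {T₁ T₂ : Type}
    {A₁ : SimpleGraph (V ⊕ T₁)} {A₂ : SimpleGraph (V ⊕ T₂)} (h₁ : SparseExt G ρ X A₁)
    (h₂ : SparseExt G ρ Y A₂) : ∃ A : SimpleGraph (V ⊕ (T₁ ⊕ T₂)), SparseExt G ρ X A ∧
      A₁ ≤ A.comap (Sum.map id Sum.inl) ∧ A₂ ≤ A.comap (Sum.map id Sum.inr) := by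
  classical
  let i₁ : V ⊕ T₁ ↪ V ⊕ (T₁ ⊕ T₂) := ⟨Sum.map id Sum.inl, Sum.map_injective.2
    ⟨Function.injective_id, Sum.inl_injective⟩⟩
  let i₂ : V ⊕ T₂ ↪ V ⊕ (T₁ ⊕ T₂) := ⟨Sum.map id Sum.inr, Sum.map_injective.2
    ⟨Function.injective_id, Sum.inr_injective⟩⟩
  -- Inclusion and exclusion: the edges of G spanned by `F.toLeft ∩ Y` lie in both images, so the
  -- right side counts them twice.
  have hcount : ∀ F : Finset (V ⊕ (T₁ ⊕ T₂)),
      (eIn (A₁.map i₁ ⊔ A₂.map i₂) F : ℝ) + eIn G (F.toLeft ∩ Y) ≤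
        eIn A₁ (F.toLeft.disjSum F.toRight.toLeft) +
          eIn A₂ (F.toLeft.disjSum F.toRight.toRight) := by
    intro F
    rw [← eIn_map_eq (F' := F) A₁ i₁ (by rintro (x | x) <;> simp [i₁]),
      ← eIn_map_eq (F' := F) A₂ i₂ (by rintro (x | x) <;> simp [i₂])]
    norm_cast
    rw [eIn, eIn, eIn, eIn, ← Set.ncard_union_add_ncard_inter _ _ (finite_inter_sym2 _ _)
      (finite_inter_sym2 _ _), SimpleGraph.edgeSet_sup, Set.union_inter_distrib_right]
    refine Nat.add_le_add_left ?_ _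
    rw [← Set.ncard_image_of_injective _ (Sym2.map.injective (Sum.inl_injective (α := V)
      (β := T₁ ⊕ T₂)))]
    refine Set.ncard_le_ncard ?_ ((finite_inter_sym2 _ _).inter_of_left _)
    rintro _ ⟨e, ⟨he, hF⟩, rfl⟩
    induction e with
    | _ v w =>
      have hadj : G.Adj v w := he
      have hF' : (v ∈ F.toLeft ∧ v ∈ Y) ∧ w ∈ F.toLeft ∧ w ∈ Y := by simpa using hF
      have hvw : s(Sum.inl v, Sum.inl w) ∈ F.sym2 := by
        simpa using ⟨Finset.mem_toLeft.1 hF'.1.1, Finset.mem_toLeft.1 hF'.2.1⟩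
      have e1 : (A₁.map i₁).Adj (i₁ (Sum.inl v)) (i₁ (Sum.inl w)) :=
        SimpleGraph.map_adj_apply.2 ((h₁.base v w).2 ⟨hadj, hYX hF'.1.2, hYX hF'.2.2⟩)
      have e2 : (A₂.map i₂).Adj (i₂ (Sum.inl v)) (i₂ (Sum.inl w)) :=
        SimpleGraph.map_adj_apply.2 ((h₂.base v w).2 ⟨hadj, hF'.1.2, hF'.2.2⟩)
      exact ⟨⟨e1, hvw⟩, ⟨e2, hvw⟩⟩
  have hcard : ∀ F : Finset (V ⊕ (T₁ ⊕ T₂)),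
      (F.toRight.card : ℝ) = F.toRight.toLeft.card + F.toRight.toRight.card := fun F => by
    exact_mod_cast Finset.card_toLeft_add_card_toRight.symm
  refine ⟨A₁.map i₁ ⊔ A₂.map i₂, ⟨?_, ?_, ?_⟩, ?_, ?_⟩
  · intro v w
    have e1 : (A₁.map i₁).Adj (Sum.inl v) (Sum.inl w) ↔ A₁.Adj (Sum.inl v) (Sum.inl w) :=
      SimpleGraph.map_adj_apply (f := i₁) (a := Sum.inl v) (b := Sum.inl w)
    have e2 : (A₂.map i₂).Adj (Sum.inl v) (Sum.inl w) ↔ A₂.Adj (Sum.inl v) (Sum.inl w) :=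
      SimpleGraph.map_adj_apply (f := i₂) (a := Sum.inl v) (b := Sum.inl w)
    rw [SimpleGraph.sup_adj, e1, e2, h₁.base, h₂.base]
    exact ⟨fun h => h.elim id fun h => ⟨h.1, hYX h.2.1, hYX h.2.2⟩, Or.inl⟩
  · intro F
    have a1 := h₁.le (F.toLeft.disjSum F.toRight.toLeft)
    have a2 := h₂.le (F.toLeft.disjSum F.toRight.toRight)
    simp only [Finset.toLeft_disjSum, Finset.toRight_disjSum] at a1 a2
    rw [hcard F, mul_add]
    linarith [hcount F]
  · intro F hF
    have a1 := h₁.le (F.toLeft.disjSum F.toRight.toLeft)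
    have a2 := h₂.le (F.toLeft.disjSum F.toRight.toRight)
    have b1 := h₁.lt (F.toLeft.disjSum F.toRight.toLeft)
    have b2 := h₂.lt (F.toLeft.disjSum F.toRight.toRight)
    simp only [Finset.toLeft_disjSum, Finset.toRight_disjSum] at a1 a2 b1 b2
    rw [hcard F, mul_add]
    obtain ⟨x | x, hx⟩ := hF
    · linarith [hcount F, b1 ⟨x, by simpa using hx⟩]
    · linarith [hcount F, b2 ⟨x, by simpa using hx⟩]
  · intro a b hab
    exact Or.inl (SimpleGraph.map_adj_apply.2 hab : (A₁.map i₁).Adj (i₁ a) (i₁ b))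
  · intro a b hab
    exact Or.inr (SimpleGraph.map_adj_apply.2 hab : (A₂.map i₂).Adj (i₂ a) (i₂ b))

/-- The base of a sparse extension can be shrunk to a core. -/
lemma SparseExt.shrink [Fintype V] {G : SimpleGraph V} {ρ : ℝ} (hρ : 0 < ρ) {X Y : Finset V}
    (hYX : Y ⊆ X)
    (hlt : ∀ F ⊆ X, ¬ F ⊆ Y → excess G ρ F < excess G ρ (F ∩ Y)) {T : Type} [Fintype T]
    {A : SimpleGraph (V ⊕ T)} (hA : SparseExt G ρ X A) :
    ∃ A' : SimpleGraph (V ⊕ (V ⊕ T)), SparseExt G ρ Y A' ∧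
      ∃ κ : V ⊕ T ↪ V ⊕ (V ⊕ T), A ≤ A'.comap κ ∧ ∀ v ∈ Y, κ (Sum.inl v) = Sum.inl v := by
  classical
  -- Vertices of Y stay in place; every other vertex of V moves to a new copy of itself.
  let κ : V ⊕ T ↪ V ⊕ (V ⊕ T) := ⟨fun x => x.elim
    (fun v => if v ∈ Y then Sum.inl v else Sum.inr (Sum.inl v)) (fun t => Sum.inr (Sum.inr t)), by
      rintro (v | t) (w | s) h
      · by_cases hv : v ∈ Y <;> by_cases hw : w ∈ Y <;> simp_all
      · by_cases hv : v ∈ Y <;> simp_all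
      · by_cases hw : w ∈ Y <;> simp_all
      · simp_all⟩
  have hκ1 : ∀ v ∈ Y, κ (Sum.inl v) = Sum.inl v := fun v hv => if_pos hv
  have hκ2 : ∀ v ∉ Y, κ (Sum.inl v) = Sum.inr (Sum.inl v) := fun v hv => if_neg hv
  have hκ3 : ∀ t, κ (Sum.inr t) = Sum.inr (Sum.inr t) := fun t => rfl
  have hκ4 : ∀ x v, κ x = Sum.inl v → v ∈ Y ∧ x = Sum.inl v := by
    rintro (w | t) v h
    · by_cases hw : w ∈ Y
      · rw [hκ1 w hw] at h
        obtain rfl := Sum.inl_injective h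
        exact ⟨hw, rfl⟩
      · rw [hκ2 w hw] at h; cases h
    · cases h
  have key : ∀ F' : Finset (V ⊕ (V ⊕ T)),
      (eIn (A.map κ) F' : ℝ) ≤ ρ * F'.toRight.card + eIn G (F'.toLeft ∩ Y) ∧
      (F'.toRight.Nonempty →
        (eIn (A.map κ) F' : ℝ) < ρ * F'.toRight.card + eIn G (F'.toLeft ∩ Y)) := by
    intro F'
    set F : Finset (V ⊕ T) := Finset.univ.filter fun x => κ x ∈ F' with hF
    have hFmem : ∀ x, x ∈ F ↔ κ x ∈ F' := fun x => by simp [hF]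
    rw [eIn_map_eq A κ hFmem]
    have hR : F'.toRight.toRight = F.toRight := by ext t; simp [hFmem, hκ3]
    set F₀ := F.toLeft ∩ X with hF₀
    have h0 : F₀ ∩ Y = F'.toLeft ∩ Y := by
      ext v
      simp only [hF₀, Finset.mem_inter, Finset.mem_toLeft, hFmem]
      constructor
      · rintro ⟨⟨h1, -⟩, h2⟩; exact ⟨hκ1 v h2 ▸ h1, h2⟩
      · rintro ⟨h1, h2⟩; exact ⟨⟨(hκ1 v h2).symm ▸ h1, hYX h2⟩, h2⟩
    have hL : F₀ \ Y ⊆ F'.toRight.toLeft := by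
      intro v hv
      simp only [hF₀, Finset.mem_sdiff, Finset.mem_inter, Finset.mem_toLeft, hFmem] at hv
      rw [hκ2 v hv.2] at hv
      simpa using hv.1.1
    have hcard : (F'.toRight.card : ℝ) = F'.toRight.toLeft.card + F.toRight.card := by
      rw [← hR]; exact_mod_cast Finset.card_toLeft_add_card_toRight.symm
    have hLc : ((F₀ \ Y).card : ℝ) ≤ F'.toRight.toLeft.card := by
      exact_mod_cast Finset.card_le_card hL
    have hsplit : ((F₀ ∩ Y).card : ℝ) + (F₀ \ Y).card = F₀.card := by
      exact_mod_cast Finset.card_inter_add_card_sdiff F₀ Y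
    have hX := hA.le F
    -- The core inequality says that the base loses at most ρ edges per vertex moved out of it,
    -- which is what these vertices may span as new ones.
    have hle : excess G ρ F₀ ≤ excess G ρ (F₀ ∩ Y) := by
      by_cases h : F₀ ⊆ Y
      · rw [Finset.inter_eq_left.2 h]
      · exact (hlt F₀ Finset.inter_subset_right h).le
    have hmul := mul_le_mul_of_nonneg_left hLc hρ.le
    have e1 : ρ * (F₀ ∩ Y).card + ρ * (F₀ \ Y).card = ρ * F₀.card := by rw [← hsplit]; ring
    rw [hcard, mul_add, ← h0]
    unfold excess at hle
    refine ⟨by linarith, ?_⟩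
    -- Strictness has three sources: the strict core inequality if v was moved out of the base, an
    -- unused allowance ρ if the copy of v meets no counted base vertex, and the strict bound in A
    -- for a vertex t that was already new.
    rintro ⟨v | t, hv⟩
    · by_cases hvF : v ∈ F₀ \ Y
      · have h1 := hlt F₀ Finset.inter_subset_right fun h =>
          (Finset.mem_sdiff.1 hvF).2 (h (Finset.mem_sdiff.1 hvF).1)
        unfold excess at h1
        linarith
      · have h1 : F₀ \ Y ⊂ F'.toRight.toLeft :=
          Finset.ssubset_iff_subset_ne.2 ⟨hL, fun h => hvF (h ▸ by simpa using hv)⟩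
        have h2 : ((F₀ \ Y).card : ℝ) < F'.toRight.toLeft.card := by
          exact_mod_cast Finset.card_lt_card h1
        have := mul_lt_mul_of_pos_left h2 hρ
        linarith
    · have h1 := hA.lt F ⟨t, by simpa [← hR] using hv⟩
      linarith
  refine ⟨A.map κ, ⟨?_, fun F => (key F).1, fun F => (key F).2⟩, κ, ?_, hκ1⟩
  · intro v w
    constructor
    · intro h
      obtain ⟨a, b, hab, ha, hb⟩ := (SimpleGraph.map_adj _ _ _ _).1 h
      obtain ⟨hv, rfl⟩ := hκ4 a v ha
      obtain ⟨hw, rfl⟩ := hκ4 b w hb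
      exact ⟨((hA.base v w).1 hab).1, hv, hw⟩
    · rintro ⟨h1, h2, h3⟩
      have := (SimpleGraph.map_adj_apply (f := κ)).2 ((hA.base v w).2 ⟨h1, hYX h2, hYX h3⟩)
      rwa [hκ1 v h2, hκ1 w h3] at this
  · intro a b hab
    exact SimpleGraph.map_adj_apply.2 hab

/-- The extensions of the single edges are glued one after another over X; earlier activations
survive by `map_mem_hClosure`. -/
lemma SparseExt.exists_of_finset {W : Type*} [Finite W] (H : SimpleGraph W) {G : SimpleGraph V}
    {ρ : ℝ} {X : Finset V} (E : Finset (Sym2 V))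
    (hE : ∀ e ∈ E, ∃ Y ⊆ X, ∃ (T : Type) (_ : Fintype T) (A : SimpleGraph (V ⊕ T)),
      SparseExt G ρ Y A ∧ e.map Sum.inl ∈ (hClosure H A).edgeSet) :
    ∃ (T : Type) (_ : Fintype T) (A : SimpleGraph (V ⊕ T)), SparseExt G ρ X A ∧
      ∀ e ∈ E, e.map Sum.inl ∈ (hClosure H A).edgeSet := by
  classical
  induction E using Finset.induction_on with
  | empty =>
    obtain ⟨A, hA⟩ := exists_sparseExt_empty G ρ X
    exact ⟨Empty, inferInstance, A, hA, by simp⟩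
  | insert e E he ih =>
    obtain ⟨T₁, _, A₁, hA₁, h₁⟩ := ih fun x hx => hE x (Finset.mem_insert_of_mem hx)
    obtain ⟨Y, hY, T₂, _, A₂, hA₂, h₂⟩ := hE e (Finset.mem_insert_self _ _)
    obtain ⟨A, hA, hle₁, hle₂⟩ := hA₁.glue hY hA₂
    refine ⟨T₁ ⊕ T₂, inferInstance, A, hA, fun x hx => ?_⟩
    rcases Finset.mem_insert.1 hx with rfl | hx
    · have := map_mem_hClosure (f := ⟨Sum.map id Sum.inr, Sum.map_injective.2
        ⟨Function.injective_id, Sum.inr_injective⟩⟩) hle₂ h₂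
      rw [Sym2.map_map] at this
      exact this
    · have := map_mem_hClosure (f := ⟨Sum.map id Sum.inl, Sum.map_injective.2
        ⟨Function.injective_id, Sum.inl_injective⟩⟩) hle₁ (h₁ x hx)
      rw [Sym2.map_map] at this
      exact this

/-- Every edge of `⟨G⟩_H` is activated by a sparse extension of its core in `G`. -/
lemma exists_sparseExt_of_mem_hClosure {W : Type*} [Fintype W] [Fintype V] (H : SimpleGraph W)
    {G : SimpleGraph V} {ρ : ℝ} (hρ : 0 < ρ) {L : ℕ} (hL : Fintype.card W ≤ L) (hL2 : 2 ≤ L)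
    {K : ℝ} (hK : ρ * Fintype.card W ≤ K) (hK2 : ρ * 2 ≤ K)
    (hgap : ∀ X : Finset V, L < X.card → X.card ≤ 2 * L → excess G ρ X < -K)
    {e : Sym2 V} (he : e ∈ (hClosure H G).edgeSet) :
    ∃ X, IsCore (excess G ρ) L e.toFinset X ∧
      ∃ (T : Type) (_ : Fintype T) (A : SimpleGraph (V ⊕ T)),
      SparseExt G ρ X A ∧ e.map Sum.inl ∈ (hClosure H A).edgeSet := by
  classical
  have hcore : ∀ S : Finset V, S.card ≤ L → ρ * S.card ≤ K → ∃ X, IsCore (excess G ρ) L S X :=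
    fun S h1 h2 => exists_isCore (excess_supermodular G ρ) hgap h1
      (by linarith [neg_le_excess G ρ S])
  have hcore2 : ∀ e : Sym2 V, ∃ X, IsCore (excess G ρ) L e.toFinset X := fun e => by
    have h2 : e.toFinset.card ≤ 2 := by rw [Sym2.card_toFinset]; split_ifs <;> omega
    refine hcore _ (h2.trans hL2) (le_trans ?_ hK2)
    have : (e.toFinset.card : ℝ) ≤ 2 := by exact_mod_cast h2
    gcongr
  let P : Sym2 V → Prop := fun e => ∃ X, IsCore (excess G ρ) L e.toFinset X ∧
      ∃ (T : Type) (_ : Fintype T) (A : SimpleGraph (V ⊕ T)),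
      SparseExt G ρ X A ∧ e.map Sum.inl ∈ (hClosure H A).edgeSet
  have hP : ∀ e, e ∈ (SimpleGraph.fromEdgeSet {e | P e}).edgeSet → P e := fun e he => by
    rw [SimpleGraph.edgeSet_fromEdgeSet] at he
    exact he.1
  -- Induction on activation: the graph of edges satisfying P contains G, with no new vertices
  -- needed, and is closed.
  refine hP e (SimpleGraph.edgeSet_mono (hClosure_le ?_ ?_) he)
  · rw [← SimpleGraph.edgeSet_subset_edgeSet, SimpleGraph.edgeSet_fromEdgeSet]
    intro e he
    refine ⟨?_, by simpa using SimpleGraph.not_isDiag_of_mem_edgeSet _ he⟩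
    obtain ⟨X, hX⟩ := hcore2 e
    obtain ⟨A, hA⟩ := exists_sparseExt_empty G ρ X
    refine ⟨X, hX, Empty, inferInstance, A, hA, SimpleGraph.edgeSet_mono (le_hClosure H A) ?_⟩
    have hs := hX.subset
    induction e with
    | _ v w =>
      exact (hA.base v w).2 ⟨he, hs (by simp), hs (by simp)⟩
  · intro e hcc
    rw [SimpleGraph.edgeSet_fromEdgeSet]
    refine ⟨?_, by simpa using hcc.not_isDiag⟩
    obtain ⟨φ, heφ, hφ⟩ := hcc
    set S : Finset V := Finset.univ.map φ with hS
    have hScard : S.card = Fintype.card W := by simp [hS, Finset.card_univ]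
    have hsub : ∀ x ∈ (H.map φ).edgeSet, x.toFinset ⊆ S := by
      intro x hx
      rw [SimpleGraph.edgeSet_map] at hx
      obtain ⟨y, hy, rfl⟩ := hx
      intro v hv
      rw [Sym2.mem_toFinset] at hv
      obtain ⟨w, -, rfl⟩ := Sym2.mem_map.1 hv
      simp [hS]
    -- The core of the whole copy contains the cores of all its edges, so it serves as a common base
    -- for gluing; the base is then shrunk to the core of e.
    obtain ⟨X, hX⟩ := hcore S (hScard.trans_le hL) (by rw [hScard]; exact hK)
    have hfin : ((H.map φ).edgeSet \ {e}).Finite := Set.toFinite _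
    obtain ⟨T, _, A, hA, hact⟩ := SparseExt.exists_of_finset H (X := X) (G := G) (ρ := ρ)
      hfin.toFinset (fun x hx => by
        rw [Set.Finite.mem_toFinset] at hx
        obtain ⟨Y, hY, hT⟩ := hP x (hφ hx)
        exact ⟨Y, hY.mono hX (hsub x hx.1), hT⟩)
    obtain ⟨Y, hY⟩ := hcore2 e
    have hYX : Y ⊆ X := hY.mono hX (hsub e heφ)
    obtain ⟨A', hA', κ, hκ, hκY⟩ := hA.shrink hρ hYX
      (fun F hF hFY => hY.lt F ((Finset.card_le_card hF).trans hX.card_le) hFY)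
    have hmem : e.map Sum.inl ∈ (hClosure H A).edgeSet := by
      have h1 : (H.map (φ.trans Function.Embedding.inl : W ↪ V ⊕ T)).edgeSet =
          Sym2.map Sum.inl '' (H.map φ).edgeSet := by
        rw [SimpleGraph.edgeSet_map, SimpleGraph.edgeSet_map, Set.image_image]
        refine Set.image_congr fun x _ => ?_
        induction x with | _ a b => rfl
      refine isHClosed_hClosure H A _ ⟨φ.trans Function.Embedding.inl, ?_, ?_⟩
      · rw [h1]; exact ⟨e, heφ, rfl⟩
      · rw [h1]
        rintro _ ⟨⟨x, hx, rfl⟩, hne⟩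
        exact hact x (by
          rw [Set.Finite.mem_toFinset]
          exact ⟨hx, fun h => hne (by rw [Set.mem_singleton_iff.1 h]; rfl)⟩)
    refine ⟨Y, hY, V ⊕ T, inferInstance, A', hA', ?_⟩
    have h2 := map_mem_hClosure κ hκ hmem
    have hs := hY.subset
    induction e with
    | _ v w =>
      simp only [Sym2.map_mk] at h2 ⊢
      rwa [hκY v (hs (by simp)), hκY w (hs (by simp))] at h2

end SparseExt

end GraphBootstrap

/-! ### From the activation density to dense sets in G -/

namespace GraphBootstrap

lemma ofReal_le_sub_div_sub_iff {ρ : ℝ} {m v : ℕ} (hm : 1 ≤ m) (hv : 3 ≤ v) :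
    ENNReal.ofReal ρ ≤ ((m : ℝ≥0∞) - 1) / ((v : ℝ≥0∞) - 2) ↔ ρ * ((v : ℝ) - 2) ≤ (m : ℝ) - 1 := by
  have h1 : (m : ℝ≥0∞) - 1 = ENNReal.ofReal ((m : ℝ) - 1) := by
    rw [ENNReal.ofReal_sub _ zero_le_one]; simp
  have h2 : (v : ℝ≥0∞) - 2 = ENNReal.ofReal ((v : ℝ) - 2) := by
    rw [ENNReal.ofReal_sub _ zero_le_two]; simp
  have hv' : (3 : ℝ) ≤ v := by exact_mod_cast hv
  have hm' : (1 : ℝ) ≤ m := by exact_mod_cast hm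
  rw [h1, h2, ← ENNReal.ofReal_div_of_pos (by linarith), ENNReal.ofReal_le_ofReal_iff
    (div_nonneg (by linarith) (by linarith)), le_div_iff₀ (by linarith)]

lemma exists_dense_of_le_activationDensity {W : Type*} {H : SimpleGraph W} {ρ : ℝ} (hρ : 0 < ρ)
    (hH : ENNReal.ofReal ρ ≤ activationDensity H) {V : Type} [Fintype V] [DecidableEq V]
    {A : SimpleGraph V} {e : Sym2 V} (he : e ∈ (hClosure H A).edgeSet \ A.edgeSet) :
    ∃ F : Finset V, e.toFinset ⊆ F ∧ 3 ≤ F.card ∧ ρ * (F.card - 2) ≤ eIn A F := by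
  classical
  have h1 : ENNReal.ofReal ρ ≤ rootedDensity A e :=
    hH.trans (iInf_le_of_le V (iInf_le_of_le inferInstance (iInf_le_of_le A
      (iInf_le_of_le e (iInf_le_of_le he le_rfl)))))
  unfold rootedDensity at h1
  obtain ⟨F, hF⟩ := exists_eq_ciSup_of_finite (f := fun F : (addEdge A e).Subgraph =>
    ⨆ (_ : e ∈ F.edgeSet) (_ : 3 ≤ F.verts.ncard),
      ((F.edgeSet.ncard : ℝ≥0∞) - 1) / ((F.verts.ncard : ℝ≥0∞) - 2))
  rw [← hF] at h1
  -- Suprema over empty conditions are 0, so positivity of ρ forces the maximising F to contain e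
  -- and a third vertex.
  have hpos : (0 : ℝ≥0∞) < ENNReal.ofReal ρ := ENNReal.ofReal_pos.2 hρ
  by_cases heF : e ∈ F.edgeSet
  swap
  · simp only [heF, not_false_eq_true, iSup_neg, bot_eq_zero'] at h1
    exact absurd h1 (not_le.2 hpos)
  by_cases hcF : 3 ≤ F.verts.ncard
  swap
  · rw [iSup_pos heF, iSup_neg hcF, bot_eq_zero'] at h1
    exact absurd h1 (not_le.2 hpos)
  simp only [heF, hcF, iSup_pos] at h1
  have hfin : F.edgeSet.Finite := Set.toFinite _
  rw [ofReal_le_sub_div_sub_iff ((Set.ncard_pos hfin).2 ⟨e, heF⟩) hcF] at h1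
  refine ⟨F.verts.toFinset, ?_, ?_, ?_⟩
  · intro v hv
    rw [Sym2.mem_toFinset] at hv
    exact Set.mem_toFinset.2 (F.mem_verts_of_mem_edge heF hv)
  · rwa [← Set.ncard_eq_toFinset_card']
  · rw [← Set.ncard_eq_toFinset_card']
    refine h1.trans ?_
    rw [sub_le_iff_le_add]
    norm_cast
    -- Only e can be missing from A; it accounts for the -1 in the density.
    have h2 : F.edgeSet ⊆ insert e (A.edgeSet ∩ (F.verts.toFinset.sym2 : Set (Sym2 V))) := by
      intro x hx
      rw [Set.mem_insert_iff, or_iff_not_imp_left]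
      intro hne
      have hx' := F.edgeSet_subset hx
      rw [addEdge, SimpleGraph.edgeSet_sup, SimpleGraph.edgeSet_fromEdgeSet] at hx'
      refine ⟨hx'.resolve_right fun h => hne (by simpa using h.1), ?_⟩
      rw [Finset.mem_coe, Finset.mem_sym2_iff]
      exact fun v hv => Set.mem_toFinset.2 (F.mem_verts_of_mem_edge hx hv)
    exact (Set.ncard_le_ncard h2 (Set.toFinite _)).trans (Set.ncard_insert_le _ _)

lemma exists_sparse_of_activationDensity_lt {W : Type*} {H : SimpleGraph W} {ρ : ℝ}
    (hH : activationDensity H < ENNReal.ofReal ρ) :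
    ∃ (V : Type) (_ : Fintype V) (_ : DecidableEq V) (A : SimpleGraph V) (e : Sym2 V),
      e ∈ (hClosure H A).edgeSet \ A.edgeSet ∧
      ∀ F : Finset V, e.toFinset ⊆ F → 3 ≤ F.card → (eIn A F : ℝ) ≤ ρ * (F.card - 2) := by
  classical
  simp only [activationDensity, iInf_lt_iff] at hH
  obtain ⟨V, _, A, e, he, hlt⟩ := hH
  refine ⟨V, Fintype.ofFinite V, inferInstance, A, e, he, fun F heF hF => ?_⟩
  have hde : ¬ e.IsDiag := SimpleGraph.not_isDiag_of_mem_edgeSet _ he.1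
  set B : (addEdge A e).Subgraph := (⊤ : (addEdge A e).Subgraph).induce F
  have hedge : ∀ x : Sym2 V, x ∈ (addEdge A e).edgeSet → x.toFinset ⊆ F → x ∈ B.edgeSet := by
    intro x hx hxF
    induction x with
    | _ v w =>
      refine SimpleGraph.Subgraph.mem_edgeSet.2 ⟨hxF (by simp), hxF (by simp), by simpa using hx⟩
  have h1 : e ∈ B.edgeSet := hedge e (by
    rw [addEdge, SimpleGraph.edgeSet_sup, SimpleGraph.edgeSet_fromEdgeSet]
    exact Or.inr ⟨rfl, by simpa using hde⟩) heF
  have h2 : B.verts.ncard = F.card := by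
    rw [SimpleGraph.Subgraph.induce_verts, Set.ncard_coe_finset]
  have hfin : B.edgeSet.Finite := Set.toFinite _
  have h3 : ((B.edgeSet.ncard : ℝ≥0∞) - 1) / ((F.card : ℝ≥0∞) - 2) < ENNReal.ofReal ρ := by
    refine lt_of_le_of_lt ?_ hlt
    refine le_iSup_of_le B (le_iSup_of_le h1 (le_iSup_of_le (h2 ▸ hF) ?_))
    rw [h2]
  rw [← not_le, ofReal_le_sub_div_sub_iff ((Set.ncard_pos hfin).2 ⟨e, h1⟩) hF, not_le] at h3
  have h4 : insert e (A.edgeSet ∩ (F.sym2 : Set (Sym2 V))) ⊆ B.edgeSet := by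
    rw [Set.insert_subset_iff]
    refine ⟨h1, fun x hx => hedge x ?_ ?_⟩
    · rw [addEdge, SimpleGraph.edgeSet_sup]; exact Or.inl hx.1
    · intro v hv
      exact Finset.mem_sym2_iff.1 hx.2 v (Sym2.mem_toFinset.1 hv)
  have h5 := Set.ncard_le_ncard h4 hfin
  rw [Set.ncard_insert_of_notMem (fun h => he.2 h.1) (finite_inter_sym2 _ _)] at h5
  have h6 : (eIn A F : ℝ) + 1 ≤ B.edgeSet.ncard := by exact_mod_cast h5
  linarith

/-- If `G` has no dense sets of intermediate size, then every edge that becomes active is contained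
in a dense set of small size. -/
theorem exists_dense_of_mem_hClosure {W : Type*} [Fintype W] (H : SimpleGraph W) {ρ : ℝ}
    (hρ : 0 < ρ) (hH : ENNReal.ofReal ρ ≤ activationDensity H) {V : Type} [Fintype V]
    [DecidableEq V] {G : SimpleGraph V} {L : ℕ} (hL : Fintype.card W ≤ L) (hL2 : 2 ≤ L) {K : ℝ}
    (hK : ρ * Fintype.card W ≤ K) (hK2 : ρ * 2 ≤ K)
    (hgap : ∀ X : Finset V, L < X.card → X.card ≤ 2 * L → excess G ρ X < -K)
    {e : Sym2 V} (he : e ∈ (hClosure H G).edgeSet) (heG : e ∉ G.edgeSet) :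
    ∃ X : Finset V, e.toFinset ⊆ X ∧ 3 ≤ X.card ∧ X.card ≤ L ∧ ρ * (X.card - 2) ≤ eIn G X := by
  classical
  obtain ⟨X, hX, T, _, A, hA, hact⟩ :=
    exists_sparseExt_of_mem_hClosure H hρ hL hL2 hK hK2 hgap he
  have hd : ¬ e.IsDiag := SimpleGraph.not_isDiag_of_mem_edgeSet _ he
  have hnA : e.map Sum.inl ∉ A.edgeSet := by
    induction e with
    | _ v w => exact fun h => heG ((hA.base v w).1 h).1
  obtain ⟨F, heF, hF3, hF⟩ := exists_dense_of_le_activationDensity hρ hH ⟨hact, hnA⟩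
  have heL : e.toFinset ⊆ F.toLeft ∩ X := by
    intro v hv
    refine Finset.mem_inter.2 ⟨Finset.mem_toLeft.2 (heF ?_), hX.subset hv⟩
    rw [Sym2.mem_toFinset] at hv ⊢
    exact Sym2.mem_map.2 ⟨v, hv, rfl⟩
  have he2 : e.toFinset.card = 2 := Sym2.card_toFinset_of_not_isDiag e hd
  have hFc : (F.card : ℝ) = F.toLeft.card + F.toRight.card := by
    exact_mod_cast Finset.card_toLeft_add_card_toRight.symm
  have hle := hA.le F
  -- The new vertices of F pay for at most ρ edges each, so the remaining edges are edges of G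
  -- inside the core.
  have h1 : ρ * ((F.toLeft.card : ℝ) - 2) ≤ eIn G (F.toLeft ∩ X) := by
    rw [hFc] at hF
    linarith
  have hc := Finset.card_le_card heL
  have hcL : (F.toLeft ∩ X).card ≤ F.toLeft.card := Finset.card_le_card Finset.inter_subset_left
  refine ⟨F.toLeft ∩ X, heL, ?_, (Finset.card_le_card Finset.inter_subset_right).trans hX.card_le,
    le_trans ?_ h1⟩
  -- If the trace were only e, it would span nothing, as e is not in G. Then `F.toLeft` is e as
  -- well, so F has a new vertex, and there the bound is strict.
  · by_contra hlt
    have h2 : (F.toLeft ∩ X).card = 2 := by omega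
    have h3 : e.toFinset = F.toLeft ∩ X := Finset.eq_of_subset_of_card_le heL (by omega)
    have h4 : eIn G (F.toLeft ∩ X) = 0 := by
      rw [← h3, eIn, Set.ncard_eq_zero (finite_inter_sym2 _ _), Set.eq_empty_iff_forall_notMem]
      rintro x ⟨hx1, hx2⟩
      refine heG ?_
      have hxd := SimpleGraph.not_isDiag_of_mem_edgeSet _ hx1
      have : x = e := by
        induction x with | _ a b =>
        induction e with | _ v w =>
        simp only [Finset.mem_coe, Finset.mk_mem_sym2_iff, Sym2.mem_toFinset, Sym2.mem_iff] at hx2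
        rw [Sym2.mk_isDiag_iff] at hxd
        rw [Sym2.eq_iff]
        rcases hx2 with ⟨rfl | rfl, rfl | rfl⟩ <;> simp_all
      exact this ▸ hx1
    have h5 : F.toLeft.card = 2 := by
      have h6 : ρ * ((F.toLeft.card : ℝ) - 2) ≤ 0 := by rw [h4] at h1; exact_mod_cast h1
      have h7 : (F.toLeft.card : ℝ) ≤ 2 := by nlinarith
      have : F.toLeft.card ≤ 2 := by exact_mod_cast h7
      omega
    have h6 : F.toRight.Nonempty := by
      rw [← Finset.card_pos]
      have := Finset.card_toLeft_add_card_toRight (u := F)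
      omega
    have h7 := hA.lt F h6
    rw [h4] at h7
    rw [hFc, h5] at hF
    push_cast at hF h7
    linarith
  · have : ((F.toLeft ∩ X).card : ℝ) ≤ F.toLeft.card := by exact_mod_cast hcL
    gcongr

end GraphBootstrap

/-! ### Upper bound, deterministic part: percolation from sparse extensions -/

namespace GraphBootstrap

/-- Every sparse rooted graph with at most `L` vertices can be found in `G`, whatever the images of
the roots. -/
def HasSparseExtensions {U : Type*} (G : SimpleGraph U) (ρ : ℝ) (L : ℕ) : Prop :=
  ∀ k ≤ L, ∀ (Γ : SimpleGraph (Fin k)) (X : Finset (Fin k)),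
    (∀ Z, X ⊆ Z → excess Γ ρ Z ≤ excess Γ ρ X) → ∀ φ : Fin k → U, Set.InjOn φ X →
    ∃ ψ : Fin k → U, Function.Injective ψ ∧ (∀ x ∈ X, ψ x = φ x) ∧
      ∀ a b, Γ.Adj a b → ¬ (a ∈ X ∧ b ∈ X) → G.Adj (ψ a) (ψ b)

lemma eIn_comap {V V' : Type*} (A : SimpleGraph V') (i : V ↪ V') (Z : Finset V) :
    eIn (A.comap i) Z = eIn A (Z.map i) := by
  rw [eIn, eIn, ← Set.ncard_image_of_injective _ (Sym2.map.injective i.injective)]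
  congr 1
  ext e
  constructor
  · rintro ⟨x, ⟨hx, hZ⟩, rfl⟩
    induction x with | _ a b =>
    exact ⟨hx, by simpa using hZ⟩
  · rintro ⟨he, hZ⟩
    induction e with | _ a b =>
    simp only [Finset.mem_coe, Finset.mk_mem_sym2_iff, Finset.mem_map] at hZ
    obtain ⟨⟨a, ha, rfl⟩, ⟨b, hb, rfl⟩⟩ := hZ
    exact ⟨s(a, b), ⟨he, by simp [ha, hb]⟩, rfl⟩

lemma HasSparseExtensions.exists_extension {U : Type*} {G : SimpleGraph U} {ρ : ℝ} {L : ℕ}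
    (hG : HasSparseExtensions G ρ L) {V : Type*} [DecidableEq V] {A : SimpleGraph V}
    {X Y : Finset V} (hXY : X ⊆ Y) (hY : Y.card ≤ L)
    (hsp : ∀ Z, X ⊆ Z → Z ⊆ Y → excess A ρ Z ≤ excess A ρ X) {φ : V → U} (hφ : Set.InjOn φ X) :
    ∃ ψ : V → U, Set.InjOn ψ Y ∧ (∀ x ∈ X, ψ x = φ x) ∧
      ∀ a ∈ Y, ∀ b ∈ Y, A.Adj a b → ¬ (a ∈ X ∧ b ∈ X) → G.Adj (ψ a) (ψ b) := by
  let i : Fin Y.card ↪ V := Y.equivFin.symm.toEmbedding.trans (Function.Embedding.subtype _)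
  have hi : ∀ (v : V) (hv : v ∈ Y), i (Y.equivFin ⟨v, hv⟩) = v := fun v hv => by simp [i]
  have hiY : ∀ a, i a ∈ Y := fun a => (Y.equivFin.symm a).2
  set X' : Finset (Fin Y.card) := Finset.univ.filter fun a => i a ∈ X with hX'
  have memX' : ∀ a, a ∈ X' ↔ i a ∈ X := fun a => by simp [hX']
  have hmapX' : X'.map i = X := by
    ext v
    simp only [Finset.mem_map, memX']
    exact ⟨by rintro ⟨a, ha, rfl⟩; exact ha, fun hv => ⟨_, by rwa [hi v (hXY hv)], hi v (hXY hv)⟩⟩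
  have hexc : ∀ Z : Finset (Fin Y.card), excess (A.comap i) ρ Z = excess A ρ (Z.map i) :=
    fun Z => by rw [excess, excess, eIn_comap, Finset.card_map]
  obtain ⟨ψ, hψ1, hψ2, hψ3⟩ := hG Y.card hY (A.comap i) X' (fun Z hZ => by
      rw [hexc, hexc, hmapX']
      refine hsp _ (hmapX' ▸ Finset.map_subset_map.2 hZ) fun v hv => ?_
      obtain ⟨a, -, rfl⟩ := Finset.mem_map.1 hv
      exact hiY a) (φ ∘ i) (fun a ha b hb hab => i.injective
        (hφ ((memX' a).1 ha) ((memX' b).1 hb) hab))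
  refine ⟨fun v => if h : v ∈ Y then ψ (Y.equivFin ⟨v, h⟩) else φ v, ?_, ?_, ?_⟩
  · intro a ha b hb hab
    have ha' : a ∈ Y := ha
    have hb' : b ∈ Y := hb
    simp only [ha', hb', dif_pos] at hab
    simpa using hψ1 hab
  · intro x hx
    simp only [hXY hx, dif_pos]
    rw [hψ2 _ ((memX' _).2 (by rwa [hi])), Function.comp_apply, hi]
  · intro a ha b hb hab hX
    simp only [ha, hb, dif_pos]
    refine hψ3 _ _ ?_ ?_
    · rw [SimpleGraph.comap_adj, hi, hi]; exact hab
    · rwa [memX', memX', hi, hi]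

/-- If `A` witnesses an activation density below `ρ₁ < ρ₂` and all small extensions of density `ρ₂`
can be found in `G`, then `G` percolates. -/
theorem hClosure_eq_top_of_hasSparseExtensions {W : Type*} [Fintype W] (H : SimpleGraph W)
    {V : Type*} [Fintype V] [DecidableEq V] {A : SimpleGraph V} {e₀ : Sym2 V} {ρ₁ ρ₂ : ℝ}
    (hρ₁ : 0 ≤ ρ₁) (hρ : ρ₁ < ρ₂) (he₀ : e₀ ∈ (hClosure H A).edgeSet \ A.edgeSet)
    (hA : ∀ F : Finset V, e₀.toFinset ⊆ F → 3 ≤ F.card → (eIn A F : ℝ) ≤ ρ₁ * (F.card - 2))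
    {L : ℕ} (hL : ρ₂ * Fintype.card W ≤ (ρ₂ - ρ₁) * L) {U : Type*} {G : SimpleGraph U}
    (hG : HasSparseExtensions G ρ₂ L) : hClosure H G = ⊤ := by
  classical
  have hd : ¬ e₀.IsDiag := SimpleGraph.not_isDiag_of_mem_edgeSet _ he₀.1
  have he2 : e₀.toFinset.card = 2 := Sym2.card_toFinset_of_not_isDiag e₀ hd
  -- The density bound is only known for sets containing the root edge; adding its at most 2 missing
  -- vertices is absorbed by the -2 in that bound.
  have hsp : ∀ F : Finset V, (eIn A F : ℝ) ≤ ρ₁ * F.card := by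
    intro F
    have h1 : (eIn A F : ℝ) ≤ eIn A (F ∪ e₀.toFinset) := by
      exact_mod_cast eIn_mono le_rfl Finset.subset_union_left
    have h2 : ((F ∪ e₀.toFinset).card : ℝ) ≤ F.card + 2 := by
      exact_mod_cast he2 ▸ Finset.card_union_le F e₀.toFinset
    by_cases h3 : 3 ≤ (F ∪ e₀.toFinset).card
    · have h4 := hA _ Finset.subset_union_right h3
      have h5 : ρ₁ * ((F ∪ e₀.toFinset).card - 2 : ℝ) ≤ ρ₁ * F.card := by
        gcongr; linarith
      linarith
    · have h4 : F ⊆ e₀.toFinset := by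
        have : e₀.toFinset = F ∪ e₀.toFinset :=
          Finset.eq_of_subset_of_card_le Finset.subset_union_right (by omega)
        rw [this]; exact Finset.subset_union_left
      have h5 : eIn A F = 0 := by
        rw [eIn, Set.ncard_eq_zero (finite_inter_sym2 _ _), Set.eq_empty_iff_forall_notMem]
        rintro x ⟨hx1, hx2⟩
        refine he₀.2 ?_
        have hxd := SimpleGraph.not_isDiag_of_mem_edgeSet _ hx1
        have hx3 := Finset.sym2_mono h4 hx2
        have : x = e₀ := by
          clear hA he₀ he2
          induction x with | _ a b =>
          induction e₀ with | _ v w =>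
          simp only [Finset.mk_mem_sym2_iff, Sym2.mem_toFinset, Sym2.mem_iff] at hx3
          rw [Sym2.mk_isDiag_iff] at hxd
          rw [Sym2.eq_iff]
          rcases hx3 with ⟨rfl | rfl, rfl | rfl⟩ <;> simp_all
        exact this ▸ hx1
      rw [h5]
      push_cast
      positivity
  -- With size bound `Fintype.card V` the gap condition is vacuous.
  have hcore : ∀ S : Finset V, ∃ X, IsCore (excess A ρ₂) (Fintype.card V) S X := fun S =>
    exists_isCore (K := ρ₂ * Fintype.card V) (excess_supermodular A ρ₂)
      (fun X hX _ => absurd (Finset.card_le_univ X) (not_le.2 hX)) (Finset.card_le_univ S) (by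
        have h1 : (S.card : ℝ) ≤ Fintype.card V := by exact_mod_cast Finset.card_le_univ S
        have h2 : ρ₂ * S.card ≤ ρ₂ * Fintype.card V := by
          have : 0 ≤ ρ₂ := hρ₁.trans hρ.le
          gcongr
        linarith [neg_le_excess A ρ₂ S])
  -- An edge is activated wherever its core alone is embedded; the rest of A need not be present.
  let P : Sym2 V → Prop := fun e => ∀ X, IsCore (excess A ρ₂) (Fintype.card V) e.toFinset X →
    ∀ ψ : V → U, Set.InjOn ψ X → (∀ a ∈ X, ∀ b ∈ X, A.Adj a b → G.Adj (ψ a) (ψ b)) →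
      e.map ψ ∈ (hClosure H G).edgeSet
  have hP : ∀ e ∈ (hClosure H A).edgeSet, P e := by
    intro e he
    have h1 : hClosure H A ≤ SimpleGraph.fromEdgeSet {e | P e} := by
      refine hClosure_le ?_ ?_
      · rw [← SimpleGraph.edgeSet_subset_edgeSet, SimpleGraph.edgeSet_fromEdgeSet]
        intro e he
        refine ⟨fun X hX ψ _ hhom => SimpleGraph.edgeSet_mono (le_hClosure H G) ?_,
          by simpa using SimpleGraph.not_isDiag_of_mem_edgeSet _ he⟩
        have hs := hX.subset
        induction e with
        | _ v w => exact hhom v (hs (by simp)) w (hs (by simp)) he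
      · intro e hcc
        rw [SimpleGraph.edgeSet_fromEdgeSet]
        refine ⟨fun X hX ψ hψ hhom => ?_, by simpa using hcc.not_isDiag⟩
        obtain ⟨φ, heφ, hφ⟩ := hcc
        set S : Finset V := Finset.univ.map φ with hS
        have hScard : S.card = Fintype.card W := by simp [hS, Finset.card_univ]
        have hsub : ∀ x ∈ (H.map φ).edgeSet, x.toFinset ⊆ S := by
          intro x hx
          rw [SimpleGraph.edgeSet_map] at hx
          obtain ⟨y, hy, rfl⟩ := hx
          intro v hv
          rw [Sym2.mem_toFinset] at hv
          obtain ⟨w, -, rfl⟩ := Sym2.mem_map.1 hv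
          simp [hS]
        obtain ⟨Y, hY⟩ := hcore S
        -- The excess of Y is at least that of S, hence at least -ρ₂ |W|, and at most -(ρ₂ - ρ₁)
        -- |Y|. The bound on |Y| does not depend on the size of A.
        have hYL : Y.card ≤ L := by
          have h2 := hY.le S subset_rfl (Finset.card_le_univ S)
          have h3 := neg_le_excess A ρ₂ S
          rw [hScard] at h3
          have h4 := hsp Y
          have h5 : excess A ρ₂ Y = eIn A Y - ρ₂ * Y.card := rfl
          have h6 : (ρ₂ - ρ₁) * Y.card ≤ (ρ₂ - ρ₁) * L := by linarith
          exact_mod_cast le_of_mul_le_mul_left h6 (sub_pos.2 hρ)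
        have hXY : X ⊆ Y := hX.mono hY (hsub e heφ)
        -- X maximises the excess among supersets of e, which is the sparseness of Y over the roots
        -- X.
        obtain ⟨ψ', hinj, hagree, hedge⟩ := hG.exists_extension hXY hYL (fun Z hZ _ =>
          hX.le Z (hX.subset.trans hZ) (Finset.card_le_univ Z)) hψ
        have hhom' : ∀ a ∈ Y, ∀ b ∈ Y, A.Adj a b → G.Adj (ψ' a) (ψ' b) := by
          intro a ha b hb hab
          by_cases hab' : a ∈ X ∧ b ∈ X
          · rw [hagree a hab'.1, hagree b hab'.2]
            exact hhom a hab'.1 b hab'.2 hab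
          · exact hedge a ha b hb hab hab'
        have heψ : e.map ψ = e.map ψ' := by
          have hs := hX.subset
          induction e with
          | _ v w => simp [hagree v (hs (by simp)), hagree w (hs (by simp))]
        rw [heψ]
        let χ : W ↪ U := ⟨ψ' ∘ φ, fun a b hab => φ.injective
          (hinj (hY.subset (by simp [hS])) (hY.subset (by simp [hS])) hab)⟩
        have hχ : (H.map χ).edgeSet = Sym2.map ψ' '' (H.map φ).edgeSet := by
          rw [SimpleGraph.edgeSet_map, SimpleGraph.edgeSet_map, Set.image_image]
          refine Set.image_congr fun x _ => ?_
          induction x with | _ a b => rfl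
        refine isHClosed_hClosure H G _ ⟨χ, ?_, ?_⟩
        · rw [hχ]; exact ⟨e, heφ, rfl⟩
        · rw [hχ]
          rintro _ ⟨⟨x, hx, rfl⟩, hne⟩
          have hxP : P x := by
            have h2 := hφ ⟨hx, fun h => hne (by rw [Set.mem_singleton_iff.1 h]; rfl)⟩
            rw [SimpleGraph.edgeSet_fromEdgeSet] at h2
            exact h2.1
          obtain ⟨Z, hZ⟩ := hcore x.toFinset
          have hZY : Z ⊆ Y := hZ.mono hY (hsub x hx)
          exact hxP Z hZ ψ' (hinj.mono hZY) fun a ha b hb => hhom' a (hZY ha) b (hZY hb)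
    have h2 := SimpleGraph.edgeSet_mono h1 he
    rw [SimpleGraph.edgeSet_fromEdgeSet] at h2
    exact h2.1
  obtain ⟨X, hX⟩ := hcore e₀.toFinset
  -- A larger set has excess at most ρ₁ (|X| - 2) - ρ₂ |X|, less than the -2 ρ₂ guaranteed by the
  -- pair itself.
  have hX2 : X = e₀.toFinset := by
    refine (Finset.eq_of_subset_of_card_le hX.subset ?_).symm
    by_contra hlt
    have h3 : 3 ≤ X.card := by omega
    have h4 := hA X hX.subset h3
    have h5 := hX.le _ subset_rfl (Finset.card_le_univ _)
    have h6 := neg_le_excess A ρ₂ e₀.toFinset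
    rw [he2] at h6
    have h7 : excess A ρ₂ X = eIn A X - ρ₂ * X.card := rfl
    have h8 : (3 : ℝ) ≤ X.card := by exact_mod_cast h3
    push_cast at h6
    nlinarith
  have hmain := hP e₀ he₀.1 X hX
  subst hX2
  have hnA := he₀.2
  clear hX hA he₀ he2 hsp hP
  induction e₀ with | _ u v =>
  have huv : u ≠ v := by rwa [Sym2.mk_isDiag_iff] at hd
  ext a b
  rw [SimpleGraph.top_adj]
  refine ⟨fun h => h.ne, fun hab => ?_⟩
  -- The core {u, v} spans no edge of A, so any placement of it is admissible and every pair a, b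
  -- becomes active.
  have h1 := hmain (fun x => if x = u then a else b) (by
      intro x hx y hy hxy
      have hx' : x = u ∨ x = v := by simpa using hx
      have hy' : y = u ∨ y = v := by simpa using hy
      rcases hx' with rfl | rfl <;> rcases hy' with rfl | rfl
      · rfl
      · exact absurd (by simpa [huv.symm] using hxy) hab
      · exact absurd (by simpa [huv.symm] using hxy.symm) hab
      · rfl)
    (by
      intro x hx y hy hxy
      exfalso
      have hx' : x = u ∨ x = v := by simpa using hx
      have hy' : y = u ∨ y = v := by simpa using hy
      rcases hx' with rfl | rfl <;> rcases hy' with rfl | rfl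
      · exact hxy.ne rfl
      · exact hnA hxy
      · exact hnA hxy.symm
      · exact hxy.ne rfl)
  simpa [huv.symm] using h1

end GraphBootstrap

/-! ### Probability of a missing rooted extension -/

namespace GraphBootstrap

section Extension

variable {k n m : ℕ}

/-- The edges of `Γ` that are not spanned by `X`. -/
noncomputable def outerEdges {V : Type*} [Fintype V] (Γ : SimpleGraph V) (X : Finset V) :
    Finset (Sym2 V) :=
  (Set.toFinite (Γ.edgeSet \ (X.sym2 : Set (Sym2 V)))).toFinset

lemma mem_outerEdges {V : Type*} [Fintype V] {Γ : SimpleGraph V} {X : Finset V} {x : Sym2 V} :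
    x ∈ outerEdges Γ X ↔ x ∈ Γ.edgeSet ∧ x ∉ X.sym2 := by
  rw [outerEdges, Set.Finite.mem_toFinset]
  rfl

/-- The map placing the vertices of `X` by `φ`, and any other vertex `w` in its own class. -/
def partiteMap (X : Finset (Fin k)) (φ : Fin k → Fin n) (g : Fin k × Fin m → Fin n)
    (f : Fin k → Fin m) (w : Fin k) : Fin n := if w ∈ X then φ w else g (w, f w)

variable {X : Finset (Fin k)} {φ : Fin k → Fin n} {g : Fin k × Fin m ↪ Fin n}

/-- The classes are disjoint from each other and from the placed roots, so an image reveals its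
vertex even across two different placements. -/
lemma partiteMap_inj (hφ : Set.InjOn φ X) (hg : ∀ x, ∀ w ∈ X, g x ≠ φ w) {f f' : Fin k → Fin m}
    {w w' : Fin k} (h : partiteMap X φ g f w = partiteMap X φ g f' w') : w = w' := by
  unfold partiteMap at h
  split_ifs at h with h1 h2 h2
  · exact hφ h1 h2 h
  · exact absurd h.symm (hg _ _ h1)
  · exact absurd h (hg _ _ h2)
  · exact congrArg Prod.fst (g.injective h)

lemma sym2_map_partiteMap (hφ : Set.InjOn φ X) (hg : ∀ x, ∀ w ∈ X, g x ≠ φ w)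
    {f f' : Fin k → Fin m} {x x' : Sym2 (Fin k)}
    (h : x.map (partiteMap X φ g f) = x'.map (partiteMap X φ g f')) :
    x = x' ∧ ∀ w ∈ x, w ∉ X → f w = f' w := by
  have key : ∀ w, partiteMap X φ g f w = partiteMap X φ g f' w → w ∉ X → f w = f' w := by
    intro w hw hX
    simp only [partiteMap, hX, if_false] at hw
    exact congrArg Prod.snd (g.injective hw)
  induction x with | _ a b =>
  induction x' with | _ c d =>
  simp only [Sym2.map_mk, Sym2.eq_iff] at h
  rcases h with ⟨h1, h2⟩ | ⟨h1, h2⟩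
  · obtain rfl := partiteMap_inj hφ hg h1
    obtain rfl := partiteMap_inj hφ hg h2
    refine ⟨rfl, fun w hw => ?_⟩
    rcases Sym2.mem_iff.1 hw with rfl | rfl
    exacts [key _ h1, key _ h2]
  · obtain rfl := partiteMap_inj hφ hg h1
    obtain rfl := partiteMap_inj hφ hg h2
    refine ⟨Sym2.eq_swap, fun w hw => ?_⟩
    rcases Sym2.mem_iff.1 hw with rfl | rfl
    exacts [key _ h1, key _ h2]

lemma card_piFinset_agree (f : Fin k → Fin m) (Z : Finset (Fin k)) :
    (Finset.univ.filter fun f' : Fin k → Fin m => ∀ w ∈ Z, f w = f' w).card = m ^ (k - Z.card) := by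
  have h : (Finset.univ.filter fun f' : Fin k → Fin m => ∀ w ∈ Z, f w = f' w) =
      Fintype.piFinset fun w => if w ∈ Z then {f w} else Finset.univ := by
    ext f'
    simp only [Finset.mem_filter, Finset.mem_univ, true_and, Fintype.mem_piFinset]
    refine forall_congr' fun w => ?_
    by_cases hw : w ∈ Z <;> simp [hw, eq_comm]
  rw [h, Fintype.card_piFinset]
  simp only [apply_ite Finset.card, Finset.card_singleton, Finset.card_univ, Fintype.card_fin]
  rw [Finset.prod_ite, Finset.prod_const_one, one_mul, Finset.prod_const]
  congr 1
  have := Finset.card_compl Z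
  rw [Fintype.card_fin] at this
  rw [← this]
  congr 1
  ext w; simp

/-- The probability that a rooted graph does not extend a given placement of its roots. -/
theorem bprob_not_exists_extension_le {p : ℝ} (hp0 : 0 < p) (hp1 : p ≤ 1)
    (Γ : SimpleGraph (Fin k)) (X : Finset (Fin k)) (φ : Fin k → Fin n) (hφ : Set.InjOn φ X)
    (hm : 0 < m) (hkm : k * m + k ≤ n) {B : ℝ} (hB : 0 < B)
    (hsum : ∑ Z ∈ (Xᶜ).powerset with Z.Nonempty,
      ((m : ℝ) ^ Z.card * p ^ (eIn Γ (X ∪ Z) - eIn Γ X))⁻¹ ≤ B) :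
    bprob (edgeProb p) (fun S : Finset (Sym2 (Fin n)) => ¬ ∃ ψ : Fin k → Fin n,
      Function.Injective ψ ∧ (∀ x ∈ X, ψ x = φ x) ∧ ∀ a b, Γ.Adj a b → ¬ (a ∈ X ∧ b ∈ X) →
        (SimpleGraph.fromEdgeSet (S : Set (Sym2 (Fin n)))).Adj (ψ a) (ψ b)) ≤
      Real.exp (-(1 / (2 * B))) := by
  classical
  have h0 : ∀ e : Sym2 (Fin n), 0 ≤ edgeProb p e := edgeProb_nonneg hp0.le
  have h1 : ∀ e : Sym2 (Fin n), edgeProb p e ≤ 1 := edgeProb_le_one hp1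
  -- There is room for k disjoint classes of m vertices avoiding the roots; one candidate placement
  -- is a choice of a vertex in each class.
  have havail : Fintype.card (Fin k × Fin m) ≤ (Finset.univ \ X.image φ).card := by
    have h2 := Finset.le_card_sdiff (X.image φ) Finset.univ
    have h3 : (X.image φ).card ≤ k :=
      Finset.card_image_le.trans ((Finset.card_le_univ X).trans_eq (Fintype.card_fin k))
    rw [Finset.card_univ, Fintype.card_fin] at h2
    rw [Fintype.card_prod, Fintype.card_fin, Fintype.card_fin]
    omega
  obtain ⟨g, hg'⟩ := Function.Embedding.exists_of_card_le_finset havail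
  have hg : ∀ x, ∀ w ∈ X, g x ≠ φ w := by
    intro x w hw h
    have h2 := hg' ⟨x, rfl⟩
    rw [Finset.mem_coe, Finset.mem_sdiff] at h2
    exact h2.2 (Finset.mem_image.2 ⟨w, hw, h.symm⟩)
  set O := outerEdges Γ X with hO
  set T : (Fin k → Fin m) → Finset (Sym2 (Fin n)) :=
    fun f => O.image (Sym2.map (partiteMap X φ g f)) with hT
  have hinj : ∀ f, Function.Injective (partiteMap X φ g f) := fun f w w' h =>
    partiteMap_inj hφ hg h
  have hTcard : ∀ f, (T f).card = O.card := fun f =>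
    Finset.card_image_of_injective _ (Sym2.map.injective (hinj f))
  have hTdiag : ∀ f, ∀ e ∈ T f, ¬ e.IsDiag := by
    intro f e he
    obtain ⟨x, hx, rfl⟩ := Finset.mem_image.1 he
    have hx' := SimpleGraph.not_isDiag_of_mem_edgeSet _ (mem_outerEdges.1 hx).1
    rwa [Sym2.isDiag_map (hinj f)]
  have himp : ∀ S : Finset (Sym2 (Fin n)), (¬ ∃ ψ : Fin k → Fin n,
      Function.Injective ψ ∧ (∀ x ∈ X, ψ x = φ x) ∧ ∀ a b, Γ.Adj a b → ¬ (a ∈ X ∧ b ∈ X) →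
        (SimpleGraph.fromEdgeSet (S : Set (Sym2 (Fin n)))).Adj (ψ a) (ψ b)) →
      ∀ f, ¬ T f ⊆ S := by
    intro S hS f hf
    refine hS ⟨partiteMap X φ g f, hinj f, fun x hx => by simp [partiteMap, hx], ?_⟩
    intro a b hab hX
    rw [SimpleGraph.fromEdgeSet_adj]
    refine ⟨hf (Finset.mem_image.2 ⟨s(a, b), mem_outerEdges.2 ⟨hab, ?_⟩, rfl⟩),
      fun h => hab.ne (hinj f h)⟩
    rwa [Finset.mk_mem_sym2_iff]
  rcases eq_or_ne X Finset.univ with rfl | hX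
  · have f : Fin k → Fin m := fun _ => ⟨0, hm⟩
    have hT0 : T f = ∅ := by
      rw [← Finset.card_eq_zero, hTcard, Finset.card_eq_zero]
      exact Finset.eq_empty_of_forall_notMem fun x hx => (mem_outerEdges.1 hx).2 (by
        induction x with | _ a b => simp)
    refine le_trans (bprob_mono h0 h1 (Q' := fun _ => False) fun S hS => himp S hS f ?_) ?_
    · rw [hT0]; exact Finset.empty_subset S
    · simp [bprob, Real.exp_nonneg]
  obtain ⟨w₀, hw₀⟩ : ∃ w, w ∉ X := by
    by_contra! h
    exact hX (Finset.eq_univ_iff_forall.2 h)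
  -- Every edge to be embedded has an endpoint outside X, so placements that share no free vertex
  -- share no edge.
  let R : (Fin k → Fin m) → (Fin k → Fin m) → Prop := fun f f' => ∃ w, w ∉ X ∧ f w = f' w
  have hJ := bprob_forall_not_subset_le h0 h1 T R (fun f => ⟨w₀, hw₀, rfl⟩)
    (fun f f' ⟨w, hw, h⟩ => ⟨w, hw, h.symm⟩) (by
      intro f f' hR
      rw [Finset.disjoint_left]
      intro e he he'
      obtain ⟨x, hx, rfl⟩ := Finset.mem_image.1 he
      obtain ⟨x', hx', hxx⟩ := Finset.mem_image.1 he'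
      obtain ⟨-, hag⟩ := sym2_map_partiteMap hφ hg hxx.symm
      have hxX := (mem_outerEdges.1 hx).2
      rw [Finset.mem_sym2_iff] at hxX
      push Not at hxX
      obtain ⟨w, hw, hwX⟩ := hxX
      exact hR ⟨w, hwX, hag w hw hwX⟩)
  refine (bprob_mono h0 h1 himp).trans (hJ.trans ?_)
  have hμ : ∑ f, ∏ e ∈ T f, edgeProb p e = (m : ℝ) ^ k * p ^ O.card := by
    rw [Finset.sum_congr rfl fun f _ => by rw [prod_edgeProb (hTdiag f), hTcard],
      Finset.sum_const, Finset.card_univ, Fintype.card_pi]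
    simp
  set c : Finset (Fin k) → ℝ := fun Z => (p ^ (eIn Γ (X ∪ Z) - eIn Γ X))⁻¹ with hc
  have hc0 : ∀ Z, 0 ≤ c Z := fun Z => by simp only [hc]; positivity
  have hunion : ∀ f f', ∏ e ∈ T f ∪ T f', edgeProb p e ≤
      p ^ O.card * p ^ O.card * c ((Xᶜ).filter fun w => f w = f' w) := by
    intro f f'
    set Z := (Xᶜ).filter fun w => f w = f' w with hZ
    refine (prod_edgeProb_le hp0.le _).trans ?_
    -- With Z the free vertices placed alike, a common edge lies inside X ∪ Z but not inside X.
    have hcap : (T f ∩ T f').card ≤ eIn Γ (X ∪ Z) - eIn Γ X := by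
      have hsub : T f ∩ T f' ⊆ ((Set.toFinite ((Γ.edgeSet ∩ ((X ∪ Z).sym2 : Set (Sym2 (Fin k)))) \
          (Γ.edgeSet ∩ (X.sym2 : Set (Sym2 (Fin k)))))).toFinset).image
          (Sym2.map (partiteMap X φ g f)) := by
        intro e he
        obtain ⟨he1, he2⟩ := Finset.mem_inter.1 he
        obtain ⟨x, hx, rfl⟩ := Finset.mem_image.1 he1
        obtain ⟨x', hx', hxx⟩ := Finset.mem_image.1 he2
        obtain ⟨-, hag⟩ := sym2_map_partiteMap hφ hg hxx.symm
        obtain ⟨hx1, hx2⟩ := mem_outerEdges.1 hx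
        refine Finset.mem_image.2 ⟨x, ?_, rfl⟩
        rw [Set.Finite.mem_toFinset]
        refine ⟨⟨hx1, ?_⟩, fun h => hx2 h.2⟩
        rw [Finset.mem_coe, Finset.mem_sym2_iff]
        intro w hw
        by_cases hwX : w ∈ X
        · exact Finset.mem_union_left _ hwX
        · exact Finset.mem_union_right _ (by simp [hZ, hwX, hag w hw hwX])
      refine (Finset.card_le_card hsub).trans (Finset.card_image_le.trans ?_)
      have hss : (X.sym2 : Set (Sym2 (Fin k))) ⊆ ((X ∪ Z).sym2 : Set (Sym2 (Fin k))) := by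
        exact_mod_cast Finset.sym2_mono (Finset.subset_union_left (s₁ := X) (s₂ := Z))
      rw [← Set.ncard_eq_toFinset_card, Set.ncard_sdiff
        (Set.inter_subset_inter_right _ hss) (finite_inter_sym2 _ _)]
      exact le_rfl
    have hcard := Finset.card_union_add_card_inter (T f) (T f')
    rw [hTcard, hTcard] at hcard
    rw [hc, ← div_eq_mul_inv, le_div_iff₀ (by positivity), ← pow_add, ← pow_add]
    exact pow_le_pow_of_le_one hp0.le hp1 (by omega)
  have hD : ∑ f, ∑ f', (if R f f' then ∏ e ∈ T f ∪ T f', edgeProb p e else 0) ≤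
      ((m : ℝ) ^ k * p ^ O.card) ^ 2 * B := by
    have hstep : ∀ f, ∑ f', (if R f f' then ∏ e ∈ T f ∪ T f', edgeProb p e else 0) ≤
        p ^ O.card * p ^ O.card * ((m : ℝ) ^ k * B) := by
      intro f
      -- Summing over all Z on which f and f' agree, instead of the largest one, only adds
      -- nonnegative terms and makes the count of f' a pure power of m.
      calc _ ≤ ∑ f' : Fin k → Fin m, ∑ Z ∈ (Xᶜ).powerset with Z.Nonempty,
            (if ∀ w ∈ Z, f w = f' w then p ^ O.card * p ^ O.card * c Z else 0) := by
            refine Finset.sum_le_sum fun f' _ => ?_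
            have hnn : ∀ Z ∈ (Xᶜ).powerset.filter fun Z => Z.Nonempty,
                0 ≤ (if ∀ w ∈ Z, f w = f' w then p ^ O.card * p ^ O.card * c Z else 0) := by
              intro Z _
              split_ifs
              · have := hc0 Z; positivity
              · exact le_rfl
            split_ifs with hR
            · obtain ⟨w, hw, hfw⟩ := hR
              refine (hunion f f').trans (le_trans ?_ (Finset.single_le_sum hnn
                (a := (Xᶜ).filter fun w => f w = f' w) ?_))
              · rw [if_pos]
                intro w hw; exact (Finset.mem_filter.1 hw).2
              · rw [Finset.mem_filter, Finset.mem_powerset]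
                exact ⟨Finset.filter_subset _ _, ⟨w, by simp [hw, hfw]⟩⟩
            · exact Finset.sum_nonneg hnn
        _ = ∑ Z ∈ (Xᶜ).powerset with Z.Nonempty,
              p ^ O.card * p ^ O.card * ((m : ℝ) ^ k *
              ((m : ℝ) ^ Z.card * p ^ (eIn Γ (X ∪ Z) - eIn Γ X))⁻¹) := by
            rw [Finset.sum_comm]
            refine Finset.sum_congr rfl fun Z _ => ?_
            rw [← Finset.sum_filter, Finset.sum_const, card_piFinset_agree, nsmul_eq_mul, hc]
            have hZk : Z.card ≤ k := (Finset.card_le_univ Z).trans_eq (Fintype.card_fin k)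
            have hmk : (m : ℝ) ^ k = (m : ℝ) ^ (k - Z.card) * (m : ℝ) ^ Z.card := by
              rw [← pow_add, Nat.sub_add_cancel hZk]
            have hm' : (m : ℝ) ≠ 0 := by exact_mod_cast hm.ne'
            rw [hmk]
            push_cast
            field_simp
        _ ≤ _ := by
            rw [← Finset.mul_sum, ← Finset.mul_sum]
            gcongr
    calc _ ≤ ∑ _f : Fin k → Fin m, p ^ O.card * p ^ O.card * ((m : ℝ) ^ k * B) :=
          Finset.sum_le_sum fun f _ => hstep f
      _ = _ := by
          rw [Finset.sum_const, Finset.card_univ, Fintype.card_pi]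
          simp
          ring
  refine Real.exp_le_exp.2 (neg_le_neg ?_)
  rw [hμ]
  have hμ0 : 0 < (m : ℝ) ^ k * p ^ O.card := by positivity
  set D := ∑ f, ∑ f', (if R f f' then ∏ e ∈ T f ∪ T f', edgeProb p e else 0) with hDdef
  have hD0 : 0 < D := by
    have hp : ∀ T : Finset (Sym2 (Fin n)), 0 ≤ ∏ e ∈ T, edgeProb p e := fun T =>
      Finset.prod_nonneg fun e _ => h0 e
    refine lt_of_lt_of_le hμ0 (hμ ▸ Finset.sum_le_sum fun f _ => ?_)
    refine le_trans ?_ (Finset.single_le_sum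
      (f := fun f' => if R f f' then ∏ e ∈ T f ∪ T f', edgeProb p e else 0)
      (fun f' _ => by split_ifs <;> simp [hp]) (Finset.mem_univ f))
    rw [if_pos ⟨w₀, hw₀, rfl⟩, Finset.union_self]
  rw [div_le_div_iff₀ (by positivity) (by positivity)]
  nlinarith

end Extension

end GraphBootstrap

/-! ### Second-moment sums and the union bound over rooted graphs -/

namespace GraphBootstrap

section SumBound

variable {k n m b L : ℕ} {p ρ η : ℝ}

/-- The second-moment sum of a sparse rooted graph. -/
lemma sum_inv_le (hp0 : 0 < p) (hp1 : p ≤ 1) (hm : 0 < m) (hk : k ≤ L) (hL : 0 < L) (hη : 0 ≤ η)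
    (hsmall : ∀ z : ℕ, 0 < z → z < b → ∀ E : ℕ, (E : ℝ) ≤ ρ * z → ((m : ℝ) ^ z * p ^ E)⁻¹ ≤ η)
    (hτ : 2 * (L : ℝ) ≤ m * p ^ ρ) {Γ : SimpleGraph (Fin k)} {X : Finset (Fin k)}
    (hX : ∀ Z, X ⊆ Z → excess Γ ρ Z ≤ excess Γ ρ X) :
    ∑ Z ∈ (Xᶜ).powerset with Z.Nonempty,
      ((m : ℝ) ^ Z.card * p ^ (eIn Γ (X ∪ Z) - eIn Γ X))⁻¹ ≤
      b * L ^ b * η + 2 * (L / (m * p ^ ρ)) ^ b := by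
  classical
  set τ := (m : ℝ) * p ^ ρ with hτdef
  have hτ0 : 0 < τ := by positivity
  have hL1 : (1 : ℝ) ≤ L := by exact_mod_cast hL
  set r := (L : ℝ) / τ with hr
  have hr0 : 0 ≤ r := by positivity
  have hr1 : r ≤ 1 / 2 := by rw [hr, div_le_div_iff₀ hτ0 two_pos]; linarith
  -- Sets with fewer than b vertices are bounded by η, larger ones by the worst case E = ρ z, which
  -- gives a geometric series.
  let f : ℕ → ℝ := fun z => if z = 0 then 0 else if z < b then η else (τ⁻¹) ^ z
  have hf0 : ∀ z, 0 ≤ f z := by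
    intro z
    simp only [f]
    split_ifs <;> first | exact le_rfl | exact hη | positivity
  have hterm : ∀ Z ∈ (Xᶜ).powerset.filter fun Z => Z.Nonempty,
      ((m : ℝ) ^ Z.card * p ^ (eIn Γ (X ∪ Z) - eIn Γ X))⁻¹ ≤ f Z.card := by
    intro Z hZ
    obtain ⟨hZX, hZn⟩ := Finset.mem_filter.1 hZ
    have hdisj : Disjoint X Z := by
      rw [Finset.mem_powerset] at hZX
      exact Finset.disjoint_left.2 fun x hx hxZ => Finset.mem_compl.1 (hZX hxZ) hx
    have hmono : eIn Γ X ≤ eIn Γ (X ∪ Z) := eIn_mono le_rfl Finset.subset_union_left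
    have hE : ((eIn Γ (X ∪ Z) - eIn Γ X : ℕ) : ℝ) ≤ ρ * Z.card := by
      have h := hX (X ∪ Z) Finset.subset_union_left
      rw [excess, excess, Finset.card_union_of_disjoint hdisj] at h
      push_cast [hmono] at h ⊢
      linarith
    have hz : Z.card ≠ 0 := hZn.card_pos.ne'
    simp only [f, hz, if_false]
    split_ifs with hb
    · exact hsmall _ hZn.card_pos hb _ hE
    · rw [inv_pow]
      refine inv_anti₀ (by positivity) ?_
      rw [hτdef, mul_pow, ← Real.rpow_natCast (p ^ ρ), ← Real.rpow_mul hp0.le]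
      gcongr
      rw [← Real.rpow_natCast p]
      exact Real.rpow_le_rpow_of_exponent_ge hp0 hp1 hE
  have hchoose : ∀ z, ((k.choose z : ℕ) : ℝ) ≤ (L : ℝ) ^ z := fun z => by
    refine le_trans (b := ((k : ℝ)) ^ z) (by exact_mod_cast Nat.choose_le_pow k z) ?_
    gcongr
  have hsplit : ∀ z, (L : ℝ) ^ z * f z ≤
      (if z < b then (L : ℝ) ^ b * η else 0) + (if b ≤ z then r ^ z else 0) := by
    intro z
    simp only [f]
    rcases lt_or_ge z b with hb | hb
    · rw [if_pos hb, if_pos hb, if_neg (by omega : ¬ b ≤ z), add_zero]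
      split_ifs
      · rw [mul_zero]; positivity
      · have : (L : ℝ) ^ z ≤ (L : ℝ) ^ b := pow_le_pow_right₀ hL1 hb.le
        gcongr
    · rw [if_neg (by omega : ¬ z < b), if_neg (by omega : ¬ z < b), if_pos hb, zero_add]
      split_ifs
      · rw [mul_zero]; positivity
      · rw [hr, div_eq_mul_inv, mul_pow]
  calc _ ≤ ∑ Z ∈ (Xᶜ).powerset with Z.Nonempty, f Z.card := Finset.sum_le_sum hterm
    _ ≤ ∑ Z ∈ (Finset.univ : Finset (Fin k)).powerset, f Z.card := by
        refine Finset.sum_le_sum_of_subset_of_nonneg (fun Z _ => ?_) fun Z _ _ => hf0 _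
        exact Finset.mem_powerset.2 (Finset.subset_univ _)
    _ = ∑ z ∈ Finset.range (k + 1), (k.choose z : ℝ) * f z := by
        rw [Finset.sum_powerset_apply_card, Finset.card_univ, Fintype.card_fin]
        exact Finset.sum_congr rfl fun z _ => nsmul_eq_mul _ _
    _ ≤ ∑ z ∈ Finset.range (k + 1),
          ((if z < b then (L : ℝ) ^ b * η else 0) + (if b ≤ z then r ^ z else 0)) :=
        Finset.sum_le_sum fun z _ =>
          (mul_le_mul_of_nonneg_right (hchoose z) (hf0 z)).trans (hsplit z)
    _ ≤ _ := by
        rw [Finset.sum_add_distrib]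
        refine add_le_add ?_ ?_
        · rw [← Finset.sum_filter, Finset.sum_const, nsmul_eq_mul, mul_assoc]
          gcongr
          calc _ ≤ (Finset.range b).card := Finset.card_le_card fun z hz =>
                Finset.mem_range.2 (Finset.mem_filter.1 hz).2
            _ = b := Finset.card_range b
        · rw [← Finset.sum_filter]
          have h : (Finset.range (k + 1)).filter (fun z => b ≤ z) = Finset.Ico b (k + 1) := by
            ext z; simp [and_comm]
          rw [h]
          refine (geom_sum_Ico_le_of_lt_one hr0 (by linarith)).trans ?_
          rw [div_le_iff₀ (by linarith)]
          nlinarith [pow_nonneg hr0 b]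

lemma card_simpleGraph_le (k : ℕ) : Nat.card (SimpleGraph (Fin k)) ≤ 2 ^ (k * k) := by
  classical
  have h1 : Nat.card (SimpleGraph (Fin k)) ≤ Nat.card (Set (Sym2 (Fin k))) :=
    Nat.card_le_card_of_injective (fun G => G.edgeSet) SimpleGraph.edgeSet_injective
  have h2 : Fintype.card (Sym2 (Fin k)) ≤ k * k := by
    have h := Fintype.card_le_of_surjective (α := Fin k × Fin k)
      (fun x => s(x.1, x.2)) (fun e => by induction e with | _ a b => exact ⟨(a, b), rfl⟩)
    simpa using h
  rw [Nat.card_eq_fintype_card (α := Set (Sym2 (Fin k))), Fintype.card_set] at h1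
  exact h1.trans (Nat.pow_le_pow_right two_pos h2)

/-- The probability that the binomial random graph lacks some sparse extension. -/
theorem bprob_not_hasSparseExtensions_le (hp0 : 0 < p) (hp1 : p ≤ 1) (hm : 0 < m) (hL : 0 < L)
    (hLm : L * m + L ≤ n) (hη : 0 ≤ η)
    (hsmall : ∀ z : ℕ, 0 < z → z < b → ∀ E : ℕ, (E : ℝ) ≤ ρ * z → ((m : ℝ) ^ z * p ^ E)⁻¹ ≤ η)
    (hτ : 2 * (L : ℝ) ≤ m * p ^ ρ) :
    bprob (edgeProb p) (fun S : Finset (Sym2 (Fin n)) =>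
      ¬ HasSparseExtensions (SimpleGraph.fromEdgeSet (S : Set (Sym2 (Fin n)))) ρ L) ≤
      (L + 1) * 2 ^ (L * L) * 2 ^ L * n ^ L *
        Real.exp (-(1 / (2 * (b * L ^ b * η + 2 * (L / (m * p ^ ρ)) ^ b)))) := by
  classical
  have h0 : ∀ e : Sym2 (Fin n), 0 ≤ edgeProb p e := edgeProb_nonneg hp0.le
  have h1 : ∀ e : Sym2 (Fin n), edgeProb p e ≤ 1 := edgeProb_le_one hp1
  have hn : 1 ≤ n := by omega
  let ι := Σ k : Fin (L + 1), SimpleGraph (Fin k) × Finset (Fin k) × (Fin k → Fin n)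
  have : Fintype ι := Fintype.ofFinite ι
  let Q : ι → Finset (Sym2 (Fin n)) → Prop := fun i S =>
    (∀ Z, i.2.2.1 ⊆ Z → excess i.2.1 ρ Z ≤ excess i.2.1 ρ i.2.2.1) ∧ Set.InjOn i.2.2.2 i.2.2.1 ∧
    ¬ ∃ ψ : Fin i.1 → Fin n, Function.Injective ψ ∧ (∀ x ∈ i.2.2.1, ψ x = i.2.2.2 x) ∧
      ∀ a b, i.2.1.Adj a b → ¬ (a ∈ i.2.2.1 ∧ b ∈ i.2.2.1) →
        (SimpleGraph.fromEdgeSet (S : Set (Sym2 (Fin n)))).Adj (ψ a) (ψ b)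
  set B := b * (L : ℝ) ^ b * η + 2 * (L / (m * p ^ ρ)) ^ b with hB
  have hB0 : 0 < B := by positivity
  have hcard : (Fintype.card ι : ℝ) ≤ (L + 1) * 2 ^ (L * L) * 2 ^ L * n ^ L := by
    have h : Nat.card ι ≤ (L + 1) * (2 ^ (L * L) * (2 ^ L * n ^ L)) := by
      rw [Nat.card_sigma]
      refine (Finset.sum_le_card_nsmul _ _ (2 ^ (L * L) * (2 ^ L * n ^ L)) fun k _ => ?_).trans ?_
      · have hk : (k : ℕ) ≤ L := Nat.lt_succ_iff.1 k.2
        rw [Nat.card_prod, Nat.card_prod]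
        refine Nat.mul_le_mul ((card_simpleGraph_le k).trans
          (Nat.pow_le_pow_right two_pos (Nat.mul_le_mul hk hk))) (Nat.mul_le_mul ?_ ?_)
        · rw [Nat.card_eq_fintype_card, Fintype.card_finset, Fintype.card_fin]
          exact Nat.pow_le_pow_right two_pos hk
        · rw [Nat.card_eq_fintype_card, Fintype.card_pi]
          simpa using Nat.pow_le_pow_right hn hk
      · simp
    rw [Nat.card_eq_fintype_card] at h
    calc (Fintype.card ι : ℝ) ≤ ((L + 1) * (2 ^ (L * L) * (2 ^ L * n ^ L)) : ℕ) := by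
          exact_mod_cast h
      _ = _ := by push_cast; ring
  have hQ : ∀ i, bprob (edgeProb p) (Q i) ≤ Real.exp (-(1 / (2 * B))) := by
    intro i
    by_cases hi : (∀ Z, i.2.2.1 ⊆ Z → excess i.2.1 ρ Z ≤ excess i.2.1 ρ i.2.2.1) ∧
        Set.InjOn i.2.2.2 i.2.2.1
    · have hk : (i.1 : ℕ) ≤ L := Nat.lt_succ_iff.1 i.1.2
      refine (bprob_mono h0 h1 fun S hS => hS.2.2).trans
        (bprob_not_exists_extension_le hp0 hp1 i.2.1 i.2.2.1 i.2.2.2 hi.2 hm ?_ hB0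
          (sum_inv_le hp0 hp1 hm hk hL hη hsmall hτ hi.1))
      nlinarith
    · refine le_trans (bprob_mono h0 h1 (Q' := fun _ => False) fun S hS => hi ⟨hS.1, hS.2.1⟩) ?_
      simp [bprob, Real.exp_nonneg]
  refine (bprob_mono h0 h1 (Q' := fun S => ∃ i ∈ Finset.univ, Q i S) fun S hS => ?_).trans
    ((bprob_exists_le h0 h1 Finset.univ Q).trans
    ((Finset.sum_le_card_nsmul _ _ _ fun i _ => hQ i).trans ?_))
  · unfold HasSparseExtensions at hS
    push Not at hS
    obtain ⟨k, hk, Γ, X, hX, φ, hφ, hS⟩ := hS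
    refine ⟨⟨⟨k, Nat.lt_succ_iff.2 hk⟩, Γ, X, φ⟩, Finset.mem_univ _, hX, hφ, ?_⟩
    rintro ⟨ψ, hψ1, hψ2, hψ3⟩
    obtain ⟨a, b, hab, hX, hS⟩ := hS ψ hψ1 hψ2
    exact hS (hψ3 a b hab fun h => hX h.1 h.2)
  · rw [nsmul_eq_mul, Finset.card_univ]
    gcongr

end SumBound

end GraphBootstrap

/-! ### Upper bound: choice of parameters -/

namespace GraphBootstrap

lemma percProb_eq_bprob {W : Type*} (H : SimpleGraph W) (n : ℕ) (p : I) :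
    percProb H n p = bprob (edgeProb (p : ℝ)) fun S : Finset (Sym2 (Fin n)) =>
      hClosure H (SimpleGraph.fromEdgeSet (S : Set (Sym2 (Fin n)))) = ⊤ := by
  rw [percProb, binomialRandom_real_eq_bprob]
  exact bprob_congr _ fun S => Iff.rfl

lemma percProb_nonneg {W : Type*} (H : SimpleGraph W) (n : ℕ) (p : I) : 0 ≤ percProb H n p :=
  MeasureTheory.measureReal_nonneg

lemma percProb_le_one {W : Type*} (H : SimpleGraph W) (n : ℕ) (p : I) : percProb H n p ≤ 1 := by
  rw [percProb_eq_bprob, ← bprob_true (edgeProb (V := Fin n) (p : ℝ))]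
  exact bprob_mono (edgeProb_nonneg p.2.1) (edgeProb_le_one p.2.2) fun _ _ => trivial

lemma one_sub_le_percProb {W : Type*} [Fintype W] {H : SimpleGraph W} {ρ₁ ρ₂ : ℝ} (hρ₁ : 0 ≤ ρ₁)
    (hρ : ρ₁ < ρ₂) (hH : activationDensity H < ENNReal.ofReal ρ₁) {L : ℕ}
    (hL : ρ₂ * Fintype.card W ≤ (ρ₂ - ρ₁) * L) (n : ℕ) (p : I) :
    1 - bprob (edgeProb (p : ℝ)) (fun S : Finset (Sym2 (Fin n)) =>
      ¬ HasSparseExtensions (SimpleGraph.fromEdgeSet (S : Set (Sym2 (Fin n)))) ρ₂ L) ≤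
    percProb H n p := by
  obtain ⟨V, _, _, A, e, he, hA⟩ := exists_sparse_of_activationDensity_lt hH
  rw [bprob_not, sub_sub_cancel, percProb_eq_bprob]
  exact bprob_mono (edgeProb_nonneg p.2.1) (edgeProb_le_one p.2.2) fun S hS =>
    hClosure_eq_top_of_hasSparseExtensions H hρ₁ hρ he hA hL hS

/-- The multiples `ρ z` with `0 < z < b` stay away from the integers, if they are not integers. -/
lemma exists_gap {ρ : ℝ} {b : ℕ} (h : ∀ z : ℕ, 0 < z → z < b → ∀ E : ℕ, (E : ℝ) ≠ ρ * z) :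
    ∃ c > (0 : ℝ), ∀ z : ℕ, 0 < z → z < b → ∀ E : ℕ, (E : ℝ) ≤ ρ * z + c → (E : ℝ) ≤ ρ * z - c := by
  have key : ∀ z : ℕ, 0 < z → z < b → ∃ d > (0 : ℝ), ∀ E : ℕ, d ≤ |ρ * z - E| := by
    intro z h0 hz
    by_cases hr : ∃ E : ℕ, (E : ℤ) = round (ρ * z)
    · obtain ⟨E, hE⟩ := hr
      refine ⟨|ρ * z - round (ρ * z)|, ?_, fun E' => by simpa using round_le (ρ * z) (E' : ℤ)⟩
      rw [← hE, gt_iff_lt, abs_pos, sub_ne_zero]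
      exact fun h' => h z h0 hz E (by simpa using h'.symm)
    -- The nearest integer is then not a natural number, so every natural number is at distance at
    -- least 1/2.
    · refine ⟨1 / 2, by norm_num, fun E => ?_⟩
      by_contra! hlt
      have h1 := abs_sub_round (ρ * z)
      refine hr ⟨E, ?_⟩
      by_contra hne
      have h2 : |(E : ℝ) - round (ρ * z)| < 1 := by
        calc _ = |(ρ * z - round (ρ * z)) - (ρ * z - E)| := by ring_nf
          _ ≤ |ρ * z - round (ρ * z)| + |ρ * z - E| := abs_sub _ _
          _ < 1 := by linarith
      have h3 : |(E : ℤ) - round (ρ * z)| < 1 := by exact_mod_cast h2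
      rw [Int.abs_lt_one_iff] at h3
      omega
  have hev : ∀ z ∈ Finset.Ioo 0 b, ∀ᶠ c in nhdsWithin (0 : ℝ) (Set.Ioi 0), ∀ E : ℕ,
      2 * c ≤ |ρ * z - E| := by
    intro z hz
    obtain ⟨d, hd, hdE⟩ := key z (Finset.mem_Ioo.1 hz).1 (Finset.mem_Ioo.1 hz).2
    filter_upwards [Ioo_mem_nhdsGT (show (0 : ℝ) < d / 2 by linarith)] with c hc E
    have := hc.2
    exact le_trans (by linarith) (hdE E)
  obtain ⟨c, hc, hc0⟩ := (((Filter.eventually_all_finset _).2 hev).and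
    self_mem_nhdsWithin).exists
  refine ⟨c, hc0, fun z h0 hz E hE => ?_⟩
  have h1 := hc z (Finset.mem_Ioo.2 ⟨h0, hz⟩) E
  have hc0' : 0 < c := hc0
  rcases le_abs.1 h1 with h2 | h2 <;> linarith

/-- For a reduced fraction a/b, integrality of ρ z would make b divide z. -/
lemma natCast_ne_mul {ρ : ℝ} {b : ℕ}
    (h : Irrational ρ ∨ ∃ a : ℕ, a.Coprime b ∧ ρ = (a : ℝ) / (b : ℝ)) (z : ℕ) (h0 : 0 < z)
    (hz : z < b) (E : ℕ) : (E : ℝ) ≠ ρ * z := by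
  intro hE
  rcases h with h | ⟨a, hab, rfl⟩
  · exact (h.mul_natCast h0.ne').ne_nat E hE.symm
  · have hb : (b : ℝ) ≠ 0 := by exact_mod_cast (h0.trans hz).ne'
    have h1 : E * b = a * z := by
      have : (E : ℝ) * b = a * z := by rw [hE]; field_simp
      exact_mod_cast this
    have h2 : b ∣ z := hab.symm.dvd_of_dvd_mul_left (h1 ▸ dvd_mul_left b E)
    exact absurd (Nat.le_of_dvd h0 h2) (by omega)

/-- For L = O(log n) the number of rooted graphs with placed roots is exp(O(log² n)); each of the
four factors contributes at most C² l² to the exponent. -/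
lemma union_factor_le {L n : ℕ} {C l : ℝ} (hl : 1 ≤ l) (hn : l = Real.log n) (hn0 : 0 < n)
    (hC : 1 ≤ C) (hLC : (L : ℝ) ≤ C * l) :
    ((L : ℝ) + 1) * 2 ^ (L * L) * 2 ^ L * n ^ L ≤ Real.exp (4 * C ^ 2 * l ^ 2) := by
  have h2 : (2 : ℝ) ≤ Real.exp 1 := by linarith [Real.add_one_le_exp (1 : ℝ)]
  have hnl : (n : ℝ) = Real.exp l := by
    rw [hn, Real.exp_log (by exact_mod_cast hn0)]
  have hpow : ∀ k : ℕ, (2 : ℝ) ^ k ≤ Real.exp k := fun k => by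
    calc (2 : ℝ) ^ k ≤ Real.exp 1 ^ k := by gcongr
      _ = Real.exp k := by rw [← Real.exp_nat_mul, mul_one]
  calc _ ≤ Real.exp L * Real.exp ((L * L : ℕ) : ℝ) * Real.exp L * Real.exp (L * l) := by
        rw [hnl, ← Real.exp_nat_mul]
        gcongr
        · exact Real.add_one_le_exp _
        · exact hpow _
        · exact hpow _
    _ = Real.exp (L + L * L + L + L * l) := by
        rw [← Real.exp_add, ← Real.exp_add, ← Real.exp_add]; push_cast; rfl
    _ ≤ _ := by
        refine Real.exp_le_exp.2 ?_
        have hL0 : (0 : ℝ) ≤ L := Nat.cast_nonneg L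
        have a1 : C * l ≤ C ^ 2 * l ^ 2 := by
          rw [← mul_pow]; nlinarith [mul_le_mul hC hl zero_le_one (by linarith)]
        have a2 : (L : ℝ) * L ≤ C ^ 2 * l ^ 2 := by
          rw [← mul_pow, sq]; gcongr
        have a3 : (L : ℝ) * l ≤ C ^ 2 * l ^ 2 := by
          calc (L : ℝ) * l ≤ C * l * l := by gcongr
            _ ≤ C ^ 2 * l ^ 2 := by nlinarith [mul_nonneg (sub_nonneg.2 hC) (sq_nonneg l)]
        linarith

set_option maxHeartbeats 1000000 in
/-- Percolation is likely as soon as `n p ^ ρ` is a large multiple of `log n ^ (2 + 2 / b)`. -/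
lemma one_sub_exp_le_percProb {W : Type*} [Fintype W] {H : SimpleGraph W} {ρ : ℝ} (hρ : 1 ≤ ρ)
    (hH : activationDensity H = ENNReal.ofReal ρ) {b : ℕ} (hb : 0 < b) {c : ℝ}
    (hc : ∀ z : ℕ, 0 < z → z < b → ∀ E : ℕ, (E : ℝ) ≤ ρ * z + c → (E : ℝ) ≤ ρ * z - c)
    {C A l : ℝ} (hC : C = (ρ + 2) * Fintype.card W + 2)
    (hA : (4 * C ^ 2 + 1) * (2 * (8 * Real.exp 2 * C ^ 2 + 1)) ≤ A) {n : ℕ} {p : I}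
    (hl : l = Real.log n) (hp : (n : ℝ) * (p : ℝ) ^ ρ = A * l ^ (2 + 2 / (b : ℝ)))
    (h1 : 1 ≤ l) (h2 : 2 * C * l ≤ n) (h3 : 2 * b ≤ c * l)
    (h4 : b * (C * l) ^ b * (p : ℝ) ^ c * (A * l ^ 2) ≤ 1) :
    1 - Real.exp (-l ^ 2) ≤ percProb H n p := by
  have hl0 : 0 < l := by linarith
  have hρ0 : 0 < ρ := by linarith
  have hC2 : 2 ≤ C := by rw [hC]; have : 0 ≤ (ρ + 2) * (Fintype.card W : ℝ) := by positivity
                         linarith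
  have hbR : (1 : ℝ) ≤ b := by exact_mod_cast hb
  have he2 : 1 ≤ Real.exp 2 := Real.one_le_exp (by norm_num)
  have hCC : 4 ≤ C ^ 2 := by nlinarith
  have hCe : 4 ≤ Real.exp 2 * C ^ 2 := by nlinarith
  have hA1 : 8 * Real.exp 2 * C ^ 2 ≤ A := by nlinarith
  have hA0 : 1 ≤ A := by linarith
  have hnR : (0 : ℝ) < n := by nlinarith
  have hn : 0 < n := by exact_mod_cast hnR
  have hnl : (n : ℝ) = Real.exp l := by rw [hl, Real.exp_log hnR]
  have hp0 : 0 < (p : ℝ) := by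
    refine lt_of_le_of_ne p.2.1 fun h => ?_
    rw [← h, Real.zero_rpow hρ0.ne', mul_zero] at hp
    have : 0 < A * l ^ (2 + 2 / (b : ℝ)) := by positivity
    linarith
  have hp1 : (p : ℝ) ≤ 1 := p.2.2
  -- the parameters
  obtain ⟨δ, hδ⟩ : ∃ x, x = 1 / l := ⟨_, rfl⟩
  have hδ0 : 0 < δ := by rw [hδ]; positivity
  have hδl : δ * l = 1 := by rw [hδ]; field_simp
  have hδ1 : δ ≤ 1 := by rw [hδ, div_le_one hl0]; exact h1
  obtain ⟨L, hLdef⟩ : ∃ x, x = ⌈(ρ + 2) * Fintype.card W * l⌉₊ + 1 := ⟨_, rfl⟩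
  have hLlow : (ρ + 2) * Fintype.card W * l ≤ L := by
    rw [hLdef]; push_cast
    linarith [Nat.le_ceil ((ρ + 2) * Fintype.card W * l)]
  have hLC : (L : ℝ) ≤ C * l := by
    rw [hLdef, hC]; push_cast
    have := Nat.ceil_lt_add_one (show 0 ≤ (ρ + 2) * Fintype.card W * l by positivity)
    nlinarith
  have hL0 : 0 < L := by omega
  have hLR : (0 : ℝ) < L := by exact_mod_cast hL0
  have h2L : 2 * L ≤ n := by
    have : (2 : ℝ) * L ≤ n := by linarith
    exact_mod_cast this
  -- L classes of this size use at most half of the vertices and leave room for the roots.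
  obtain ⟨m, hmdef⟩ : ∃ x, x = n / (2 * L) := ⟨_, rfl⟩
  have hm : 0 < m := hmdef ▸ Nat.div_pos h2L (by omega)
  have hmR : (0 : ℝ) < m := by exact_mod_cast hm
  have hml : m * (2 * L) ≤ n := hmdef ▸ Nat.div_mul_le_self _ _
  have hmu : (n : ℝ) ≤ 4 * L * m := by
    have : n < 2 * L * (n / (2 * L) + 1) := Nat.lt_mul_div_succ n (by omega)
    rw [← hmdef] at this
    have : n ≤ 4 * L * m := by nlinarith
    exact_mod_cast this
  have hLm : L * m + L ≤ n := by nlinarith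
  have hmain := one_sub_le_percProb (H := H) (ρ₁ := ρ + δ) (ρ₂ := ρ + 2 * δ) (by linarith)
    (by linarith) (by rw [hH]; exact (ENNReal.ofReal_lt_ofReal_iff (by linarith)).2 (by linarith))
    (L := L) (by
      have : (ρ + 2 * δ - (ρ + δ)) * L = δ * L := by ring
      rw [this]
      calc _ ≤ (ρ + 2) * (Fintype.card W : ℝ) :=
            mul_le_mul_of_nonneg_right (by linarith) (Nat.cast_nonneg _)
        _ = δ * ((ρ + 2) * Fintype.card W * l) := by
            linear_combination (-(ρ + 2) * (Fintype.card W : ℝ)) * hδl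
        _ ≤ _ := by gcongr) n p
  refine le_trans (sub_le_sub_left ?_ 1) hmain
  -- the sizes of the terms
  have hlpow : l ^ (2 + 2 / (b : ℝ)) = l ^ 2 * l ^ (2 / (b : ℝ)) := by
    rw [Real.rpow_add hl0]; norm_num
  have hx1 : 1 ≤ l ^ (2 / (b : ℝ)) := Real.one_le_rpow h1 (by positivity)
  -- Here ρ ≥ 1 is used: p ≥ p^ρ ≥ 1/n.
  have hpn : (n : ℝ)⁻¹ ≤ p := by
    have h5 : (n : ℝ)⁻¹ ≤ (p : ℝ) ^ ρ := by
      rw [inv_le_iff_one_le_mul₀ hnR, mul_comm, hp, hlpow]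
      have : 1 ≤ l ^ 2 := one_le_pow₀ h1
      exact one_le_mul_of_one_le_of_one_le hA0 (one_le_mul_of_one_le_of_one_le this hx1)
    refine h5.trans ?_
    calc (p : ℝ) ^ ρ ≤ (p : ℝ) ^ (1 : ℝ) := Real.rpow_le_rpow_of_exponent_ge hp0 hp1 hρ
      _ = p := Real.rpow_one _
  have hp2δ : (Real.exp 2)⁻¹ ≤ (p : ℝ) ^ (2 * δ) := by
    calc (Real.exp 2)⁻¹ = ((n : ℝ)⁻¹) ^ (2 * δ) := by
          rw [hnl, ← Real.exp_neg, ← Real.exp_neg, ← Real.exp_mul]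
          congr 1; linear_combination 2 * hδl
      _ ≤ _ := Real.rpow_le_rpow (by positivity) hpn (by positivity)
  have hmp : A * (l * l ^ (2 / (b : ℝ))) ≤ 4 * C * (m * (p : ℝ) ^ ρ) := by
    have h5 : A * (l ^ 2 * l ^ (2 / (b : ℝ))) ≤ 4 * (C * l) * m * (p : ℝ) ^ ρ := by
      rw [← hlpow, ← hp]
      gcongr
      refine hmu.trans ?_
      gcongr
    have h6 : l * (A * (l * l ^ (2 / (b : ℝ)))) ≤ l * (4 * C * (m * (p : ℝ) ^ ρ)) := by
      calc _ = A * (l ^ 2 * l ^ (2 / (b : ℝ))) := by ring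
        _ ≤ _ := h5
        _ = _ := by ring
    exact le_of_mul_le_mul_left h6 hl0
  obtain ⟨τ, hτ⟩ : ∃ x, x = (m : ℝ) * (p : ℝ) ^ (ρ + 2 * δ) := ⟨_, rfl⟩
  have hτ0 : 0 < τ := by rw [hτ]; positivity
  have hτlow : A * (l * l ^ (2 / (b : ℝ))) ≤ 4 * C * Real.exp 2 * τ := by
    refine hmp.trans ?_
    rw [hτ, Real.rpow_add hp0]
    have : 1 ≤ Real.exp 2 * (p : ℝ) ^ (2 * δ) := by
      rwa [inv_le_iff_one_le_mul₀ (by positivity), mul_comm] at hp2δ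
    calc 4 * C * (m * (p : ℝ) ^ ρ) = 4 * C * (m * (p : ℝ) ^ ρ) * 1 := by ring
      _ ≤ 4 * C * (m * (p : ℝ) ^ ρ) * (Real.exp 2 * (p : ℝ) ^ (2 * δ)) := by gcongr
      _ = _ := by ring
  have hratio : (L : ℝ) / τ ≤ 4 * Real.exp 2 * C ^ 2 / A * (l ^ (2 / (b : ℝ)))⁻¹ := by
    rw [div_le_iff₀ hτ0, ← div_eq_mul_inv, div_div, div_mul_eq_mul_div, le_div_iff₀ (by positivity)]
    calc (L : ℝ) * (A * l ^ (2 / (b : ℝ))) ≤ C * l * (A * l ^ (2 / (b : ℝ))) := by gcongr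
      _ = C * (A * (l * l ^ (2 / (b : ℝ)))) := by ring
      _ ≤ C * (4 * C * Real.exp 2 * τ) := by gcongr
      _ = _ := by ring
  have hC2A : 4 * Real.exp 2 * C ^ 2 / A ≤ 1 / 2 := by
    rw [div_le_div_iff₀ (by linarith) two_pos]; linarith
  have hτ2 : 2 * (L : ℝ) ≤ τ := by
    have h5 : (L : ℝ) / τ ≤ 1 / 2 := by
      refine hratio.trans ?_
      calc _ ≤ 1 / 2 * (1 : ℝ) := by
            gcongr
            exact inv_le_one_of_one_le₀ hx1
        _ = 1 / 2 := by norm_num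
    rw [div_le_div_iff₀ hτ0 two_pos] at h5
    linarith
  have hLpow : ((L : ℝ) / τ) ^ b ≤ 4 * Real.exp 2 * C ^ 2 / A / l ^ 2 := by
    calc ((L : ℝ) / τ) ^ b ≤ (4 * Real.exp 2 * C ^ 2 / A * (l ^ (2 / (b : ℝ)))⁻¹) ^ b := by gcongr
      _ = (4 * Real.exp 2 * C ^ 2 / A) ^ b * (l ^ 2)⁻¹ := by
          rw [mul_pow, inv_pow, ← Real.rpow_natCast (l ^ (2 / (b : ℝ))), ← Real.rpow_mul hl0.le,
            div_mul_cancel₀ _ (by positivity)]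
          norm_num
      _ ≤ (4 * Real.exp 2 * C ^ 2 / A) * (l ^ 2)⁻¹ := by
          gcongr
          exact pow_le_of_le_one (by positivity) (by linarith) hb.ne'
      _ = _ := by rw [← div_eq_mul_inv]
  have hmp1 : 1 ≤ (m : ℝ) * (p : ℝ) ^ ρ := by
    have hL1 : (1 : ℝ) ≤ L := by exact_mod_cast hL0
    calc (1 : ℝ) ≤ τ := by linarith
      _ ≤ _ := by
        rw [hτ]
        exact mul_le_mul_of_nonneg_left
          (Real.rpow_le_rpow_of_exponent_ge hp0 hp1 (by linarith)) hmR.le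
  -- For z < b the slack 2δz is below c, so E ≤ ρ z + c; by the gap E ≤ ρ z - c, a saving of p^c.
  have hsmall : ∀ z : ℕ, 0 < z → z < b → ∀ E : ℕ, (E : ℝ) ≤ (ρ + 2 * δ) * z →
      ((m : ℝ) ^ z * (p : ℝ) ^ E)⁻¹ ≤ (p : ℝ) ^ c := by
    intro z hz0 hzb E hE
    have hzR : (z : ℝ) ≤ b := by exact_mod_cast hzb.le
    have h5 : 2 * δ * z ≤ c := by
      have : 2 * b * δ ≤ c := by
        calc 2 * b * δ ≤ c * l * δ := by gcongr
          _ = c := by linear_combination c * hδl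
      nlinarith
    have h6 := hc z hz0 hzb E (by linarith)
    rw [inv_le_comm₀ (by positivity) (by positivity), ← Real.rpow_neg hp0.le]
    calc (p : ℝ) ^ (-c) ≤ (m * (p : ℝ) ^ ρ) ^ z * (p : ℝ) ^ (-c) :=
          le_mul_of_one_le_left (by positivity) (one_le_pow₀ hmp1)
      _ = (m : ℝ) ^ z * (p : ℝ) ^ (ρ * z - c) := by
          rw [mul_pow, ← Real.rpow_natCast ((p : ℝ) ^ ρ), ← Real.rpow_mul hp0.le, mul_assoc,
            ← Real.rpow_add hp0, sub_eq_add_neg]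
      _ ≤ (m : ℝ) ^ z * (p : ℝ) ^ E := by
          gcongr
          rw [← Real.rpow_natCast (p : ℝ)]
          exact Real.rpow_le_rpow_of_exponent_ge hp0 hp1 h6
  refine (bprob_not_hasSparseExtensions_le hp0 hp1 hm hL0 hLm
    (Real.rpow_nonneg hp0.le c) hsmall (hτ ▸ hτ2)).trans ?_
  rw [← hτ]
  obtain ⟨B, hBdef⟩ : ∃ x, x = b * (L : ℝ) ^ b * (p : ℝ) ^ c + 2 * ((L : ℝ) / τ) ^ b := ⟨_, rfl⟩
  rw [← hBdef]
  have hB0 : 0 < B := by rw [hBdef]; positivity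
  have hB : B ≤ (8 * Real.exp 2 * C ^ 2 + 1) / (A * l ^ 2) := by
    have h5 : b * (L : ℝ) ^ b * (p : ℝ) ^ c ≤ 1 / (A * l ^ 2) := by
      rw [le_div_iff₀ (by positivity)]
      refine le_trans ?_ h4
      gcongr
    have h6 : 2 * ((L : ℝ) / τ) ^ b ≤ 8 * Real.exp 2 * C ^ 2 / (A * l ^ 2) := by
      calc _ ≤ 2 * (4 * Real.exp 2 * C ^ 2 / A / l ^ 2) := by gcongr
        _ = _ := by rw [div_div]; ring
    calc B ≤ 1 / (A * l ^ 2) + 8 * Real.exp 2 * C ^ 2 / (A * l ^ 2) :=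
          hBdef ▸ add_le_add h5 h6
      _ = _ := by rw [← add_div, add_comm]
  -- The exponent beats the union factor `exp (4 C² l²)` by l²; this fixes the size of A.
  have hexp : (4 * C ^ 2 + 1) * l ^ 2 ≤ 1 / (2 * B) := by
    rw [le_div_iff₀ (by positivity)]
    have h5 : B * (A * l ^ 2) ≤ 8 * Real.exp 2 * C ^ 2 + 1 := by
      rwa [le_div_iff₀ (by positivity)] at hB
    have h6 : (4 * C ^ 2 + 1) * l ^ 2 * (2 * B) * A ≤ 1 * A := by
      calc _ = (4 * C ^ 2 + 1) * 2 * (B * (A * l ^ 2)) := by ring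
        _ ≤ (4 * C ^ 2 + 1) * 2 * (8 * Real.exp 2 * C ^ 2 + 1) := by gcongr
        _ = (4 * C ^ 2 + 1) * (2 * (8 * Real.exp 2 * C ^ 2 + 1)) := by ring
        _ ≤ _ := by linarith
    exact le_of_mul_le_mul_right h6 (by linarith)
  calc _ ≤ Real.exp (4 * C ^ 2 * l ^ 2) * Real.exp (-((4 * C ^ 2 + 1) * l ^ 2)) := by
        gcongr
        exact union_factor_le h1 hl hn (by linarith) hLC
    _ = Real.exp (-l ^ 2) := by rw [← Real.exp_add]; congr 1; ring

end GraphBootstrap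

/-! ### Upper bound: passage to the limit -/

namespace GraphBootstrap

lemma eventually_mul_rpow_le_exp (K s : ℝ) {a : ℝ} (ha : 0 < a) :
    ∀ᶠ x : ℝ in Filter.atTop, K * x ^ s ≤ Real.exp (a * x) := by
  have hK : 0 < |K| + 1 := by positivity
  filter_upwards [(isLittleO_rpow_exp_pos_mul_atTop s ha).bound (inv_pos.2 hK),
    Filter.eventually_ge_atTop 0] with x hx hx0
  rw [Real.norm_of_nonneg (Real.rpow_nonneg hx0 s), Real.norm_of_nonneg (Real.exp_nonneg _),
    inv_mul_eq_div, le_div_iff₀ hK] at hx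
  refine le_trans ?_ hx
  rw [mul_comm]
  exact mul_le_mul_of_nonneg_left (by linarith [le_abs_self K]) (Real.rpow_nonneg hx0 s)

lemma tendsto_log_natCast : Filter.Tendsto (fun n : ℕ => Real.log n) Filter.atTop Filter.atTop :=
  Real.tendsto_log_atTop.comp tendsto_natCast_atTop_atTop

/-- The upper bound on the percolation threshold. -/
theorem tendsto_percProb_one {W : Type*} [Fintype W] {H : SimpleGraph W} {ρ : ℝ} (hρ : 1 ≤ ρ)
    (hH : activationDensity H = ENNReal.ofReal ρ) {b : ℕ} (hb : 0 < b)
    (hρb : Irrational ρ ∨ ∃ a : ℕ, a.Coprime b ∧ ρ = (a : ℝ) / (b : ℝ)) :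
    ∃ A₀ > (0 : ℝ), ∀ A : ℝ, A₀ ≤ A → ∀ p : ℕ → I,
      (∀ᶠ n : ℕ in Filter.atTop, (n : ℝ) * (p n : ℝ) ^ ρ = A * Real.log n ^ (2 + 2 / (b : ℝ))) →
      Filter.Tendsto (fun n : ℕ => percProb H n (p n)) Filter.atTop (nhds 1) := by
  obtain ⟨c, hc0, hc⟩ := exists_gap (natCast_ne_mul hρb)
  have hρ0 : 0 < ρ := by linarith
  obtain ⟨C, hC⟩ : ∃ C, C = (ρ + 2) * (Fintype.card W : ℝ) + 2 := ⟨_, rfl⟩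
  have hC0 : 0 < C := by rw [hC]; positivity
  refine ⟨(4 * C ^ 2 + 1) * (2 * (8 * Real.exp 2 * C ^ 2 + 1)), by positivity,
    fun A hA p hp => ?_⟩
  have hA0 : 0 ≤ A := le_trans (by positivity) hA
  have hlow : Filter.Tendsto (fun n : ℕ => 1 - Real.exp (-Real.log n ^ 2)) Filter.atTop
      (nhds 1) := by
    have h : Filter.Tendsto (fun n : ℕ => Real.exp (-Real.log n ^ 2)) Filter.atTop (nhds 0) :=
      Real.tendsto_exp_neg_atTop_nhds_zero.comp
        ((Filter.tendsto_pow_atTop two_ne_zero).comp tendsto_log_natCast)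
    simpa using h.const_sub 1
  refine tendsto_of_tendsto_of_tendsto_of_le_of_le' hlow tendsto_const_nhds ?_
    (Filter.Eventually.of_forall fun n => percProb_le_one H n (p n))
  have hcρ : 0 < c / (2 * ρ) := by positivity
  filter_upwards [hp, Filter.eventually_gt_atTop 0,
    tendsto_log_natCast.eventually (Filter.eventually_ge_atTop 1),
    tendsto_log_natCast.eventually (eventually_mul_rpow_le_exp (2 * C) 1 one_pos),
    tendsto_log_natCast.eventually (Filter.eventually_ge_atTop (2 * b / c)),
    tendsto_log_natCast.eventually (eventually_mul_rpow_le_exp A (2 + 2 / (b : ℝ))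
      (show (0 : ℝ) < 1 / 2 by norm_num)),
    tendsto_log_natCast.eventually (eventually_mul_rpow_le_exp (b * C ^ b * A) (b + 2 : ℕ) hcρ)]
    with n hpn hn h1 h2 h3 h4 h5
  have hnR : (0 : ℝ) < n := by exact_mod_cast hn
  have hnl := Real.exp_log hnR
  set l := Real.log n with hl
  refine one_sub_exp_le_percProb hρ hH hb hc hC hA hl hpn h1 ?_ ?_ ?_
  · rwa [Real.rpow_one, one_mul, hnl] at h2
  · rw [div_le_iff₀ hc0] at h3; linarith
  · have hp0 : (0 : ℝ) ≤ p n := (p n).2.1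
    -- The logarithmic factor is at most n^(1/2), so p^c is a negative power of n and beats every
    -- power of log n.
    have h6 : (p n : ℝ) ^ ρ ≤ Real.exp (-(l / 2)) := by
      have h7 : (n : ℝ) * (p n : ℝ) ^ ρ ≤ n * Real.exp (-(l / 2)) := by
        rw [hpn]
        refine h4.trans_eq ?_
        rw [← hnl, ← Real.exp_add]; congr 1; ring
      exact le_of_mul_le_mul_left h7 hnR
    have h7 : (p n : ℝ) ^ c ≤ Real.exp (-(c / (2 * ρ) * l)) := by
      calc (p n : ℝ) ^ c = ((p n : ℝ) ^ ρ) ^ (c / ρ) := by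
            rw [← Real.rpow_mul hp0, mul_div_cancel₀ _ hρ0.ne']
        _ ≤ Real.exp (-(l / 2)) ^ (c / ρ) :=
            Real.rpow_le_rpow (Real.rpow_nonneg hp0 _) h6 (by positivity)
        _ = _ := by rw [← Real.exp_mul]; congr 1; field_simp
    rw [Real.rpow_natCast] at h5
    calc b * (C * l) ^ b * (p n : ℝ) ^ c * (A * l ^ 2)
        = b * C ^ b * A * l ^ (b + 2) * (p n : ℝ) ^ c := by rw [mul_pow]; ring
      _ ≤ Real.exp (c / (2 * ρ) * l) * Real.exp (-(c / (2 * ρ) * l)) := by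
          gcongr
      _ = 1 := by rw [← Real.exp_add, add_neg_cancel, Real.exp_zero]

end GraphBootstrap

/-! ### Tail bound for the number of edges in a fixed vertex set -/

namespace GraphBootstrap

/-- A given vertex set is unlikely to span many edges of the binomial random graph. -/
lemma bprob_le_eIn_le {n : ℕ} {p : ℝ} (hp0 : 0 ≤ p) (hp1 : p ≤ 1) (X : Finset (Fin n)) {t y : ℝ}
    (ht : 0 < t) (hy0 : 0 < y) (hy1 : y ≤ 1) (hy : Real.exp 1 * (X.card : ℝ) ^ 2 * p / 2 ≤ y * t) :
    bprob (edgeProb p) (fun S : Finset (Sym2 (Fin n)) =>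
      t ≤ eIn (SimpleGraph.fromEdgeSet (S : Set (Sym2 (Fin n)))) X) ≤ y ^ t := by
  classical
  have h0 : ∀ e : Sym2 (Fin n), 0 ≤ edgeProb p e := edgeProb_nonneg hp0
  have h1 : ∀ e : Sym2 (Fin n), edgeProb p e ≤ 1 := edgeProb_le_one hp1
  set M := ⌈t⌉₊ with hM
  have hM0 : 0 < M := Nat.ceil_pos.2 ht
  have hMt : t ≤ M := Nat.le_ceil t
  have hMR : (0 : ℝ) < M := by exact_mod_cast hM0
  set E := X.offDiag.image (Function.uncurry Sym2.mk) with hE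
  have hEcard : (E.card : ℝ) ≤ (X.card : ℝ) ^ 2 / 2 := by
    rw [hE, Sym2.card_image_offDiag]
    refine (Nat.choose_le_pow_div 2 X.card).trans_eq ?_
    norm_num
  have hstep : ∀ S : Finset (Sym2 (Fin n)),
      t ≤ eIn (SimpleGraph.fromEdgeSet (S : Set (Sym2 (Fin n)))) X →
      ∃ T ∈ E.powersetCard M, T ⊆ S := by
    intro S hS
    have hsub : (SimpleGraph.fromEdgeSet (S : Set (Sym2 (Fin n)))).edgeSet ∩
        (X.sym2 : Set (Sym2 (Fin n))) ⊆ ((E ∩ S : Finset (Sym2 (Fin n))) : Set (Sym2 (Fin n))) := by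
      rintro e ⟨he, heX⟩
      induction e with | _ a b =>
      rw [SimpleGraph.mem_edgeSet, SimpleGraph.fromEdgeSet_adj] at he
      rw [Finset.mem_coe, Finset.mk_mem_sym2_iff] at heX
      rw [Finset.mem_coe, Finset.mem_inter]
      exact ⟨Finset.mem_image.2 ⟨(a, b), Finset.mem_offDiag.2 ⟨heX.1, heX.2, he.2⟩, rfl⟩, he.1⟩
    have hcard : M ≤ (E ∩ S).card := by
      refine Nat.ceil_le.2 (hS.trans ?_)
      rw [← Set.ncard_coe_finset]
      exact_mod_cast Set.ncard_le_ncard hsub (Set.toFinite _)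
    obtain ⟨T, hT, hTc⟩ := Finset.exists_subset_card_eq hcard
    exact ⟨T, Finset.mem_powersetCard.2 ⟨hT.trans Finset.inter_subset_left, hTc⟩,
      hT.trans Finset.inter_subset_right⟩
  refine (bprob_mono h0 h1 hstep).trans ((bprob_exists_le h0 h1 _ fun T S => T ⊆ S).trans ?_)
  have hsum : ∑ T ∈ E.powersetCard M, bprob (edgeProb p) (fun S => T ⊆ S) ≤
      (E.card.choose M : ℝ) * p ^ M := by
    calc _ ≤ ∑ T ∈ E.powersetCard M, p ^ M := by
          refine Finset.sum_le_sum fun T hT => ?_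
          rw [bprob_subset, ← (Finset.mem_powersetCard.1 hT).2]
          exact prod_edgeProb_le hp0 T
      _ = _ := by rw [Finset.sum_const, Finset.card_powersetCard, nsmul_eq_mul]
  refine hsum.trans ?_
  -- M! ≥ (M/e)^M turns the union bound over M-sets of pairs into (e |E| p / M)^M.
  have hfac : (M : ℝ) ^ M / (M.factorial : ℝ) ≤ Real.exp 1 ^ M := by
    rw [← Real.exp_nat_mul, mul_one]
    exact Real.pow_div_factorial_le_exp _ (Nat.cast_nonneg M) M
  have hb : Real.exp 1 * E.card * p ≤ y * M := by
    calc Real.exp 1 * E.card * p ≤ Real.exp 1 * ((X.card : ℝ) ^ 2 / 2) * p := by gcongr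
      _ = Real.exp 1 * (X.card : ℝ) ^ 2 * p / 2 := by ring
      _ ≤ y * t := hy
      _ ≤ y * M := by gcongr
  have hf0 : (0 : ℝ) < M.factorial := by exact_mod_cast M.factorial_pos
  calc (E.card.choose M : ℝ) * p ^ M ≤ (E.card : ℝ) ^ M / M.factorial * p ^ M := by
        gcongr
        exact Nat.choose_le_pow_div M E.card
    _ ≤ y ^ M := by
        rw [div_le_iff₀ hf0] at hfac
        have hMM : (0 : ℝ) < (M : ℝ) ^ M := by positivity
        have h2 : (Real.exp 1 * E.card * p) ^ M ≤ (y * M) ^ M := by gcongr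
        rw [mul_pow, mul_pow, mul_pow] at h2
        rw [div_mul_eq_mul_div, div_le_iff₀ hf0]
        refine le_of_mul_le_mul_left ?_ hMM
        calc (M : ℝ) ^ M * ((E.card : ℝ) ^ M * p ^ M)
            ≤ (Real.exp 1 ^ M * M.factorial) * ((E.card : ℝ) ^ M * p ^ M) := by gcongr
          _ = (Real.exp 1 ^ M * (E.card : ℝ) ^ M * p ^ M) * M.factorial := by ring
          _ ≤ (y ^ M * (M : ℝ) ^ M) * M.factorial := by gcongr
          _ = _ := by ring
    _ ≤ y ^ t := by
        rw [← Real.rpow_natCast]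
        exact Real.rpow_le_rpow_of_exponent_ge hy0 hy1 hMt

end GraphBootstrap

namespace GraphBootstrap

/-! ### Lower bound: first-moment estimates -/

section LowerBound

variable {n L N : ℕ} {p ρ l ε : ℝ}

lemma exp_one_mul_nine_le : Real.exp 1 * 9 ≤ 26 := by
  have := Real.exp_one_lt_d9
  linarith

/-- Below the threshold, all vertex sets of logarithmic size are sparse. -/
lemma bprob_exists_le_excess_le (hp0 : 0 < p) (hp1 : p ≤ 1) (hρ : 1 ≤ ρ) (hl1 : 1 ≤ l)
    (hnl : (n : ℝ) = Real.exp l) (hlL : l ≤ L) (hLl : (L : ℝ) ≤ 2 * l) (hN : 2 * (N : ℝ) ≤ l)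
    (hpl : p * l ≤ 1 / 26) (hε : (n : ℝ) * (26 * (p * l)) ^ ρ ≤ Real.exp (-(2 * N + 6))) :
    bprob (edgeProb p) (fun S : Finset (Sym2 (Fin n)) => ∃ X : Finset (Fin n), L < X.card ∧
      X.card ≤ 2 * L ∧ -(ρ * N) ≤
        excess (SimpleGraph.fromEdgeSet (S : Set (Sym2 (Fin n)))) ρ X) ≤ Real.exp (-l) := by
  have h0 : ∀ e : Sym2 (Fin n), 0 ≤ edgeProb p e := edgeProb_nonneg hp0.le
  have h1 : ∀ e : Sym2 (Fin n), edgeProb p e ≤ 1 := edgeProb_le_one hp1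
  have hl0 : 0 < l := by linarith
  have hn0 : (0 : ℝ) < n := by rw [hnl]; exact Real.exp_pos _
  have hρ0 : 0 < ρ := by linarith
  set y := 26 * (p * l) with hy
  have hy0 : 0 < y := by positivity
  have hy1 : y ≤ 1 := by linarith
  let Q : ℕ → Finset (Fin n) → Finset (Sym2 (Fin n)) → Prop := fun x X S =>
    ρ * ((x : ℝ) - N) ≤ eIn (SimpleGraph.fromEdgeSet (S : Set (Sym2 (Fin n)))) X
  have hterm : ∀ x ∈ Finset.Ioc L (2 * L),
      bprob (edgeProb p) (fun S => ∃ X ∈ (Finset.univ : Finset (Fin n)).powersetCard x, Q x X S) ≤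
        Real.exp (-(3 * l)) := by
    intro x hx
    obtain ⟨hx1, hx2⟩ := Finset.mem_Ioc.1 hx
    have hx1' : (L : ℝ) ≤ x := by exact_mod_cast hx1.le
    have hx2' : (x : ℝ) ≤ 2 * L := by exact_mod_cast hx2
    have hxl : l ≤ x := hlL.trans hx1'
    have hx0 : (0 : ℝ) < x := by linarith
    have hxN : (x : ℝ) / 2 ≤ x - N := by linarith
    have hNx : N ≤ x := by
      have : (N : ℝ) ≤ x := by linarith
      exact_mod_cast this
    have hQ : ∀ X ∈ (Finset.univ : Finset (Fin n)).powersetCard x,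
        bprob (edgeProb p) (Q x X) ≤ y ^ (ρ * ((x : ℝ) - N)) := by
      intro X hX
      refine bprob_le_eIn_le hp0.le hp1 X (mul_pos hρ0 (by linarith)) hy0 hy1 ?_
      rw [(Finset.mem_powersetCard.1 hX).2]
      calc Real.exp 1 * (x : ℝ) ^ 2 * p / 2 = Real.exp 1 * x * p * (x / 2) := by ring
        _ ≤ y * (x / 2) := by
            refine mul_le_mul_of_nonneg_right ?_ (by positivity)
            calc Real.exp 1 * x * p ≤ Real.exp 1 * (4 * l) * p := by
                  gcongr; linarith
              _ = Real.exp 1 * 4 * (p * l) := by ring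
              _ ≤ y := by
                  rw [hy]
                  have := exp_one_mul_nine_le
                  gcongr
                  linarith [Real.exp_pos 1]
        _ ≤ y * (ρ * ((x : ℝ) - N)) := by
            gcongr
            nlinarith
    refine (bprob_exists_le h0 h1 _ (Q x)).trans ((Finset.sum_le_sum hQ).trans ?_)
    rw [Finset.sum_const, Finset.card_powersetCard, Finset.card_univ, Fintype.card_fin,
      nsmul_eq_mul]
    have hch : ((n.choose x : ℕ) : ℝ) ≤ (n : ℝ) ^ N * (n : ℝ) ^ (x - N) := by
      rw [← pow_add, Nat.add_sub_cancel' hNx]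
      exact_mod_cast Nat.choose_le_pow n x
    calc _ ≤ (n : ℝ) ^ N * (n : ℝ) ^ (x - N) * y ^ (ρ * ((x : ℝ) - N)) := by gcongr
      _ = (n : ℝ) ^ N * ((n : ℝ) * y ^ ρ) ^ (x - N) := by
          rw [mul_pow, ← Real.rpow_natCast (y ^ ρ), ← Real.rpow_mul hy0.le, Nat.cast_sub hNx,
            mul_assoc]
      _ ≤ Real.exp l ^ N * Real.exp (-(2 * N + 6)) ^ (x - N) := by rw [hnl] at hε ⊢; gcongr
      _ = Real.exp (N * l - (x - N) * (2 * N + 6)) := by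
          rw [← Real.exp_nat_mul, ← Real.exp_nat_mul, ← Real.exp_add, Nat.cast_sub hNx]
          congr 1; ring
      _ ≤ _ := by
          refine Real.exp_le_exp.2 ?_
          have hN0 : (0 : ℝ) ≤ N := Nat.cast_nonneg N
          -- Since x - N ≥ l/2, the constant 2N + 6 pays N l for the factor n^N and leaves exp(-3l),
          -- which survives the sum over x.
          have : l / 2 * (2 * N + 6) ≤ ((x : ℝ) - N) * (2 * N + 6) := by gcongr; linarith
          linarith
  refine (bprob_mono h0 h1 (Q' := fun S => ∃ x ∈ Finset.Ioc L (2 * L),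
      ∃ X ∈ (Finset.univ : Finset (Fin n)).powersetCard x, Q x X S) ?_).trans ?_
  · rintro S ⟨X, hX1, hX2, hX⟩
    refine ⟨X.card, Finset.mem_Ioc.2 ⟨hX1, hX2⟩, X,
      Finset.mem_powersetCard.2 ⟨Finset.subset_univ _, rfl⟩, ?_⟩
    rw [excess] at hX
    change ρ * ((X.card : ℝ) - N) ≤ _
    linarith
  · refine (bprob_exists_le h0 h1 _ _).trans ((Finset.sum_le_card_nsmul _ _ _ hterm).trans ?_)
    rw [Nat.card_Ioc, nsmul_eq_mul]
    have h2 : ((2 * L - L : ℕ) : ℝ) ≤ Real.exp (2 * l) := by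
      have : 2 * L - L = L := by omega
      rw [this]
      linarith [Real.add_one_le_exp (2 * l)]
    calc _ ≤ Real.exp (2 * l) * Real.exp (-(3 * l)) := by gcongr
      _ = _ := by rw [← Real.exp_add]; congr 1; ring

/-- Below the threshold, a given pair of vertices is unlikely to lie in a small dense set. -/
lemma bprob_exists_dense_le (hp0 : 0 < p) (hp1 : p ≤ 1) (hρ : 1 ≤ ρ) (hl1 : 1 ≤ l)
    (hn0 : 0 < n) (hLl : (L : ℝ) ≤ 2 * l) (hpl : p * l ≤ 1 / 26)
    (hε : (n : ℝ) * (26 * (p * l)) ^ ρ ≤ 1 / 4) {e : Sym2 (Fin n)} (he : ¬ e.IsDiag) :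
    bprob (edgeProb p) (fun S : Finset (Sym2 (Fin n)) => ∃ X : Finset (Fin n), e.toFinset ⊆ X ∧
      3 ≤ X.card ∧ X.card ≤ L ∧ ρ * ((X.card : ℝ) - 2) ≤
        eIn (SimpleGraph.fromEdgeSet (S : Set (Sym2 (Fin n)))) X) ≤ 1 / l := by
  have h0 : ∀ e : Sym2 (Fin n), 0 ≤ edgeProb p e := edgeProb_nonneg hp0.le
  have h1 : ∀ e : Sym2 (Fin n), edgeProb p e ≤ 1 := edgeProb_le_one hp1
  have hl0 : 0 < l := by linarith
  have hρ0 : 0 < ρ := by linarith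
  have hec : e.toFinset.card = 2 := Sym2.card_toFinset_of_not_isDiag e he
  let Q : ℕ → Finset (Fin n) → Finset (Sym2 (Fin n)) → Prop := fun z Z S =>
    ρ * (z : ℝ) ≤ eIn (SimpleGraph.fromEdgeSet (S : Set (Sym2 (Fin n)))) (e.toFinset ∪ Z)
  have hterm : ∀ z ∈ Finset.Icc 1 L,
      bprob (edgeProb p) (fun S => ∃ Z ∈ (Finset.univ : Finset (Fin n)).powersetCard z, Q z Z S) ≤
        (1 / 2) ^ z * (1 / (2 * l)) := by
    intro z hz
    obtain ⟨hz1, hz2⟩ := Finset.mem_Icc.1 hz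
    have hz1' : (1 : ℝ) ≤ z := by exact_mod_cast hz1
    have hz2' : (z : ℝ) ≤ L := by exact_mod_cast hz2
    have hzl : (z : ℝ) / (2 * l) ≤ 1 := by rw [div_le_one (by positivity)]; linarith
    -- The value is 13 p z; the factor z/(2l) ≤ 1 is split off because one copy of it yields the
    -- final 1/l.
    obtain ⟨y, hy⟩ : ∃ y, y = 26 * (p * l) * (z / (2 * l)) := ⟨_, rfl⟩
    have hyz : y = 13 * (p * z) := by rw [hy]; field_simp; ring
    have hy0 : 0 < y := by rw [hyz]; positivity
    have hy1 : y ≤ 1 := by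
      rw [hy]
      exact mul_le_one₀ (by linarith) (by positivity) hzl
    have hQ : ∀ Z ∈ (Finset.univ : Finset (Fin n)).powersetCard z,
        bprob (edgeProb p) (Q z Z) ≤ y ^ (ρ * (z : ℝ)) := by
      intro Z hZ
      refine bprob_le_eIn_le hp0.le hp1 _ (mul_pos hρ0 (by linarith)) hy0 hy1 ?_
      -- 2 + z ≤ 3z as z ≥ 1; its square is the 9 in 9e ≤ 26.
      have hcard : ((e.toFinset ∪ Z).card : ℝ) ≤ 3 * z := by
        have h2 := Finset.card_union_le e.toFinset Z
        rw [hec, (Finset.mem_powersetCard.1 hZ).2] at h2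
        have : (e.toFinset ∪ Z).card ≤ 3 * z := by omega
        exact_mod_cast this
      calc Real.exp 1 * ((e.toFinset ∪ Z).card : ℝ) ^ 2 * p / 2
          ≤ Real.exp 1 * (3 * z) ^ 2 * p / 2 := by gcongr
        _ = (Real.exp 1 * 9) * (p * (z : ℝ) ^ 2 / 2) := by ring
        _ ≤ 26 * (p * (z : ℝ) ^ 2 / 2) := by
            gcongr
            exact exp_one_mul_nine_le
        _ = y * (1 * z) := by rw [hyz]; ring
        _ ≤ y * (ρ * z) := by gcongr
    refine (bprob_exists_le h0 h1 _ (Q z)).trans ((Finset.sum_le_sum hQ).trans ?_)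
    rw [Finset.sum_const, Finset.card_powersetCard, Finset.card_univ, Fintype.card_fin,
      nsmul_eq_mul]
    have hch : ((n.choose z : ℕ) : ℝ) ≤ (n : ℝ) ^ z := by exact_mod_cast Nat.choose_le_pow n z
    have hny : (n : ℝ) * y ^ ρ ≤ 1 / 4 * (z / (2 * l)) := by
      rw [hy, Real.mul_rpow (by positivity) (by positivity), ← mul_assoc]
      gcongr
      calc ((z : ℝ) / (2 * l)) ^ ρ ≤ (z / (2 * l)) ^ (1 : ℝ) :=
            Real.rpow_le_rpow_of_exponent_ge (by positivity) hzl hρ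
        _ = _ := Real.rpow_one _
    have h2z : (z : ℝ) ≤ 2 ^ z := by exact_mod_cast z.lt_two_pow_self.le
    calc _ ≤ (n : ℝ) ^ z * y ^ (ρ * (z : ℝ)) := by gcongr
      _ = ((n : ℝ) * y ^ ρ) ^ z := by
          rw [mul_pow, ← Real.rpow_natCast (y ^ ρ), ← Real.rpow_mul hy0.le]
      _ ≤ (1 / 4 * (z / (2 * l))) ^ z := by gcongr
      _ ≤ (1 / 4) ^ z * (z / (2 * l)) := by
          rw [mul_pow]
          gcongr
          exact pow_le_of_le_one (by positivity) hzl (by omega)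
      _ ≤ (1 / 4) ^ z * (2 ^ z / (2 * l)) := by gcongr
      _ = _ := by
          rw [show (1 / 4 : ℝ) = 1 / 2 * (1 / 2) by norm_num, mul_pow]
          have : (1 / 2 : ℝ) ^ z * 2 ^ z = 1 := by rw [← mul_pow]; norm_num
          rw [div_eq_mul_inv, one_div (2 * l)]
          linear_combination ((1 / 2 : ℝ) ^ z * (2 * l)⁻¹) * this
  refine (bprob_mono h0 h1 (Q' := fun S => ∃ z ∈ Finset.Icc 1 L,
      ∃ Z ∈ (Finset.univ : Finset (Fin n)).powersetCard z, Q z Z S) ?_).trans ?_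
  · rintro S ⟨X, heX, hX3, hXL, hX⟩
    have hsd : (X \ e.toFinset).card = X.card - 2 := by
      rw [Finset.card_sdiff_of_subset heX, hec]
    refine ⟨X.card - 2, Finset.mem_Icc.2 ⟨by omega, by omega⟩, X \ e.toFinset,
      Finset.mem_powersetCard.2 ⟨Finset.subset_univ _, hsd⟩, ?_⟩
    change ρ * ((X.card - 2 : ℕ) : ℝ) ≤ _
    rw [Finset.union_sdiff_of_subset heX, Nat.cast_sub (by omega)]
    exact_mod_cast hX
  · refine (bprob_exists_le h0 h1 _ _).trans ((Finset.sum_le_sum hterm).trans ?_)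
    rw [← Finset.sum_mul]
    have h2 : ∑ z ∈ Finset.Icc 1 L, (1 / 2 : ℝ) ^ z ≤ 2 := by
      refine le_trans (b := ∑ z ∈ Finset.range (L + 1), (1 / 2 : ℝ) ^ z) ?_
        (sum_geometric_two_le _)
      refine Finset.sum_le_sum_of_subset_of_nonneg (fun z hz => ?_) fun _ _ _ => by positivity
      rw [Finset.mem_range]
      have := (Finset.mem_Icc.1 hz).2
      omega
    calc _ ≤ 2 * (1 / (2 * l)) := by gcongr
      _ = 1 / l := by field_simp

/-- The lower bound on the percolation threshold, uniformly in `p`. -/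
theorem exists_percProb_le {W : Type*} [Fintype W] {H : SimpleGraph W} (hρ : 1 ≤ ρ)
    (hH : ENNReal.ofReal ρ ≤ activationDensity H) :
    ∃ ε₀ > (0 : ℝ), ∀ᶠ n : ℕ in Filter.atTop, ∀ p : I, 0 < (p : ℝ) →
      (n : ℝ) * (p : ℝ) ^ ρ * Real.log n ^ ρ ≤ ε₀ →
      percProb H n p ≤ Real.exp (-Real.log n) + 2 / Real.log n := by
  have hρ0 : 0 < ρ := by linarith
  -- K = ρ N must cover the cores both of copies of H and of single pairs.
  set N := max (Fintype.card W) 2 with hN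
  have hN2 : (2 : ℝ) ≤ N := by exact_mod_cast le_max_right _ _
  refine ⟨Real.exp (-(2 * N + 6)) / 26 ^ ρ, by positivity, ?_⟩
  filter_upwards [Filter.eventually_ge_atTop 2,
    tendsto_log_natCast.eventually (Filter.eventually_ge_atTop (2 * (N : ℝ)))]
    with n hn hln p hp0 hp
  have hp1 : (p : ℝ) ≤ 1 := p.2.2
  have h0 : ∀ e : Sym2 (Fin n), 0 ≤ edgeProb (p : ℝ) e := edgeProb_nonneg hp0.le
  have h1 : ∀ e : Sym2 (Fin n), edgeProb (p : ℝ) e ≤ 1 := edgeProb_le_one hp1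
  have hn1 : (1 : ℝ) ≤ n := by exact_mod_cast (by omega : 1 ≤ n)
  have hnl := Real.exp_log (show (0 : ℝ) < n by linarith)
  set l := Real.log n with hl
  have hl4 : 4 ≤ l := by linarith
  have hl0 : 0 < l := by linarith
  have hpl0 : 0 ≤ (p : ℝ) * l := by positivity
  have hε : (n : ℝ) * (26 * (p * l)) ^ ρ ≤ Real.exp (-(2 * N + 6)) := by
    rw [le_div_iff₀ (by positivity)] at hp
    refine le_trans (le_of_eq ?_) hp
    rw [Real.mul_rpow (by norm_num) hpl0, Real.mul_rpow hp0.le hl0.le]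
    ring
  have h14 : Real.exp (-(2 * N + 6)) ≤ 1 / 4 := by
    rw [Real.exp_neg, ← one_div]
    refine one_div_le_one_div_of_le (by norm_num) ?_
    linarith [Real.add_one_le_exp (2 * (N : ℝ) + 6)]
  have hpl : (p : ℝ) * l ≤ 1 / 26 := by
    by_contra! hlt
    have h2 : 1 ≤ (26 * ((p : ℝ) * l)) ^ ρ := Real.one_le_rpow (by linarith) hρ0.le
    nlinarith
  obtain ⟨L, hL⟩ : ∃ L, L = ⌈l⌉₊ := ⟨_, rfl⟩
  have hlL : l ≤ L := hL ▸ Nat.le_ceil l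
  have hLl : (L : ℝ) ≤ 2 * l := by
    have := Nat.ceil_lt_add_one hl0.le
    rw [← hL] at this
    linarith
  have hNL : N ≤ L := by
    have : (N : ℝ) ≤ L := by linarith
    exact_mod_cast this
  have he : ¬ (s((⟨0, by omega⟩ : Fin n), ⟨1, by omega⟩)).IsDiag := by
    rw [Sym2.mk_isDiag_iff]
    simp
  set e : Sym2 (Fin n) := s(⟨0, by omega⟩, ⟨1, by omega⟩) with hedef
  have hb1 := bprob_exists_le_excess_le (N := N) hp0 hp1 hρ (by linarith) hnl.symm hlL hLl hln hpl
    hε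
  have hb2 := bprob_exists_dense_le hp0 hp1 hρ (by linarith) (by omega : 0 < n) hLl hpl
    (hε.trans h14) he
  have hb3 : bprob (edgeProb (p : ℝ)) (fun S : Finset (Sym2 (Fin n)) => {e} ⊆ S) ≤ 1 / l := by
    rw [bprob_subset, le_div_iff₀ hl0]
    refine (mul_le_mul_of_nonneg_right (prod_edgeProb_le hp0.le _) hl0.le).trans ?_
    rw [Finset.card_singleton, pow_one]
    linarith
  -- Percolation makes the fixed pair e active, so the gap fails, or e lies in a small dense set, or
  -- e is an initial edge.
  rw [percProb_eq_bprob]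
  refine (bprob_mono h0 h1 (Q' := fun S => (∃ X : Finset (Fin n), L < X.card ∧
      X.card ≤ 2 * L ∧ -(ρ * N) ≤
        excess (SimpleGraph.fromEdgeSet (S : Set (Sym2 (Fin n)))) ρ X) ∨
      (∃ X : Finset (Fin n), e.toFinset ⊆ X ∧ 3 ≤ X.card ∧ X.card ≤ L ∧ ρ * ((X.card : ℝ) - 2) ≤
        eIn (SimpleGraph.fromEdgeSet (S : Set (Sym2 (Fin n)))) X) ∨ {e} ⊆ S) ?_).trans ?_
  · intro S hS
    by_contra! hcon
    obtain ⟨hc1, hc2, hc3⟩ := hcon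
    obtain ⟨X, hX1, hX2, hX3, hX4⟩ := exists_dense_of_mem_hClosure H hρ0 hH
      (G := SimpleGraph.fromEdgeSet (S : Set (Sym2 (Fin n)))) (L := L)
      ((le_max_left _ _).trans hNL) ((le_max_right _ _).trans hNL) (K := ρ * N)
      (by gcongr; exact le_max_left _ _) (by gcongr) hc1 (e := e)
      (by rw [hS, SimpleGraph.edgeSet_top]; exact he)
      (fun h => hc3 (by
        rw [SimpleGraph.edgeSet_fromEdgeSet] at h
        exact Finset.singleton_subset_iff.2 h.1))
    exact absurd hX4 (not_le.2 (hc2 X hX1 hX2 hX3))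
  · refine (bprob_or_le h0 h1 _ _).trans ?_
    have := bprob_or_le h0 h1 (fun S => ∃ X : Finset (Fin n), e.toFinset ⊆ X ∧ 3 ≤ X.card ∧
      X.card ≤ L ∧ ρ * ((X.card : ℝ) - 2) ≤
        eIn (SimpleGraph.fromEdgeSet (S : Set (Sym2 (Fin n)))) X) (fun S => {e} ⊆ S)
    have h2l : 2 / l = 1 / l + 1 / l := by ring
    linarith

lemma tendsto_exp_neg_log_add : Filter.Tendsto
    (fun n : ℕ => Real.exp (-Real.log n) + 2 / Real.log n) Filter.atTop (nhds 0) := by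
  simpa using (Real.tendsto_exp_neg_atTop_nhds_zero.comp tendsto_log_natCast).add
    (tendsto_log_natCast.const_div_atTop 2)

end LowerBound

end GraphBootstrap

/-! ### The critical threshold and the edgeless case -/

namespace GraphBootstrap

lemma hClosure_eq_self_of_isEmpty {W V : Type*} [IsEmpty W] (H : SimpleGraph W)
    (G : SimpleGraph V) : hClosure H G = G := by
  refine le_antisymm (hClosure_le le_rfl ?_) (le_hClosure H G)
  rintro e ⟨φ, he, -⟩
  rw [SimpleGraph.edgeSet_map] at he
  obtain ⟨x, -, -⟩ := he
  induction x with | _ a b => exact isEmptyElim a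

lemma rootedDensity_ne_top {V : Type*} [Finite V] (A : SimpleGraph V) (e : Sym2 V) :
    rootedDensity A e ≠ ⊤ := by
  refine ne_top_of_le_ne_top (ENNReal.natCast_ne_top (Nat.card (Sym2 V)))
    (iSup_le fun F => iSup_le fun _ => iSup_le fun hF => ENNReal.div_le_of_le_mul ?_)
  have h1 : (1 : ℝ≥0∞) ≤ (F.verts.ncard : ℝ≥0∞) - 2 := by
    rw [← Nat.cast_ofNat, ← ENNReal.natCast_sub]
    exact_mod_cast (by omega : 1 ≤ F.verts.ncard - 2)
  calc (F.edgeSet.ncard : ℝ≥0∞) - 1 ≤ F.edgeSet.ncard := tsub_le_self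
    _ ≤ Nat.card (Sym2 V) := by
        exact_mod_cast (Set.ncard_le_ncard (Set.subset_univ F.edgeSet)).trans_eq (Set.ncard_univ _)
    _ ≤ _ := le_mul_of_one_le_right' h1

/-- A copy of H minus one edge restores that edge in a single step, and any finite witness has
finite density. -/
lemma activationDensity_ne_top {W : Type*} [Finite W] {H : SimpleGraph W} {v w : W}
    (h : H.Adj v w) : activationDensity H ≠ ⊤ := by
  obtain ⟨k, ⟨i⟩⟩ := Finite.exists_equiv_fin W
  set φ : W ↪ Fin k := i.toEmbedding with hφ
  set e : Sym2 (Fin k) := s(φ v, φ w) with he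
  set A : SimpleGraph (Fin k) := SimpleGraph.fromEdgeSet ((H.map φ).edgeSet \ {e}) with hA
  have heH : e ∈ (H.map φ).edgeSet := by
    rw [he, SimpleGraph.mem_edgeSet]
    exact (SimpleGraph.map_adj_apply (f := φ)).2 h
  have hAe : e ∉ A.edgeSet := by
    rw [hA, SimpleGraph.edgeSet_fromEdgeSet]
    exact fun h => h.1.2 rfl
  have hsub : (H.map φ).edgeSet \ {e} ⊆ A.edgeSet := by
    rw [hA, SimpleGraph.edgeSet_fromEdgeSet]
    exact fun x hx => ⟨hx, SimpleGraph.not_isDiag_of_mem_edgeSet _ hx.1⟩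
  have hcl : e ∈ (hClosure H A).edgeSet := isHClosed_hClosure H A e
    ⟨φ, heH, hsub.trans (SimpleGraph.edgeSet_mono (le_hClosure H A))⟩
  refine ne_top_of_le_ne_top (rootedDensity_ne_top A e) ?_
  exact iInf_le_of_le (Fin k) (iInf_le_of_le inferInstance (iInf_le_of_le A (iInf_le_of_le e
    (iInf_le _ ⟨hcl, hAe⟩))))

lemma percProb_one {W : Type*} (H : SimpleGraph W) (n : ℕ) : percProb H n 1 = 1 := by
  classical
  refine le_antisymm (percProb_le_one H n 1) ?_
  rw [percProb_eq_bprob]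
  have h0 : ∀ e : Sym2 (Fin n), 0 ≤ edgeProb ((1 : I) : ℝ) e := edgeProb_nonneg zero_le_one
  have h1 : ∀ e : Sym2 (Fin n), edgeProb ((1 : I) : ℝ) e ≤ 1 := edgeProb_le_one le_rfl
  set T : Finset (Sym2 (Fin n)) := Finset.univ.filter fun e => ¬ e.IsDiag with hT
  have h : bprob (edgeProb ((1 : I) : ℝ)) (fun S => T ⊆ S) = 1 := by
    rw [bprob_subset, prod_edgeProb fun e he => (Finset.mem_filter.1 he).2]
    simp
  rw [← h]
  refine bprob_mono h0 h1 fun S hS => top_le_iff.1 (le_trans ?_ (le_hClosure H _))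
  intro a b hab
  rw [SimpleGraph.fromEdgeSet_adj]
  rw [SimpleGraph.top_adj] at hab
  exact ⟨hS (Finset.mem_filter.2 ⟨Finset.mem_univ _, by simpa using hab⟩), hab⟩

lemma pc_le {W : Type*} {H : SimpleGraph W} {n : ℕ} {p : I} (hp : 0 < (p : ℝ))
    (h : 1 / 2 ≤ percProb H n p) : pc n H ≤ p :=
  csInf_le ⟨0, fun _ hx => by obtain ⟨_, _, hx, _⟩ := hx; exact hx.le⟩ ⟨p, rfl, hp, h⟩

lemma le_pc {W : Type*} {H : SimpleGraph W} {n : ℕ} {t : ℝ}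
    (h : ∀ p : I, 0 < (p : ℝ) → 1 / 2 ≤ percProb H n p → t ≤ p) : t ≤ pc n H := by
  refine le_csInf ⟨1, 1, rfl, one_pos, by rw [percProb_one]; norm_num⟩ ?_
  rintro x ⟨p, rfl, hp, hx⟩
  exact h p hp hx

lemma pc_nonneg {W : Type*} (H : SimpleGraph W) (n : ℕ) : 0 ≤ pc n H :=
  le_pc fun _ hp _ => hp.le

lemma pc_le_one {W : Type*} (H : SimpleGraph W) (n : ℕ) : pc n H ≤ 1 :=
  pc_le (p := 1) one_pos (by rw [percProb_one]; norm_num)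

lemma half_le_pc_of_isEmpty {W : Type*} [IsEmpty W] (H : SimpleGraph W) {n : ℕ} (hn : 2 ≤ n) :
    1 / 2 ≤ pc n H := by
  refine le_pc fun p hp h => h.trans ?_
  rw [percProb_eq_bprob]
  set e : Sym2 (Fin n) := s(⟨0, by omega⟩, ⟨1, by omega⟩) with he
  have hle : bprob (edgeProb (p : ℝ)) (fun S : Finset (Sym2 (Fin n)) => {e} ⊆ S) ≤ p := by
    rw [bprob_subset]
    exact (prod_edgeProb_le hp.le _).trans_eq (by simp)
  refine le_trans (bprob_mono (edgeProb_nonneg hp.le) (edgeProb_le_one p.2.2) fun S hS => ?_) hle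
  rw [hClosure_eq_self_of_isEmpty] at hS
  have : (SimpleGraph.fromEdgeSet (S : Set (Sym2 (Fin n)))).Adj ⟨0, by omega⟩ ⟨1, by omega⟩ := by
    rw [hS, SimpleGraph.top_adj]; simp
  rw [SimpleGraph.fromEdgeSet_adj] at this
  exact Finset.singleton_subset_iff.2 this.1

lemma isBigO_pc_lower {W : Type*} [Fintype W] {H : SimpleGraph W} {ρ : ℝ} (hρ : 1 < ρ)
    (hH : activationDensity H = ENNReal.ofReal ρ) :
    (fun n : ℕ => 1 / Real.log n) =O[Filter.atTop] fun n : ℕ => (n : ℝ) ^ ρ⁻¹ * pc n H := by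
  obtain ⟨ε, hε0, hε⟩ := exists_percProb_le hρ.le hH.ge
  have hρ0 : 0 < ρ := by linarith
  have hlt := tendsto_exp_neg_log_add.eventually (Iio_mem_nhds (show (0 : ℝ) < 1 / 2 by norm_num))
  refine Asymptotics.IsBigO.of_bound ((ε ^ ρ⁻¹)⁻¹) ?_
  filter_upwards [hε, hlt, Filter.eventually_gt_atTop 0,
    tendsto_log_natCast.eventually (Filter.eventually_gt_atTop 0)] with n h1 h2 hn hl
  have hnR : (0 : ℝ) < n := by exact_mod_cast hn
  have hεp : 0 < ε ^ ρ⁻¹ := by positivity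
  rw [Real.norm_of_nonneg (by positivity),
    Real.norm_of_nonneg (mul_nonneg (by positivity) (pc_nonneg H n)), inv_mul_eq_div,
    le_div_iff₀ hεp]
  have hpc : (ε / n) ^ ρ⁻¹ / Real.log n ≤ pc n H := by
    refine le_pc fun p hp hperc => ?_
    by_contra! hlt
    refine absurd (h1 p hp ?_) (not_le.2 (lt_of_lt_of_le h2 hperc))
    rw [lt_div_iff₀ hl] at hlt
    rw [mul_assoc, ← Real.mul_rpow hp.le hl.le]
    calc (n : ℝ) * (p * Real.log n) ^ ρ ≤ n * ((ε / n) ^ ρ⁻¹) ^ ρ := by gcongr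
      _ = ε := by
          rw [← Real.rpow_mul (by positivity), inv_mul_cancel₀ hρ0.ne', Real.rpow_one]
          field_simp
  calc 1 / Real.log n * ε ^ ρ⁻¹ = (n : ℝ) ^ ρ⁻¹ * ((ε / n) ^ ρ⁻¹ / Real.log n) := by
        rw [Real.div_rpow hε0.le hnR.le]
        field_simp
    _ ≤ _ := by gcongr

/-- Every `ρ > 1` has a valid denominator `b` for which the exponent `2 + 2 / b` is at most
`2 ρ`. -/
lemma exists_denominator {ρ : ℝ} (hρ : 1 < ρ) : ∃ b : ℕ, 0 < b ∧
    (Irrational ρ ∨ ∃ a : ℕ, a.Coprime b ∧ ρ = (a : ℝ) / (b : ℝ)) ∧ 2 + 2 / (b : ℝ) ≤ 2 * ρ := by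
  by_cases h : Irrational ρ
  · obtain ⟨b, hb⟩ := exists_nat_gt (1 / (ρ - 1))
    have hρ1 : 0 < ρ - 1 := by linarith
    have hb0 : (0 : ℝ) < b := lt_trans (by positivity) hb
    refine ⟨b, by exact_mod_cast hb0, Or.inl h, ?_⟩
    rw [div_lt_iff₀ hρ1] at hb
    have : 2 / (b : ℝ) ≤ 2 * (ρ - 1) := by
      rw [div_le_iff₀ hb0]; linarith
    linarith
  · rw [Irrational, not_not] at h
    obtain ⟨q, rfl⟩ := h
    have hq1 : 1 < q := by exact_mod_cast hρ
    have hq : (q : ℝ) = (q.num.natAbs : ℝ) / (q.den : ℝ) := by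
      have h1 : (q.num.natAbs : ℤ) = q.num := Int.natAbs_of_nonneg (Rat.num_nonneg.2 (by linarith))
      rw [← Int.cast_natCast q.num.natAbs, h1, Rat.cast_def]
    have hden : (0 : ℝ) < q.den := by exact_mod_cast q.den_pos
    refine ⟨q.den, q.den_pos, Or.inr ⟨q.num.natAbs, q.reduced, hq⟩, ?_⟩
    -- ρ = a/b > 1 forces a ≥ b + 1, hence 2 + 2/b = 2(b + 1)/b ≤ 2a/b.
    have hlt : q.den + 1 ≤ q.num.natAbs := by
      rw [hq, lt_div_iff₀ hden, one_mul] at hρ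
      exact_mod_cast hρ
    have hlt' : (q.den : ℝ) + 1 ≤ q.num.natAbs := by exact_mod_cast hlt
    rw [hq]
    calc 2 + 2 / (q.den : ℝ) = 2 * ((q.den + 1) / q.den) := by field_simp
      _ ≤ _ := by gcongr

/-- Taking the ρ-th root turns the factor log^(2+2/b) into a power of log at most 2, for b from
`exists_denominator`. -/
lemma isBigO_pc_upper {W : Type*} [Fintype W] {H : SimpleGraph W} {ρ : ℝ} (hρ : 1 < ρ)
    (hH : activationDensity H = ENNReal.ofReal ρ) :
    (fun n : ℕ => (n : ℝ) ^ ρ⁻¹ * pc n H) =O[Filter.atTop] fun n : ℕ => Real.log n ^ 2 := by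
  obtain ⟨b, hb0, hb, hbρ⟩ := exists_denominator hρ
  obtain ⟨A, hA0, hA⟩ := tendsto_percProb_one hρ.le hH hb0 hb
  have hρ0 : 0 < ρ := by linarith
  let t : ℕ → ℝ := fun n => (A * Real.log n ^ (2 + 2 / (b : ℝ)) / n) ^ ρ⁻¹
  -- The truncation only makes p a probability for small n; eventually t n ≤ 1.
  let p : ℕ → I := fun n => Set.projIcc 0 1 zero_le_one (t n)
  have hbase : ∀ᶠ n : ℕ in Filter.atTop, 0 < n ∧ 1 ≤ Real.log n ∧
      A * Real.log n ^ (2 + 2 / (b : ℝ)) / n ≤ 1 := by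
    filter_upwards [Filter.eventually_gt_atTop 0,
      tendsto_log_natCast.eventually (Filter.eventually_ge_atTop 1),
      tendsto_log_natCast.eventually (eventually_mul_rpow_le_exp A (2 + 2 / (b : ℝ)) one_pos)]
      with n hn hl h
    have hnR : (0 : ℝ) < n := by exact_mod_cast hn
    refine ⟨hn, hl, ?_⟩
    rw [div_le_one hnR]
    rwa [one_mul, Real.exp_log hnR] at h
  have hpt : ∀ᶠ n : ℕ in Filter.atTop, (p n : ℝ) = t n := by
    filter_upwards [hbase] with n ⟨hn, hl, h⟩
    have hnR : (0 : ℝ) < n := by exact_mod_cast hn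
    have h0 : 0 ≤ A * Real.log n ^ (2 + 2 / (b : ℝ)) / n := by positivity
    simp only [p]
    rw [Set.projIcc_of_mem zero_le_one
      ⟨Real.rpow_nonneg h0 _, Real.rpow_le_one h0 h (by positivity)⟩]
  have hlim := hA A le_rfl p (by
    filter_upwards [hbase, hpt] with n ⟨hn, hl, h⟩ hp
    have hnR : (0 : ℝ) < n := by exact_mod_cast hn
    rw [hp, ← Real.rpow_mul (by positivity), inv_mul_cancel₀ hρ0.ne', Real.rpow_one]
    field_simp)
  refine Asymptotics.IsBigO.of_bound (A ^ ρ⁻¹) ?_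
  filter_upwards [hbase, hpt, hlim.eventually (Ioi_mem_nhds (show (1 / 2 : ℝ) < 1 by norm_num))]
    with n ⟨hn, hl, h⟩ hp hperc
  have hnR : (0 : ℝ) < n := by exact_mod_cast hn
  have hl0 : 0 < Real.log n := by linarith
  rw [Real.norm_of_nonneg (mul_nonneg (by positivity) (pc_nonneg H n)),
    Real.norm_of_nonneg (by positivity)]
  have hp0 : 0 < (p n : ℝ) := by rw [hp]; positivity
  have hpc : pc n H ≤ t n := hp ▸ pc_le hp0 (le_of_lt hperc)
  calc (n : ℝ) ^ ρ⁻¹ * pc n H ≤ (n : ℝ) ^ ρ⁻¹ * t n := by gcongr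
    _ = A ^ ρ⁻¹ * Real.log n ^ ((2 + 2 / (b : ℝ)) * ρ⁻¹) := by
        simp only [t]
        rw [← Real.mul_rpow hnR.le (by positivity), mul_div_cancel₀ _ hnR.ne',
          Real.mul_rpow hA0.le (by positivity), ← Real.rpow_mul hl0.le]
    _ ≤ A ^ ρ⁻¹ * Real.log n ^ (2 : ℝ) := by
        gcongr
        rw [← div_eq_mul_inv, div_le_iff₀ hρ0]
        exact hbρ
    _ = _ := by norm_num

lemma isBigO_pc_of_isEmpty {W : Type*} [IsEmpty W] (H : SimpleGraph W) :
    ((fun n : ℕ => 1 / Real.log n) =O[Filter.atTop] fun n : ℕ => pc n H) ∧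
      (fun n : ℕ => pc n H) =O[Filter.atTop] fun n : ℕ => Real.log n ^ 2 := by
  refine ⟨Asymptotics.IsBigO.of_bound 2 ?_, Asymptotics.IsBigO.of_bound 1 ?_⟩ <;>
  filter_upwards [Filter.eventually_ge_atTop 2,
    tendsto_log_natCast.eventually (Filter.eventually_ge_atTop 1)] with n hn hl
  · rw [Real.norm_of_nonneg (by positivity), Real.norm_of_nonneg (pc_nonneg H n)]
    have h1 : 1 / Real.log n ≤ 1 := by rw [div_le_one (by linarith)]; exact hl
    linarith [half_le_pc_of_isEmpty H hn]
  · rw [Real.norm_of_nonneg (pc_nonneg H n), Real.norm_of_nonneg (by positivity), one_mul]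
    exact (pc_le_one H n).trans (one_le_pow₀ hl)

lemma tendsto_percProb_zero {W : Type*} [Fintype W] {H : SimpleGraph W} {ρ : ℝ} (hρ : 1 ≤ ρ)
    (hH : activationDensity H = ENNReal.ofReal ρ) :
    ∃ ε₀ > (0 : ℝ), ∀ ε : ℝ, 0 < ε → ε < ε₀ → ∀ p : ℕ → I,
      (∀ᶠ n : ℕ in Filter.atTop, (n : ℝ) * (p n : ℝ) ^ ρ * Real.log n ^ ρ = ε) →
      Filter.Tendsto (fun n : ℕ => percProb H n (p n)) Filter.atTop (nhds 0) := by
  obtain ⟨ε₀, hε₀, h⟩ := exists_percProb_le hρ hH.ge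
  refine ⟨ε₀, hε₀, fun ε hε hlt p hp => ?_⟩
  refine tendsto_of_tendsto_of_tendsto_of_le_of_le' tendsto_const_nhds tendsto_exp_neg_log_add
    (Filter.Eventually.of_forall fun n => percProb_nonneg H n (p n)) ?_
  filter_upwards [h, hp] with n hn hpn
  refine hn (p n) (lt_of_le_of_ne (p n).2.1 fun h0 => ?_) (hpn.le.trans hlt.le)
  rw [← h0, Real.zero_rpow (by linarith), mul_zero, zero_mul] at hpn
  exact hε.ne hpn

end GraphBootstrap
theorem theorem2 {W : Type*} [Finite W] (H : SimpleGraph W) (hH : ∀ v, ∃ w, H.Adj v w)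
    (hρ : 1 < GraphBootstrap.activationDensity H) :
    -- bounds on the critical threshold, where `1/ρ = 0` if `ρ = ∞`
    ((fun n : ℕ => 1 / Real.log n) =O[Filter.atTop]
        (fun n : ℕ => (n : ℝ) ^ ((GraphBootstrap.activationDensity H)⁻¹).toReal *
          GraphBootstrap.pc n H) ∧
      (fun n : ℕ => (n : ℝ) ^ ((GraphBootstrap.activationDensity H)⁻¹).toReal *
          GraphBootstrap.pc n H) =O[Filter.atTop]
        (fun n : ℕ => Real.log n ^ 2)) ∧
    -- the two parts, for finite `ρ`
    (∀ ρ : ℝ, GraphBootstrap.activationDensity H = ENNReal.ofReal ρ →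
      -- lower bound: with high probability, no percolation
      (∃ ε₀ > (0 : ℝ), ∀ ε : ℝ, 0 < ε → ε < ε₀ → ∀ p : ℕ → unitInterval,
        (∀ᶠ n : ℕ in Filter.atTop, (n : ℝ) * (p n : ℝ) ^ ρ * Real.log n ^ ρ = ε) →
        Filter.Tendsto (fun n : ℕ => GraphBootstrap.percProb H n (p n))
          Filter.atTop (nhds 0)) ∧
      -- upper bound: with high probability, percolation
      (∀ b : ℕ, 0 < b → (Irrational ρ ∨ ∃ a : ℕ, a.Coprime b ∧ ρ = (a : ℝ) / (b : ℝ)) →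
        ∃ A₀ > (0 : ℝ), ∀ A : ℝ, A₀ ≤ A → ∀ p : ℕ → unitInterval,
          (∀ᶠ n : ℕ in Filter.atTop,
            (n : ℝ) * (p n : ℝ) ^ ρ = A * Real.log n ^ (2 + 2 / (b : ℝ))) →
          Filter.Tendsto (fun n : ℕ => GraphBootstrap.percProb H n (p n))
            Filter.atTop (nhds 1))) := by
  have := Fintype.ofFinite W
  have one_lt : ∀ {ρ : ℝ}, GraphBootstrap.activationDensity H = ENNReal.ofReal ρ → 1 < ρ :=
    fun h => ENNReal.one_lt_ofReal.1 (h ▸ hρ)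
  refine ⟨?_, fun ρ h => ⟨GraphBootstrap.tendsto_percProb_zero (one_lt h).le h,
    fun b hb hρb => GraphBootstrap.tendsto_percProb_one (one_lt h).le h hb hρb⟩⟩
  -- Without isolated vertices, H is edgeless only if it has no vertices; then nothing is ever
  -- activated and ρ = ∞.
  rcases isEmpty_or_nonempty W with hW | ⟨⟨v⟩⟩
  · have htop : GraphBootstrap.activationDensity H = ⊤ := by
      refine iInf_eq_top.2 fun V => iInf_eq_top.2 fun _ => iInf_eq_top.2 fun A =>
        iInf_eq_top.2 fun e => iInf_eq_top.2 fun he => ?_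
      rw [GraphBootstrap.hClosure_eq_self_of_isEmpty] at he
      exact absurd he.1 he.2
    simpa [htop] using GraphBootstrap.isBigO_pc_of_isEmpty H
  · obtain ⟨w, hw⟩ := hH v
    have h := (ENNReal.ofReal_toReal (GraphBootstrap.activationDensity_ne_top hw)).symm
    rw [ENNReal.toReal_inv]
    exact ⟨GraphBootstrap.isBigO_pc_lower (one_lt h) h, GraphBootstrap.isBigO_pc_upper (one_lt h) h⟩
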